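/- **Notation.** Fix a smooth function $\varphi:\mathbb R^3\to\mathbb R$ supported in the closed unit ball with $\varphi=1$ on $B(0,1/2)$. For $N>0$ let $P_{\le N}$ be the Fourier multiplier $\widehat{P_{\le N}f}(\xi)=\varphi(\xi/N)\hat f(\xi)$ (with $\hat f(\xi)=\int f(x)e^{-2\pi i x\cdot\xi}\,dx$), that is, convolution with the inverse Fourier transform of $\varphi(\cdot/N)$, and let $P_N:=P_{\le N}-P_{\le N/2}$. For $1\le p,q<\infty$ and $f:\mathbb R^3\to\mathbb R^3$ let $$\|f\|_{L^{p,q}}:=\Big(p\int_0^\infty \alpha^q\,|\{x:|f(x)|>\alpha\}|^{q/p}\,\frac{d\alpha}{\alpha}\Big)^{1/q}.$$ A classical solution of the Navier–Stokes equations on $[a,b]\times\mathbb R^3$ is a pair $(u,p)$, $u(t,x)\in\mathbb R^3$, $p(t,x)\in\mathbb R$, such that $u$ is continuous on $[a,b]\times\mathbb R^3$, the derivatives $\partial_tu,\nabla u,\nabla^2u,\nabla p$ exist and are continuous on $(a,b)\times\mathbb R^3$, and $\partial_tu-\Delta u+u\cdot\nabla u+\nabla p=0$, $\nabla\cdot u=0$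 hold there pointwise. For constants $C_0,M$ put $M_j:=M^{C_0^j}$. **Proposition (Back propagation).** There is a constant $C\ge 1$, depending only on $\varphi$, such that the following holds for every $C_0\ge C$. Let $3\le \mathfrak q_0<\infty$, $M\ge C_0$, $t_0\in\mathbb R$, $T>0$, and let $(u,p)$ be a classical solution of the Navier–Stokes equations on $[t_0-T,t_0]\times\mathbb R^3$ with $$\|u\|_{L^\infty_tL^{3,\mathfrak q_0}_x([t_0-T,t_0]\times\mathbb R^3)}\le M .$$ Let $(t_1,x_1)\in[t_0-T/2,t_0]\times\mathbb R^3$ and $N_1\ge M_3T^{-1/2}$ be such that $$|P_{N_1}u(t_1,x_1)|\ge M_1^{-1}N_1 .$$ Then there exist $(t_2,x_2)\in[t_0-T,t_1]\times\mathbb R^3$ and $N_2\in[M_2^{-1}N_1,M_2N_1]$ such that $$M_3^{-1}N_1^{-2}\le t_1-t_2\le M_3N_1^{-2},\qquad |x_2-x_1|\le M_3N_1^{-1},\qquad |P_{N_2}u(t_2,x_2)|\ge M_1^{-1}N_2 .$$ -/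

import Mathlib

open MeasureTheory Set
open scoped ContDiff FourierTransform Convolution ENNReal

namespace NSLorentz

/-- Three-dimensional Euclidean space. -/
abbrev E3 : Type := EuclideanSpace ℝ (Fin 3)

/-- Its complexification `ℂ³`, in which Fourier multipliers of vector fields take their values. -/
abbrev C3 : Type := EuclideanSpace ℂ (Fin 3)

/-- The inclusion of `ℝ³` in `ℂ³`. -/
noncomputable def toC3 (v : E3) : C3 := WithLp.toLp 2 (fun i => (v i : ℂ))

/-! ### Lorentz quasinorm -/

/-- The distribution function `d_f(α) = |{x : |f x| > α}|`. -/
noncomputable def distFun (f : E3 → E3) (α : ℝ) : ℝ≥0∞ :=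
  volume {x : E3 | α < ‖f x‖}

/-- The Lorentz quasinorm `(p ∫₀^∞ α^q d_f(α)^(q/p) dα/α)^(1/q)` for finite `p` and `q`,
with values in `[0, ∞]`. -/
noncomputable def lorentzNorm (p q : ℝ) (f : E3 → E3) : ℝ≥0∞ :=
  (ENNReal.ofReal p *
    ∫⁻ α in Ioi (0 : ℝ), ENNReal.ofReal (α ^ q) * distFun f α ^ (q / p) / ENNReal.ofReal α)
      ^ (1 / q)

/-- The norm of `L^∞_t L^{p,q}_x` on the slab `[a, b] × ℝ³`. -/
noncomputable def supLorentzNorm (p q a b : ℝ) (u : ℝ → E3 → E3) : ℝ≥0∞ :=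
  essSup (fun t => lorentzNorm p q (u t)) (volume.restrict (Icc a b))

/-! ### Littlewood-Paley projections -/

/-- `φ` is a smooth bump function on the unit ball which equals `1` on the ball of
radius `1/2`. -/
structure IsBump (φ : E3 → ℝ) : Prop where
  smooth : ContDiff ℝ ∞ φ
  support_subset : Function.support φ ⊆ Metric.closedBall 0 1
  eq_one : ∀ ξ ∈ Metric.ball (0 : E3) (1 / 2), φ ξ = 1

/-- The symbol `ξ ↦ φ(ξ/N)` of `P_{≤N}`. -/
noncomputable def symbolLe (φ : E3 → ℝ) (N : ℝ) (ξ : E3) : ℂ := (φ (N⁻¹ • ξ) : ℂ)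

/-- The convolution kernel of `P_{≤N}`: the inverse Fourier transform of its symbol. -/
noncomputable def kernelLe (φ : E3 → ℝ) (N : ℝ) : E3 → ℂ := 𝓕⁻ (symbolLe φ N)

/-- `P_{≤N}`, the Fourier multiplier with symbol `φ(ξ/N)`, as the convolution with its (Schwartz)
kernel; this makes sense pointwise for every function in a Lorentz space `L^{3,q}`.
See `fourier_projLe`. -/
noncomputable def projLe (φ : E3 → ℝ) (N : ℝ) (f : E3 → C3) : E3 → C3 :=
  kernelLe φ N ⋆[ContinuousLinearMap.lsmul ℂ ℂ] f

/-- `P_N u = P_{≤N} u - P_{≤N/2} u` for a real vector field `u`. -/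
noncomputable def proj (φ : E3 → ℝ) (N : ℝ) (f : E3 → E3) (x : E3) : C3 :=
  projLe φ N (fun y => toC3 (f y)) x - projLe φ (N / 2) (fun y => toC3 (f y)) x

/-- The symbol of `P_{≤N}` as a Schwartz function. -/
theorem exists_schwartz_symbolLe {φ : E3 → ℝ} (hφ : IsBump φ) {N : ℝ} (hN : 0 < N) :
    ∃ g : SchwartzMap E3 ℂ, ∀ ξ, g ξ = symbolLe φ N ξ := by
  have hs : ContDiff ℝ ∞ (symbolLe φ N) := by
    have h := hφ.smooth
    unfold symbolLe
    exact Complex.ofRealCLM.contDiff.comp (h.comp (contDiff_const_smul _))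
  have hc : HasCompactSupport (symbolLe φ N) := by
    refine HasCompactSupport.of_support_subset_isCompact (isCompact_closedBall (0 : E3) N) ?_
    intro ξ hξ
    have h1 : φ (N⁻¹ • ξ) ≠ 0 := by
      intro h0
      exact hξ (by simp [symbolLe, h0])
    have h2 : ‖N⁻¹ • ξ‖ ≤ 1 := by simpa using hφ.support_subset h1
    rw [norm_smul, Real.norm_eq_abs, abs_of_pos (inv_pos.2 hN), inv_mul_le_iff₀ hN] at h2
    simpa using h2
  exact ⟨hc.toSchwartzMap hs, fun ξ => rfl⟩

/-- `P_{≤N}` is the Fourier multiplier with symbol `φ(ξ/N)`. -/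
theorem fourier_projLe {φ : E3 → ℝ} (hφ : IsBump φ) {N : ℝ} (hN : 0 < N) {f : E3 → C3}
    (hf : Integrable f) (ξ : E3) :
    𝓕 (projLe φ N f) ξ = (φ (N⁻¹ • ξ) : ℂ) • 𝓕 f ξ := by
  obtain ⟨g, hg⟩ := exists_schwartz_symbolLe hφ hN
  have hg' : symbolLe φ N = g := (funext hg).symm
  have hk : kernelLe φ N = (𝓕⁻ g : SchwartzMap E3 ℂ) := by
    rw [kernelLe, hg', SchwartzMap.fourierInv_coe]
  rw [projLe, hk, Real.fourier_smul_convolution_eq (SchwartzMap.integrable _) hf,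
    ← SchwartzMap.fourier_coe, FourierTransform.fourier_fourierInv_eq, hg]
  rfl

/-! ### The Navier-Stokes equations -/

/-- The divergence of a vector field. -/
noncomputable def divergence (v : E3 → E3) (x : E3) : ℝ :=
  ∑ i : Fin 3, fderiv ℝ v x (EuclideanSpace.single i 1) i

/-- `(u, p)` is a classical solution of the incompressible Navier-Stokes equations on
`[a, b] × ℝ³`: `u` is continuous there, `∂ₜu`, `∇u`, `∇²u` and `∇p` exist and are continuous on
`(a, b) × ℝ³`, and `∂ₜu - Δu + (u · ∇)u + ∇p = 0`, `∇ · u = 0` hold pointwise on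
`(a, b) × ℝ³`. -/
structure IsClassicalSolution (a b : ℝ) (u : ℝ → E3 → E3) (p : ℝ → E3 → ℝ) : Prop where
  continuousOn_u : ContinuousOn (fun z : ℝ × E3 => u z.1 z.2) (Icc a b ×ˢ univ)
  differentiableAt_time : ∀ t ∈ Ioo a b, ∀ x, DifferentiableAt ℝ (fun s => u s x) t
  continuousOn_deriv_time :
    ContinuousOn (fun z : ℝ × E3 => deriv (fun s => u s z.2) z.1) (Ioo a b ×ˢ univ)
  contDiff_space : ∀ t ∈ Ioo a b, ContDiff ℝ 2 (u t)
  continuousOn_fderiv :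
    ContinuousOn (fun z : ℝ × E3 => fderiv ℝ (u z.1) z.2) (Ioo a b ×ˢ univ)
  continuousOn_fderiv_fderiv :
    ContinuousOn (fun z : ℝ × E3 => fderiv ℝ (fderiv ℝ (u z.1)) z.2) (Ioo a b ×ˢ univ)
  differentiable_pressure : ∀ t ∈ Ioo a b, Differentiable ℝ (p t)
  continuousOn_gradient_pressure :
    ContinuousOn (fun z : ℝ × E3 => gradient (p z.1) z.2) (Ioo a b ×ˢ univ)
  momentum : ∀ t ∈ Ioo a b, ∀ x : E3,
    deriv (fun s => u s x) t - Laplacian.laplacian (u t) x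
      + fderiv ℝ (u t) x (u t x) + gradient (p t) x = 0
  div_free : ∀ t ∈ Ioo a b, ∀ x : E3, divergence (u t) x = 0

/-- The constants `M_j = M^(C₀^j)`. -/
noncomputable def Mlevel (C₀ M : ℝ) (j : ℕ) : ℝ := M ^ (C₀ ^ j)

end NSLorentz

/-! Rescale so that `(t₁, x₁) = (0, 0)` and `N₁ = 1`, and put `e = M^(-C₀/24)`, so that `M₁⁻¹ = e²⁴`
and `e⁻²⁴⁰ ≤ M₂`. If the conclusion fails, the solution is quiet: `|P_N u(t, x)| ≤ e²⁴ N` whenever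
`-e⁻²⁴⁰ ≤ t ≤ -e²⁴⁰`, `|x| ≤ e⁻²⁴⁰` and `e²⁴⁰ ≤ N ≤ e⁻²⁴⁰`. Quietness improves itself through the
nonlinearity to `|P_1 u(0, 0)| ≤ C M⁴ e²⁵`, which is below `e²⁴` because `e ≤ M⁻⁵` and `M` is large.
This is the contradiction.

The Lorentz norm enters only through the weak `L³` bound `m = 2M`, valid at every time by continuity
(`IsClassicalSolution.isWeakL3`). The equation enters only through a Duhamel inequality
(`IsBump.exists_duhamel`): `|P_N u(t, x)|` is at most a free term, which decays with `N²(t - s)`,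
plus an integral of `|u|²` against a space-time kernel of total mass `O(1/N)`. Nothing is assumed
about the pressure at infinity, so no Leray projection of `u ⊗ u` is taken. Instead the equation is
tested with the compactly supported divergence-free fields `e_i Δw - ∇∂_i w`, with `w` a truncated
backward heat evolution of the kernel of `-Δ⁻¹P_1`. The pressure then integrates to zero, and `div u
= 0` reduces the test to `∫ u_i Δw`. Letting the truncation radius tend to infinity uses only the
weak `L³` bound.

Averaged over unit balls, Duhamel gives `‖P_N u‖_{L¹} ≲ m²/N` for `N ≥ 1`. Splitting `|u|²` at
height `√N` and using Bernstein, it also gives `‖P_N u‖²_{L²} ≲ m⁴/√N`; hence the frequencies above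
`K` carry local energy at most `m⁴/√K` (`IsBump.exists_setLIntegral_sub_projLe_sq_le`).

For a quiet flow the local energy is now estimated twice. (1) With `K = e⁻⁶`, quietness gives
`|P_{≤K} u| ≲ m e¹⁸`, and the remaining frequencies cost `m⁴ e³`. So the energy is `O(m⁴ e³)`
(`IsBump.exists_locEnergy_le_cube`), and Duhamel upgrades the local `L¹` bound to `‖P_N u‖_{L¹} ≲ m⁴
e³/N`. (2) For `N` between `e⁻⁶` and a cutoff of size at least `e⁻⁶⁰`, quietness in `L^∞` times this
`L¹` bound gives `‖P_N u‖²_{L²} ≲ e²⁴N · m⁴e³/N = m⁴e²⁷`. Summing `J ≤ 54/e` dyadic pieces loses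
`J²`, which leaves `e²⁵`; the tail above the cutoff costs `e³⁰`
(`IsBump.exists_locEnergy_le_of_isQuietFlow`).

One more use of Duhamel, at unit frequency over a time span `e⁻²⁴`, turns the energy bound `e²⁵`
into the claimed bound for `P_1 u`. The final `e²⁴⁰` of time, where quietness is unknown, is so
short that the trivial energy bound suffices. -/

namespace NSLorentz

/-! ### Partial derivatives -/

/-- The partial derivative in the direction of the `a`-th basis vector. -/
noncomputable def pd {F : Type*} [NormedAddCommGroup F] [NormedSpace ℝ F] (a : Fin 3) (f : E3 → F) :
    E3 → F :=
  fun y => fderiv ℝ f y (EuclideanSpace.single a 1)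

/-- The Laplacian as the sum of the second partial derivatives. -/
noncomputable def lap {F : Type*} [NormedAddCommGroup F] [NormedSpace ℝ F] (f : E3 → F) : E3 → F :=
  fun y => ∑ a, pd a (pd a f) y

section pd

variable {F : Type*} [NormedAddCommGroup F] [NormedSpace ℝ F]

theorem contDiff_pd {f : E3 → F} (hf : ContDiff ℝ ∞ f) (a : Fin 3) : ContDiff ℝ ∞ (pd a f) :=
  (hf.fderiv_right (m := ∞) (by simp)).clm_apply contDiff_const

theorem contDiff_lap {f : E3 → F} (hf : ContDiff ℝ ∞ f) : ContDiff ℝ ∞ (lap f) :=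
  ContDiff.sum fun a _ => contDiff_pd (contDiff_pd hf a) a

theorem norm_iteratedFDeriv_pd_le {f : E3 → F} (hf : ContDiff ℝ ∞ f) (a : Fin 3) (n : ℕ) (y : E3) :
    ‖iteratedFDeriv ℝ n (pd a f) y‖ ≤ ‖iteratedFDeriv ℝ (n + 1) f y‖ := by
  have h := (ContinuousLinearMap.apply ℝ F (EuclideanSpace.single a (1 : ℝ) : E3)
    ).norm_iteratedFDeriv_comp_left (x := y) (N := ∞) (n := n)
    ((hf.fderiv_right (m := ∞) (by simp)).contDiffAt) (by exact_mod_cast le_top)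
  rw [norm_iteratedFDeriv_fderiv] at h
  refine h.trans (mul_le_of_le_one_left (norm_nonneg _) ?_)
  refine ContinuousLinearMap.opNorm_le_bound _ zero_le_one fun L => ?_
  have := L.le_opNorm (EuclideanSpace.single a (1 : ℝ) : E3)
  simpa using this

theorem norm_iteratedFDeriv_lap_le {f : E3 → F} (hf : ContDiff ℝ ∞ f) (n : ℕ) (y : E3) :
    ‖iteratedFDeriv ℝ n (lap f) y‖ ≤ 3 * ‖iteratedFDeriv ℝ (n + 2) f y‖ := by
  have h1 : iteratedFDeriv ℝ n (lap f) y = ∑ a, iteratedFDeriv ℝ n (pd a (pd a f)) y := by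
    have h2 : iteratedFDeriv ℝ n (lap f) = ∑ a, iteratedFDeriv ℝ n (pd a (pd a f)) :=
      iteratedFDeriv_sum fun a _ =>
        (contDiff_pd (contDiff_pd hf a) a).of_le (by exact_mod_cast le_top)
    rw [h2, Finset.sum_apply]
  rw [h1]
  refine (norm_sum_le _ _).trans ?_
  refine (Finset.sum_le_card_nsmul _ _ _ fun a _ =>
    (norm_iteratedFDeriv_pd_le (contDiff_pd hf a) a n y).trans
      (norm_iteratedFDeriv_pd_le hf a (n + 1) y)).trans ?_
  simp

theorem norm_pd_le {f : E3 → F} (hf : ContDiff ℝ ∞ f) (a : Fin 3) (y : E3) :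
    ‖pd a f y‖ ≤ ‖iteratedFDeriv ℝ 1 f y‖ := by
  simpa using norm_iteratedFDeriv_pd_le hf a 0 y

end pd

/-! ### The heat evolution of a frequency localised kernel -/

/-- `b` is a smooth symbol supported in the annulus `1/4 ≤ |ξ| ≤ 1`. -/
structure IsAnnular (b : E3 → ℂ) : Prop where
  smooth : ContDiff ℝ ∞ b
  support : ∀ ξ, b ξ ≠ 0 → 1 / 4 ≤ ‖ξ‖ ∧ ‖ξ‖ ≤ 1

/-- The symbol `e^(-4π²σ|ξ|²) b(ξ)`. -/
noncomputable def heatSym (b : E3 → ℂ) (σ : ℝ) (ξ : E3) : ℂ :=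
  Real.exp (-(4 * Real.pi ^ 2 * ‖ξ‖ ^ 2) * σ) • b ξ

/-- The kernel with symbol `e^(-4π²σ|ξ|²) b(ξ)`. -/
noncomputable def heatKer (b : E3 → ℂ) (σ : ℝ) : E3 → ℂ := 𝓕 (heatSym b σ)

theorem contDiff_heatSym_uncurry {b : E3 → ℂ} (hb : ContDiff ℝ ∞ b) :
    ContDiff ℝ ∞ (fun q : ℝ × E3 => heatSym b q.1 q.2) := by
  unfold heatSym
  refine ContDiff.smul (𝕜 := ℝ) (f := fun q : ℝ × E3 => Real.exp (-(4 * Real.pi ^ 2 * ‖q.2‖ ^ 2) * q.1))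
    (g := fun q : ℝ × E3 => b q.2) ?_ (hb.comp contDiff_snd)
  refine ContDiff.exp ?_
  refine ContDiff.mul (ContDiff.neg ?_) contDiff_fst
  exact contDiff_const.mul (contDiff_snd.norm_sq ℝ)

namespace IsAnnular

variable {b : E3 → ℂ}

theorem contDiff_heatSym (hb : IsAnnular b) (σ : ℝ) : ContDiff ℝ ∞ (heatSym b σ) :=
  ContDiff.comp (g := fun q : ℝ × E3 => heatSym b q.1 q.2) (f := fun ξ : E3 => (σ, ξ))
    (contDiff_heatSym_uncurry hb.smooth) (contDiff_const.prodMk contDiff_id)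

theorem isAnnular_heatSym (hb : IsAnnular b) (σ : ℝ) : IsAnnular (heatSym b σ) where
  smooth := hb.contDiff_heatSym σ
  support ξ h := hb.support ξ (fun h0 => h (by simp [heatSym, h0]))

theorem tsupport_subset (hb : IsAnnular b) : tsupport b ⊆ {ξ | 1 / 4 ≤ ‖ξ‖ ∧ ‖ξ‖ ≤ 1} := by
  refine closure_minimal (fun ξ h => hb.support ξ h) ?_
  exact (isClosed_le continuous_const continuous_norm).inter
    (isClosed_le continuous_norm continuous_const)

theorem hasCompactSupport (hb : IsAnnular b) : HasCompactSupport b :=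
  HasCompactSupport.of_support_subset_isCompact (isCompact_closedBall (0 : E3) 1)
    (fun ξ h => by simpa using (hb.support ξ h).2)

theorem integrable_pow (hb : IsAnnular b) (k n : ℕ) :
    Integrable (fun v => ‖v‖ ^ k * ‖iteratedFDeriv ℝ n b v‖) := by
  refine Continuous.integrable_of_hasCompactSupport ?_ ?_
  · exact (continuous_norm.pow k).mul
      (hb.smooth.continuous_iteratedFDeriv (by exact_mod_cast le_top)).norm
  · exact (hb.hasCompactSupport.iteratedFDeriv n).norm.mul_left

theorem integrable (hb : IsAnnular b) : Integrable b :=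
  hb.smooth.continuous.integrable_of_hasCompactSupport hb.hasCompactSupport

theorem integrable_norm_mul (hb : IsAnnular b) : Integrable (fun v => ‖v‖ * ‖b v‖) := by
  simpa using hb.integrable_pow 1 0

theorem smul_left (hb : IsAnnular b) {g : E3 → ℂ} (hg : ContDiff ℝ ∞ g) :
    IsAnnular (fun ξ => g ξ * b ξ) where
  smooth := hg.mul hb.smooth
  support ξ h := hb.support ξ (right_ne_zero_of_mul h)

/-- The symbol of the `a`-th partial derivative of the kernel. -/
theorem dsym (hb : IsAnnular b) (a : Fin 3) :
    IsAnnular (fun ξ => (-(2 * Real.pi * Complex.I) * ((ξ a : ℝ) : ℂ)) * b ξ) := by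
  refine hb.smul_left (contDiff_const.mul (Complex.ofRealCLM.contDiff.comp ?_))
  exact (EuclideanSpace.proj (𝕜 := ℝ) a).contDiff

theorem pd_fourier (hb : IsAnnular b) (a : Fin 3) :
    pd a (𝓕 b) = 𝓕 (fun ξ => (-(2 * Real.pi * Complex.I) * ((ξ a : ℝ) : ℂ)) * b ξ) := by
  ext y
  rw [pd, Real.fderiv_fourier hb.integrable hb.integrable_norm_mul,
    Real.fourier_continuousLinearMap_apply]
  · refine congrFun (congrArg _ (funext fun ξ => ?_)) y
    rw [VectorFourier.fourierSMulRight_apply]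
    have h1 : (innerSL ℝ ξ) (EuclideanSpace.single a (1 : ℝ) : E3) = ξ a := by
      rw [innerSL_apply_apply, EuclideanSpace.inner_single_right]
      simp
    rw [h1]
    simp only [mul_assoc, smul_eq_mul, Complex.real_smul]
  · have hcont : Continuous (VectorFourier.fourierSMulRight (innerSL ℝ : E3 →L[ℝ] E3 →L[ℝ] ℝ) b) := by
      unfold VectorFourier.fourierSMulRight
      have := hb.smooth.continuous
      fun_prop
    refine hcont.integrable_of_hasCompactSupport (hb.hasCompactSupport.mono' ?_)
    intro ξ h
    apply subset_tsupport b
    intro h0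
    apply h
    simp [VectorFourier.fourierSMulRight, h0]

theorem pd_heatKer (hb : IsAnnular b) (a : Fin 3) (σ : ℝ) :
    pd a (heatKer b σ) =
      heatKer (fun ξ => (-(2 * Real.pi * Complex.I) * ((ξ a : ℝ) : ℂ)) * b ξ) σ := by
  rw [heatKer, (hb.isAnnular_heatSym σ).pd_fourier, heatKer]
  congr 1
  ext ξ
  simp only [heatSym, Complex.real_smul]
  ring

theorem lap_heatKer (hb : IsAnnular b) (σ : ℝ) :
    lap (heatKer b σ) = heatKer (fun ξ => -((4 * Real.pi ^ 2 * ‖ξ‖ ^ 2 : ℝ) : ℂ) * b ξ) σ := by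
  have hI : ∀ a : Fin 3, Integrable (heatSym (fun ξ => (-(2 * Real.pi * Complex.I) * ((ξ a : ℝ) : ℂ)) *
      ((-(2 * Real.pi * Complex.I) * ((ξ a : ℝ) : ℂ)) * b ξ)) σ) :=
    fun a => (((hb.dsym a).dsym a).isAnnular_heatSym σ).integrable
  ext y
  simp only [lap]
  simp only [hb.pd_heatKer, (hb.dsym _).pd_heatKer]
  simp only [heatKer, Real.fourier_eq]
  rw [← integral_finsetSum]
  · congr 1
    ext ξ
    rw [← Finset.smul_sum]
    congr 1
    simp only [heatSym, Complex.real_smul, ← Finset.mul_sum]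
    congr 1
    rw [EuclideanSpace.norm_sq_eq]
    simp only [Fin.sum_univ_three, Real.norm_eq_abs, sq_abs]
    push_cast
    linear_combination (4 * (Real.pi : ℂ) ^ 2 * ((ξ 0 : ℂ) ^ 2 + (ξ 1 : ℂ) ^ 2 + (ξ 2 : ℂ) ^ 2) * b ξ) *
      Complex.I_sq
  · intro a _
    exact (Real.fourierIntegral_convergent_iff y).2 (hI a)

/-- Joint smoothness is needed because the test functions are differentiated in time and space
together. Compact support of the symbol makes it hold for negative `σ` too, so the backward
evolution is smooth on all of space-time. -/
theorem contDiff_heatKer_uncurry (hb : IsAnnular b) :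
    ContDiff ℝ ∞ (fun q : ℝ × E3 => heatKer b q.1 q.2) := by
  have hg : ContDiff ℝ ∞ (fun z : (ℝ × E3) × E3 =>
      Complex.exp (((-2 * Real.pi * inner ℝ (-z.2) z.1.2 : ℝ) : ℂ) * Complex.I) *
        heatSym b z.1.1 (-z.2)) := by
    refine ContDiff.mul ?_ ?_
    · refine ContDiff.cexp (ContDiff.mul ?_ contDiff_const)
      refine ContDiff.comp (g := fun r : ℝ => (r : ℂ)) Complex.ofRealCLM.contDiff ?_
      exact contDiff_const.mul ((contDiff_snd.neg).inner ℝ (contDiff_fst.snd))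
    · exact ContDiff.comp (g := fun q : ℝ × E3 => heatSym b q.1 q.2)
        (f := fun z : (ℝ × E3) × E3 => (z.1.1, -z.2)) (contDiff_heatSym_uncurry hb.smooth)
        ((contDiff_fst.fst).prodMk contDiff_snd.neg)
  -- The Fourier integral is read as the convolution of the constant `1` with the integrand,
  -- evaluated at `0`; smooth dependence of convolutions on a parameter then applies. Evaluation at
  -- `0` is the origin of the signs `-ξ`.
  have h := contDiffOn_convolution_right_with_param_comp (𝕜 := ℝ) (n := ⊤) (μ := (volume : Measure E3))
    (ContinuousLinearMap.mul ℝ ℂ)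
    (s := univ) (v := fun _ : ℝ × E3 => (0 : E3)) contDiffOn_const (f := fun _ : E3 => (1 : ℂ))
    (g := fun (p : ℝ × E3) (ξ : E3) =>
      Complex.exp (((-2 * Real.pi * inner ℝ (-ξ) p.2 : ℝ) : ℂ) * Complex.I) * heatSym b p.1 (-ξ))
    (k := Metric.closedBall (0 : E3) 1) isOpen_univ (isCompact_closedBall _ _)
    (by
      intro p ξ _ hξ
      have : b (-ξ) = 0 := by
        by_contra h
        exact hξ (by simpa using (hb.support _ h).2)
      simp [heatSym, this])
    (continuous_const.locallyIntegrable) hg.contDiffOn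
  rw [contDiffOn_univ] at h
  convert h using 2 with q
  rw [heatKer, Real.fourier_eq', MeasureTheory.convolution]
  congr 1
  ext ξ
  simp

theorem hasDerivAt_heatKer (hb : IsAnnular b) (σ : ℝ) (y : E3) :
    HasDerivAt (fun s => heatKer b s y) (lap (heatKer b σ) y) σ := by
  rw [hb.lap_heatKer]
  have hb' : IsAnnular (fun ξ => -((4 * Real.pi ^ 2 * ‖ξ‖ ^ 2 : ℝ) : ℂ) * b ξ) := by
    refine hb.smul_left ((Complex.ofRealCLM.contDiff.comp ?_).neg)
    exact contDiff_const.mul (contDiff_norm_sq ℝ)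
  simp only [heatKer, Real.fourier_eq]
  have hcont := (contDiff_heatSym_uncurry hb'.smooth).continuous.norm
  obtain ⟨C, hC⟩ := ((isCompact_Icc (a := σ - 1) (b := σ + 1)).prod
    (isCompact_closedBall (0 : E3) 1)).exists_bound_of_continuousOn hcont.continuousOn
  refine (hasDerivAt_integral_of_dominated_loc_of_deriv_le (𝕜 := ℝ)
    (s := Icc (σ - 1) (σ + 1)) (bound := (Metric.closedBall (0 : E3) 1).indicator fun _ => C)
    (F := fun s ξ => Real.fourierChar (-inner ℝ ξ y) • heatSym b s ξ)
    (F' := fun s ξ => Real.fourierChar (-inner ℝ ξ y) •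
      heatSym (fun ξ => -((4 * Real.pi ^ 2 * ‖ξ‖ ^ 2 : ℝ) : ℂ) * b ξ) s ξ)
    (Icc_mem_nhds (by linarith) (by linarith)) ?_ ?_ ?_ ?_ ?_ ?_).2
  · exact Filter.Eventually.of_forall fun s =>
      ((Real.fourierIntegral_convergent_iff y).2 (hb.isAnnular_heatSym s).integrable).1
  · exact (Real.fourierIntegral_convergent_iff y).2 (hb.isAnnular_heatSym σ).integrable
  · exact ((Real.fourierIntegral_convergent_iff y).2 (hb'.isAnnular_heatSym σ).integrable).1
  · refine Filter.Eventually.of_forall fun ξ s hs => ?_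
    rw [Circle.norm_smul]
    by_cases hξ : ξ ∈ Metric.closedBall (0 : E3) 1
    · rw [indicator_of_mem hξ]
      have := hC (s, ξ) ⟨hs, hξ⟩
      simpa using this
    · have : b ξ = 0 := by
        by_contra h
        exact hξ (by simpa using (hb.support _ h).2)
      simp [heatSym, this, indicator_of_notMem hξ]
  · exact (integrable_indicator_iff Metric.isClosed_closedBall.measurableSet).2
      (integrableOn_const (measure_closedBall_lt_top.ne))
  · refine Filter.Eventually.of_forall fun ξ s _ => ?_
    have h1 : HasDerivAt (fun s : ℝ => Real.exp (-(4 * Real.pi ^ 2 * ‖ξ‖ ^ 2) * s))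
        (Real.exp (-(4 * Real.pi ^ 2 * ‖ξ‖ ^ 2) * s) * (-(4 * Real.pi ^ 2 * ‖ξ‖ ^ 2))) s := by
      simpa using ((hasDerivAt_id s).const_mul (-(4 * Real.pi ^ 2 * ‖ξ‖ ^ 2))).exp
    have h2 := (h1.smul_const (b ξ)).const_smul (Real.fourierChar (-inner ℝ ξ y))
    refine h2.congr_deriv ?_
    simp only [heatSym, Complex.real_smul]
    push_cast
    ring_nf

end IsAnnular

end NSLorentz

namespace NSLorentz

/-! ### Decay of the heat kernels -/

theorem one_add_pow_mul_exp_neg_le (n : ℕ) {σ : ℝ} (hσ : 0 ≤ σ) :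
    (1 + σ) ^ n * Real.exp (-σ) ≤ n.factorial * Real.exp 1 := by
  have h := Real.pow_div_factorial_le_exp (1 + σ) (by linarith) n
  rw [div_le_iff₀ (by positivity), Real.exp_add] at h
  calc (1 + σ) ^ n * Real.exp (-σ)
      ≤ (Real.exp 1 * Real.exp σ * n.factorial) * Real.exp (-σ) := by gcongr
    _ = n.factorial * Real.exp 1 * (Real.exp σ * Real.exp (-σ)) := by ring
    _ = n.factorial * Real.exp 1 := by rw [← Real.exp_add]; simp

/-- On the annulus `4π²‖ξ‖² ≥ 1`, so all derivatives of the outer exponential are at most `e^(-σ)`,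
while those of the exponent are at most `D(1 + σ)`. The chain rule costs `(1 + σ)^n`, which the
exponential absorbs with two powers to spare. -/
theorem exists_norm_iteratedFDeriv_exp_le (n : ℕ) :
    ∃ C : ℝ, 0 ≤ C ∧ ∀ σ : ℝ, 0 ≤ σ → ∀ ξ : E3, 1 / 4 ≤ ‖ξ‖ → ‖ξ‖ ≤ 1 →
      ‖iteratedFDeriv ℝ n (fun ξ : E3 => Real.exp (-(4 * Real.pi ^ 2 * ‖ξ‖ ^ 2) * σ)) ξ‖
        ≤ C * ((1 + σ) ^ 2)⁻¹ := by
  have hq : ContDiff ℝ ∞ (fun ξ : E3 => -(4 * Real.pi ^ 2 * ‖ξ‖ ^ 2)) :=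
    (contDiff_const.mul (contDiff_norm_sq ℝ)).neg
  have hB : ∀ i : ℕ, ∃ C : ℝ, ∀ ξ ∈ Metric.closedBall (0 : E3) 1,
      ‖iteratedFDeriv ℝ i (fun ξ : E3 => -(4 * Real.pi ^ 2 * ‖ξ‖ ^ 2)) ξ‖ ≤ C := fun i =>
    (isCompact_closedBall (0 : E3) 1).exists_bound_of_continuousOn
      (hq.continuous_iteratedFDeriv (m := i) (by exact_mod_cast le_top)).continuousOn
  choose B hB using hB
  set D : ℝ := 1 + ∑ i ∈ Finset.range (n + 1), |B i| with hD
  have hD1 : 1 ≤ D := by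
    rw [hD]
    have : 0 ≤ ∑ i ∈ Finset.range (n + 1), |B i| := Finset.sum_nonneg fun i _ => abs_nonneg _
    linarith
  refine ⟨n.factorial * D ^ n * ((n + 2).factorial * Real.exp 1), by positivity,
    fun σ hσ ξ h1 h2 => ?_⟩
  have hexp : ∀ i : ℕ, ∀ x : ℝ, ‖iteratedFDeriv ℝ i Real.exp x‖ = Real.exp x := by
    intro i x
    rw [norm_iteratedFDeriv_eq_norm_iteratedDeriv, iteratedDeriv_eq_iterate, Real.iter_deriv_exp,
      Real.norm_eq_abs, Real.abs_exp]
  have h3 := norm_iteratedFDeriv_comp_le (𝕜 := ℝ) (n := n) (N := ∞) (g := Real.exp)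
    (f := fun ξ : E3 => -(4 * Real.pi ^ 2 * ‖ξ‖ ^ 2) * σ) Real.contDiff_exp
    (hq.mul contDiff_const) (by exact_mod_cast le_top) ξ (C := Real.exp (-σ)) (D := D * (1 + σ))
    (by
      intro i _
      rw [hexp]
      refine Real.exp_le_exp.2 ?_
      have hpi : 9 ≤ Real.pi ^ 2 := by nlinarith [Real.pi_gt_three]
      have h4 : 1 / 16 ≤ ‖ξ‖ ^ 2 := by nlinarith [norm_nonneg ξ]
      have h5 : 1 ≤ 4 * Real.pi ^ 2 * ‖ξ‖ ^ 2 := by nlinarith [sq_nonneg ‖ξ‖]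
      nlinarith)
    (by
      intro i hi hin
      have h6 : (fun ξ : E3 => -(4 * Real.pi ^ 2 * ‖ξ‖ ^ 2) * σ) =
          σ • (fun ξ : E3 => -(4 * Real.pi ^ 2 * ‖ξ‖ ^ 2)) := by
        exact funext fun ξ => mul_comm _ _
      rw [h6, iteratedFDeriv_const_smul_apply (a := σ) (hq.contDiffAt.of_le (by exact_mod_cast le_top)),
        norm_smul, Real.norm_eq_abs, abs_of_nonneg hσ]
      have h7 : ‖iteratedFDeriv ℝ i (fun ξ : E3 => -(4 * Real.pi ^ 2 * ‖ξ‖ ^ 2)) ξ‖ ≤ D := by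
        refine (hB i ξ (by simpa using h2)).trans ((le_abs_self _).trans ?_)
        rw [hD]
        have := Finset.single_le_sum (f := fun i => |B i|) (fun i _ => abs_nonneg _)
          (Finset.mem_range.2 (Nat.lt_succ_of_le hin))
        linarith
      calc σ * ‖iteratedFDeriv ℝ i (fun ξ : E3 => -(4 * Real.pi ^ 2 * ‖ξ‖ ^ 2)) ξ‖
          ≤ (1 + σ) * D := by gcongr; linarith
        _ = D * (1 + σ) := mul_comm _ _
        _ ≤ (D * (1 + σ)) ^ i := le_self_pow₀ (by nlinarith) (by omega))
  refine h3.trans ?_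
  have h8 := one_add_pow_mul_exp_neg_le (n + 2) hσ
  have h9 : 0 < (1 + σ) ^ 2 := by positivity
  rw [← div_eq_mul_inv, le_div_iff₀ h9]
  calc (n.factorial : ℝ) * Real.exp (-σ) * (D * (1 + σ)) ^ n * (1 + σ) ^ 2
      = n.factorial * D ^ n * ((1 + σ) ^ (n + 2) * Real.exp (-σ)) := by rw [mul_pow]; ring
    _ ≤ _ := by gcongr

namespace IsAnnular

variable {b : E3 → ℂ}

theorem exists_norm_iteratedFDeriv_heatSym_le (hb : IsAnnular b) (n : ℕ) :
    ∃ C : ℝ, 0 ≤ C ∧ ∀ σ : ℝ, 0 ≤ σ → ∀ ξ : E3,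
      ‖iteratedFDeriv ℝ n (heatSym b σ) ξ‖ ≤
        (Metric.closedBall (0 : E3) 1).indicator (fun _ => C * ((1 + σ) ^ 2)⁻¹) ξ := by
  choose E hE0 hE using exists_norm_iteratedFDeriv_exp_le
  have hB : ∀ i : ℕ, ∃ C : ℝ, ∀ ξ ∈ Metric.closedBall (0 : E3) 1,
      ‖iteratedFDeriv ℝ i b ξ‖ ≤ C := fun i =>
    (isCompact_closedBall (0 : E3) 1).exists_bound_of_continuousOn
      (hb.smooth.continuous_iteratedFDeriv (m := i) (by exact_mod_cast le_top)).continuousOn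
  choose B hB using hB
  have hB0 : ∀ i, 0 ≤ B i := fun i => (norm_nonneg _).trans (hB i 0 (by simp))
  refine ⟨∑ i ∈ Finset.range (n + 1), n.choose i * E i * B (n - i), by
    exact Finset.sum_nonneg fun i _ => mul_nonneg (mul_nonneg (by positivity) (hE0 i)) (hB0 _),
    fun σ hσ ξ => ?_⟩
  by_cases hξ : ξ ∈ tsupport (heatSym b σ)
  · obtain ⟨h1, h2⟩ := (hb.isAnnular_heatSym σ).tsupport_subset hξ
    have h3 : ξ ∈ Metric.closedBall (0 : E3) 1 := by simpa using h2
    rw [indicator_of_mem h3]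
    have hs : ContDiff ℝ ∞ (fun ξ : E3 => Real.exp (-(4 * Real.pi ^ 2 * ‖ξ‖ ^ 2) * σ)) :=
      ((contDiff_const.mul (contDiff_norm_sq ℝ)).neg.mul contDiff_const).exp
    refine (norm_iteratedFDeriv_smul_le (𝕜 := ℝ) hs hb.smooth ξ (n := n)
      (by exact_mod_cast le_top)).trans ?_
    rw [Finset.sum_mul]
    refine Finset.sum_le_sum fun i _ => ?_
    have h5 := hE i σ hσ ξ h1 h2
    have h6 := hB (n - i) ξ h3
    calc (n.choose i : ℝ) * ‖iteratedFDeriv ℝ i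
          (fun ξ : E3 => Real.exp (-(4 * Real.pi ^ 2 * ‖ξ‖ ^ 2) * σ)) ξ‖
          * ‖iteratedFDeriv ℝ (n - i) b ξ‖
        ≤ n.choose i * (E i * ((1 + σ) ^ 2)⁻¹) * B (n - i) := by
          gcongr
          exact mul_nonneg (by positivity) ((norm_nonneg _).trans h5)
      _ = _ := by ring
  · have : iteratedFDeriv ℝ n (heatSym b σ) ξ = 0 := by
      by_contra h
      exact hξ (support_iteratedFDeriv_subset n h)
    rw [this, norm_zero]
    refine indicator_nonneg (fun _ _ => ?_) ξ
    refine mul_nonneg (Finset.sum_nonneg fun i _ =>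
      mul_nonneg (mul_nonneg (by positivity) (hE0 i)) (hB0 _)) (by positivity)

/-- Powers of `‖y‖` on the kernel side become derivatives of the symbol, which are supported in the
unit ball and bounded there by a multiple of `(1 + σ)⁻²`. -/
theorem exists_pow_mul_norm_iteratedFDeriv_heatKer_le (hb : IsAnnular b) (k n : ℕ) :
    ∃ C : ℝ, 0 ≤ C ∧ ∀ σ : ℝ, 0 ≤ σ → ∀ y : E3,
      ‖y‖ ^ n * ‖iteratedFDeriv ℝ k (heatKer b σ) y‖ ≤ C * ((1 + σ) ^ 2)⁻¹ := by
  choose E hE0 hE using hb.exists_norm_iteratedFDeriv_heatSym_le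
  set V : ℝ := (volume (Metric.closedBall (0 : E3) 1)).toReal with hV
  refine ⟨(2 * Real.pi) ^ k * (2 * k + 2) ^ n *
    ∑ p ∈ Finset.range (k + 1) ×ˢ Finset.range (n + 1), E p.2 * V, ?_, fun σ hσ y => ?_⟩
  · refine mul_nonneg (by positivity) (Finset.sum_nonneg fun p _ => mul_nonneg (hE0 _) ?_)
    exact ENNReal.toReal_nonneg
  have ha := hb.isAnnular_heatSym σ
  have h1 := Real.pow_mul_norm_iteratedFDeriv_fourier_le (f := heatSym b σ) (K := ⊤) (N := ⊤)
    ha.smooth (fun k n _ _ => ha.integrable_pow k n) (k := k) (n := n) le_top le_top y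
  refine h1.trans ?_
  rw [mul_assoc _ (∑ p ∈ _, _), Finset.sum_mul]
  refine mul_le_mul_of_nonneg_left (Finset.sum_le_sum fun p _ => ?_) (by positivity)
  calc ∫ v : E3, ‖v‖ ^ p.1 * ‖iteratedFDeriv ℝ p.2 (heatSym b σ) v‖
      ≤ ∫ v : E3, (Metric.closedBall (0 : E3) 1).indicator
          (fun _ => E p.2 * ((1 + σ) ^ 2)⁻¹) v := by
        refine integral_mono (ha.integrable_pow _ _)
          ((integrable_indicator_iff Metric.isClosed_closedBall.measurableSet).2
            (integrableOn_const measure_closedBall_lt_top.ne)) fun v => ?_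
        have h2 := hE p.2 σ hσ v
        by_cases hv : v ∈ Metric.closedBall (0 : E3) 1
        · rw [indicator_of_mem hv] at h2 ⊢
          refine le_trans ?_ h2
          refine mul_le_of_le_one_left (norm_nonneg _) (pow_le_one₀ (norm_nonneg _) ?_)
          simpa using hv
        · rw [indicator_of_notMem hv] at h2 ⊢
          have h3 : ‖iteratedFDeriv ℝ p.2 (heatSym b σ) v‖ = 0 := le_antisymm h2 (norm_nonneg _)
          simp [h3]
    _ = E p.2 * V * ((1 + σ) ^ 2)⁻¹ := by
        rw [integral_indicator Metric.isClosed_closedBall.measurableSet, setIntegral_const,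
          smul_eq_mul, measureReal_def, hV]
        ring

/-- Rapid decay of the derivatives of the heat kernels. -/
theorem exists_norm_iteratedFDeriv_heatKer_le (hb : IsAnnular b) (k : ℕ) :
    ∃ C : ℝ, 0 ≤ C ∧ ∀ n ≤ k, ∀ σ : ℝ, 0 ≤ σ → ∀ y : E3,
      ‖iteratedFDeriv ℝ n (heatKer b σ) y‖ ≤ C * ((1 + σ) ^ 2)⁻¹ * ((1 + ‖y‖) ^ 6)⁻¹ := by
  -- The weights `‖y‖⁰` and `‖y‖⁶` together control `(1 + ‖y‖)⁶`.
  choose C0 hC00 hC0 using fun n => hb.exists_pow_mul_norm_iteratedFDeriv_heatKer_le n 0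
  choose C1 hC10 hC1 using fun n => hb.exists_pow_mul_norm_iteratedFDeriv_heatKer_le n 6
  refine ⟨∑ n ∈ Finset.range (k + 1), 64 * (C0 n + C1 n), Finset.sum_nonneg fun n _ => by
    have := hC00 n; have := hC10 n; positivity, fun n hn σ hσ y => ?_⟩
  have h0 := hC0 n σ hσ y
  have h1 := hC1 n σ hσ y
  have h2 : (1 + ‖y‖) ^ 6 ≤ 64 * (1 + ‖y‖ ^ 6) := by
    have := add_pow_le (zero_le_one (α := ℝ)) (norm_nonneg y) 6
    norm_num at this
    nlinarith [norm_nonneg y, pow_nonneg (norm_nonneg y) 6]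
  rw [← div_eq_mul_inv, le_div_iff₀ (by positivity)]
  calc ‖iteratedFDeriv ℝ n (heatKer b σ) y‖ * (1 + ‖y‖) ^ 6
      ≤ ‖iteratedFDeriv ℝ n (heatKer b σ) y‖ * (64 * (1 + ‖y‖ ^ 6)) := by gcongr
    _ = 64 * (‖y‖ ^ 0 * ‖iteratedFDeriv ℝ n (heatKer b σ) y‖ +
          ‖y‖ ^ 6 * ‖iteratedFDeriv ℝ n (heatKer b σ) y‖) := by ring
    _ ≤ 64 * (C0 n * ((1 + σ) ^ 2)⁻¹ + C1 n * ((1 + σ) ^ 2)⁻¹) := by gcongr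
    _ = (64 * (C0 n + C1 n)) * ((1 + σ) ^ 2)⁻¹ := by ring
    _ ≤ _ := by
        gcongr
        exact Finset.single_le_sum (f := fun n => 64 * (C0 n + C1 n))
          (fun n _ => by have := hC00 n; have := hC10 n; positivity)
          (Finset.mem_range.2 (Nat.lt_succ_of_le hn))

end IsAnnular

/-! ### Truncation -/

/-- A smooth cutoff which is `1` on the unit ball and vanishes outside the ball of radius `2`. -/
noncomputable def cutoffBump : ContDiffBump (0 : E3) where
  rIn := 1
  rOut := 2
  rIn_pos := one_pos
  rIn_lt_rOut := one_lt_two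

/-- The cutoff at scale `R`. -/
noncomputable def cutoff (R : ℝ) (y : E3) : ℝ := cutoffBump (R⁻¹ • y)

theorem contDiff_cutoff (R : ℝ) : ContDiff ℝ ∞ (cutoff R) :=
  cutoffBump.contDiff.comp (contDiff_const_smul R⁻¹)

theorem cutoff_eq_one {R : ℝ} (hR : 0 < R) {y : E3} (hy : ‖y‖ ≤ R) : cutoff R y = 1 := by
  refine cutoffBump.one_of_mem_closedBall ?_
  simp only [mem_closedBall_zero_iff, norm_smul, norm_inv, Real.norm_eq_abs, abs_of_pos hR]
  exact (inv_mul_le_iff₀ hR).2 (by simpa [cutoffBump] using hy)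

theorem cutoff_eq_zero {R : ℝ} (hR : 0 < R) {y : E3} (hy : 2 * R ≤ ‖y‖) : cutoff R y = 0 := by
  refine cutoffBump.zero_of_le_dist ?_
  simp only [dist_zero_right, norm_smul, norm_inv, Real.norm_eq_abs, abs_of_pos hR]
  rw [← div_eq_inv_mul, le_div_iff₀ hR]
  simpa [cutoffBump] using hy

theorem exists_norm_iteratedFDeriv_cutoff_le (k : ℕ) :
    ∃ C : ℝ, 0 ≤ C ∧ ∀ n ≤ k, ∀ R : ℝ, 1 ≤ R → ∀ y : E3,
      ‖iteratedFDeriv ℝ n (cutoff R) y‖ ≤ C := by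
  have hs : ContDiff ℝ ∞ (cutoffBump : E3 → ℝ) := cutoffBump.contDiff
  have hB : ∀ i : ℕ, ∃ C : ℝ, ∀ y : E3, ‖iteratedFDeriv ℝ i (cutoffBump : E3 → ℝ) y‖ ≤ C := by
    intro i
    exact (cutoffBump.hasCompactSupport.iteratedFDeriv i).exists_bound_of_continuous
      (hs.continuous_iteratedFDeriv (m := i) (by exact_mod_cast le_top))
  choose B hB using hB
  refine ⟨∑ n ∈ Finset.range (k + 1), |B n|, Finset.sum_nonneg fun n _ => abs_nonneg _,
    fun n hn R hR y => ?_⟩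
  have h1 : iteratedFDeriv ℝ n (cutoff R) y =
      R⁻¹ ^ n • iteratedFDeriv ℝ n (cutoffBump : E3 → ℝ) (R⁻¹ • y) := by
    have := iteratedFDeriv_comp_const_smul (𝕜 := ℝ) (i := n) (f := (cutoffBump : E3 → ℝ)) R⁻¹
    exact congrFun (this (hs.of_le (by exact_mod_cast le_top))) y
  rw [h1, norm_smul, norm_pow, norm_inv, Real.norm_eq_abs, abs_of_pos (by linarith)]
  refine (mul_le_of_le_one_left (norm_nonneg _)
    (pow_le_one₀ (by positivity) (inv_le_one_of_one_le₀ hR))).trans ?_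
  refine (hB n _).trans ((le_abs_self _).trans ?_)
  exact Finset.single_le_sum (f := fun n => |B n|) (fun n _ => abs_nonneg _)
    (Finset.mem_range.2 (Nat.lt_succ_of_le hn))

/-- Leibniz' rule, pointwise in `y`. Uniformity in `R ≥ 1` holds because each derivative of the
cutoff brings a factor `R⁻¹ ≤ 1`. -/
theorem exists_norm_iteratedFDeriv_cutoff_smul_le (k : ℕ) :
    ∃ C : ℝ, 0 ≤ C ∧ ∀ R : ℝ, 1 ≤ R → ∀ f : E3 → ℂ, ContDiff ℝ ∞ f → ∀ (y : E3) (B : ℝ),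
      ∀ n ≤ k, (∀ i ≤ n, ‖iteratedFDeriv ℝ i f y‖ ≤ B) →
        ‖iteratedFDeriv ℝ n (fun z => cutoff R z • f z) y‖ ≤ C * B := by
  obtain ⟨C, hC0, hC⟩ := exists_norm_iteratedFDeriv_cutoff_le k
  refine ⟨2 ^ k * C, by positivity, fun R hR f hf y B n hn hB => ?_⟩
  have hB0 : 0 ≤ B := (norm_nonneg _).trans (hB 0 (Nat.zero_le _))
  refine (norm_iteratedFDeriv_smul_le (𝕜 := ℝ) (contDiff_cutoff R) hf y (n := n)
    (by exact_mod_cast le_top)).trans ?_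
  calc ∑ i ∈ Finset.range (n + 1), (n.choose i : ℝ) * ‖iteratedFDeriv ℝ i (cutoff R) y‖ *
          ‖iteratedFDeriv ℝ (n - i) f y‖
      ≤ ∑ i ∈ Finset.range (n + 1), (n.choose i : ℝ) * (C * B) := by
        refine Finset.sum_le_sum fun i hi => ?_
        rw [mul_assoc]
        refine mul_le_mul_of_nonneg_left ?_ (by positivity)
        exact mul_le_mul (hC i (by have := Finset.mem_range.1 hi; omega) R hR y)
          (hB _ (by omega)) (norm_nonneg _) hC0
    _ = 2 ^ n * (C * B) := by
        rw [← Finset.sum_mul]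
        congr 1
        exact_mod_cast Nat.sum_range_choose n
    _ ≤ 2 ^ k * C * B := by
        rw [mul_assoc]
        gcongr
        exact one_le_two

end NSLorentz

namespace NSLorentz

/-! ### Integration by parts -/

theorem hasCompactSupport_pd {w : E3 → ℂ} (hw : HasCompactSupport w) (a : Fin 3) :
    HasCompactSupport (pd a w) :=
  hw.fderiv_apply ℝ _

theorem hasCompactSupport_lap {w : E3 → ℂ} (hw : HasCompactSupport w) :
    HasCompactSupport (lap w) := by
  have h : lap w = ∑ a, pd a (pd a w) := by
    funext y
    simp [lap]
  rw [h]
  simp only [Fin.sum_univ_three]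
  exact ((hasCompactSupport_pd (hasCompactSupport_pd hw _) _).add
    (hasCompactSupport_pd (hasCompactSupport_pd hw _) _)).add
    (hasCompactSupport_pd (hasCompactSupport_pd hw _) _)

theorem integrable_smul_of_compactSupport {h : E3 → ℝ} {w : E3 → ℂ} (hh : Continuous h)
    (hw : Continuous w) (hc : HasCompactSupport w) : Integrable (fun y => h y • w y) :=
  (hh.smul hw).integrable_of_hasCompactSupport hc.smul_left

theorem integral_pd_smul {h : E3 → ℝ} {w : E3 → ℂ} (hh : Differentiable ℝ h) (a : Fin 3)
    (hh' : Continuous (pd a h)) (hw : ContDiff ℝ ∞ w) (hc : HasCompactSupport w) :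
    ∫ y, pd a h y • w y = -∫ y, h y • pd a w y := by
  have hww := (contDiff_pd hw a).continuous
  have h1 := integral_bilinear_fderiv_right_eq_neg_left_of_integrable (μ := (volume : Measure E3))
    (f := h) (g := w) (v := EuclideanSpace.single a (1 : ℝ)) (B := ContinuousLinearMap.lsmul ℝ ℝ)
    (integrable_smul_of_compactSupport hh' hw.continuous hc)
    (integrable_smul_of_compactSupport hh.continuous hww (hasCompactSupport_pd hc a))
    (integrable_smul_of_compactSupport hh.continuous hw.continuous hc)
    (fun x _ => hh x) (fun x _ => (hw.differentiable (by simp)) x)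
  simp only [ContinuousLinearMap.lsmul_apply] at h1
  simp only [pd]
  rw [h1, neg_neg]

theorem continuous_pd {F : Type*} [NormedAddCommGroup F] [NormedSpace ℝ F] {h : E3 → F}
    (hh : ContDiff ℝ 1 h) (a : Fin 3) : Continuous (pd a h) :=
  (hh.continuous_fderiv (by simp)).clm_apply continuous_const

theorem contDiff_one_pd {F : Type*} [NormedAddCommGroup F] [NormedSpace ℝ F] {h : E3 → F}
    (hh : ContDiff ℝ 2 h) (a : Fin 3) : ContDiff ℝ 1 (pd a h) :=
  (hh.fderiv_right (m := 1) (by norm_num)).clm_apply contDiff_const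

theorem integral_lap_smul {h : E3 → ℝ} {w : E3 → ℂ} (hh : ContDiff ℝ 2 h)
    (hw : ContDiff ℝ ∞ w) (hc : HasCompactSupport w) :
    ∫ y, lap h y • w y = ∫ y, h y • lap w y := by
  have hh1 : ContDiff ℝ 1 h := hh.of_le (by norm_num)
  have h1 : ∀ a, ∫ y, pd a (pd a h) y • w y = ∫ y, h y • pd a (pd a w) y := by
    intro a
    have hd := contDiff_one_pd hh a
    rw [integral_pd_smul (hd.differentiable (by simp)) a (continuous_pd hd a) hw hc,
      integral_pd_smul (hh1.differentiable (by simp)) a (continuous_pd hh1 a) (contDiff_pd hw a)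
        (hasCompactSupport_pd hc a), neg_neg]
  simp only [lap, Finset.sum_smul, Finset.smul_sum]
  rw [integral_finsetSum, integral_finsetSum]
  · exact Finset.sum_congr rfl fun a _ => h1 a
  · intro a _
    exact integrable_smul_of_compactSupport hh.continuous
      (contDiff_pd (contDiff_pd hw a) a).continuous
      (hasCompactSupport_pd (hasCompactSupport_pd hc a) a)
  · intro a _
    exact integrable_smul_of_compactSupport (continuous_pd (contDiff_one_pd hh a) a)
      hw.continuous hc

/-- The `j`-th component of a vector field. -/
def comp (v : E3 → E3) (j : Fin 3) : E3 → ℝ := fun y => v y j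

theorem contDiff_comp {n : ℕ∞ω} {v : E3 → E3} (hv : ContDiff ℝ n v) (j : Fin 3) :
    ContDiff ℝ n (comp v j) :=
  (EuclideanSpace.proj (𝕜 := ℝ) j : E3 →L[ℝ] ℝ).contDiff.comp hv

theorem pd_comp {v : E3 → E3} {y : E3} (hv : DifferentiableAt ℝ v y) (a j : Fin 3) :
    pd a (comp v j) y = pd a v y j := by
  have h := ((EuclideanSpace.proj (𝕜 := ℝ) j : E3 →L[ℝ] ℝ).hasFDerivAt.comp y hv.hasFDerivAt).fderiv
  have h2 : (comp v j) = (EuclideanSpace.proj (𝕜 := ℝ) j : E3 →L[ℝ] ℝ) ∘ v := rfl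
  rw [pd, h2, h]
  rfl

theorem sum_pd_comp_eq_divergence {v : E3 → E3} {y : E3} (hv : DifferentiableAt ℝ v y) :
    ∑ a, pd a (comp v a) y = divergence v y :=
  Finset.sum_congr rfl fun a _ => pd_comp hv a a

theorem sum_integral_comp_smul_pd {v : E3 → E3} (hv : ContDiff ℝ 1 v)
    (hdiv : ∀ y, divergence v y = 0) {w : E3 → ℂ} (hw : ContDiff ℝ ∞ w) (hc : HasCompactSupport w) :
    ∑ j, ∫ y, comp v j y • pd j w y = 0 := by
  have h1 : ∀ j, ∫ y, comp v j y • pd j w y = -∫ y, pd j (comp v j) y • w y := by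
    intro j
    have hj := contDiff_comp hv j
    rw [integral_pd_smul (hj.differentiable (by simp)) j (continuous_pd hj j) hw hc, neg_neg]
  rw [Finset.sum_congr rfl fun j _ => h1 j, Finset.sum_neg_distrib, ← integral_finsetSum]
  · simp only [← Finset.sum_smul, sum_pd_comp_eq_divergence ((hv.differentiable (by simp)) _), hdiv]
    simp
  · intro j _
    exact integrable_smul_of_compactSupport (continuous_pd (contDiff_comp hv j) j) hw.continuous hc

/-- For divergence-free `v`, `(v · ∇)v_j = ∑_l ∂_l(v_j v_l)`. Moving the derivative onto `w` leaves
only products of components of `v`, which weak `L³` controls. -/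
theorem sum_integral_transport {v : E3 → E3} (hv : ContDiff ℝ 1 v)
    (hdiv : ∀ y, divergence v y = 0) {w : E3 → ℂ} (hw : ContDiff ℝ ∞ w) (hc : HasCompactSupport w)
    (j : Fin 3) :
    ∫ y, (∑ l, comp v l y * pd l (comp v j) y) • w y =
      -∑ l, ∫ y, (comp v j y * comp v l y) • pd l w y := by
  have hd : ∀ j, Differentiable ℝ (comp v j) := fun j => (contDiff_comp hv j).differentiable (by simp)
  have hprod : ∀ l y, pd l (fun y => comp v j y * comp v l y) y =
      comp v j y * pd l (comp v l) y + comp v l y * pd l (comp v j) y := by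
    intro l y
    simp only [pd]
    rw [fderiv_fun_mul (hd j y) (hd l y)]
    simp
  have h1 : ∀ l, ∫ y, (comp v j y * comp v l y) • pd l w y =
      -∫ y, pd l (fun y => comp v j y * comp v l y) y • w y := by
    intro l
    have hj := (contDiff_comp hv j).mul (contDiff_comp hv l)
    rw [integral_pd_smul (hj.differentiable (by simp)) l (continuous_pd hj l) hw hc, neg_neg]
  rw [Finset.sum_congr rfl fun l _ => h1 l, Finset.sum_neg_distrib, neg_neg, ← integral_finsetSum]
  · refine integral_congr_ae (Filter.Eventually.of_forall fun y => ?_)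
    simp only [hprod]
    rw [← Finset.sum_smul, Finset.sum_add_distrib, ← Finset.mul_sum,
      sum_pd_comp_eq_divergence ((hv.differentiable (by simp)) _), hdiv]
    simp
  · intro l _
    exact integrable_smul_of_compactSupport
      (continuous_pd ((contDiff_comp hv j).mul (contDiff_comp hv l)) l) hw.continuous hc

/-! ### Functions on space-time -/

/-- The time derivative. -/
noncomputable def dT (f : ℝ × E3 → ℂ) : ℝ × E3 → ℂ := fun z => fderiv ℝ f z (1, 0)

/-- The spatial partial derivatives. -/
noncomputable def dX (a : Fin 3) (f : ℝ × E3 → ℂ) : ℝ × E3 → ℂ :=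
  fun z => fderiv ℝ f z (0, EuclideanSpace.single a 1)

/-- The time slice. -/
def slice (f : ℝ × E3 → ℂ) (r : ℝ) : E3 → ℂ := fun y => f (r, y)

section spacetime

variable {f : ℝ × E3 → ℂ}

theorem contDiff_dT (hf : ContDiff ℝ ∞ f) : ContDiff ℝ ∞ (dT f) :=
  (hf.fderiv_right (m := ∞) (by simp)).clm_apply contDiff_const

theorem contDiff_dX (hf : ContDiff ℝ ∞ f) (a : Fin 3) : ContDiff ℝ ∞ (dX a f) :=
  (hf.fderiv_right (m := ∞) (by simp)).clm_apply contDiff_const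

theorem contDiff_slice (hf : ContDiff ℝ ∞ f) (r : ℝ) : ContDiff ℝ ∞ (slice f r) :=
  hf.comp (contDiff_const.prodMk contDiff_id)

theorem pd_slice (hf : ContDiff ℝ ∞ f) (a : Fin 3) (r : ℝ) :
    pd a (slice f r) = slice (dX a f) r := by
  funext y
  have h1 : HasFDerivAt (fun y : E3 => (r, y)) (ContinuousLinearMap.inr ℝ ℝ E3) y :=
    hasFDerivAt_prodMk_right r y
  have h2 := ((hf.differentiable (by simp)) (r, y)).hasFDerivAt.comp y h1
  have h3 : slice f r = f ∘ fun y : E3 => (r, y) := rfl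
  rw [pd, h3, h2.fderiv]
  rfl

theorem hasDerivAt_slice (hf : ContDiff ℝ ∞ f) (r : ℝ) (y : E3) :
    HasDerivAt (fun r => f (r, y)) (dT f (r, y)) r := by
  have h1 : HasFDerivAt (fun r : ℝ => (r, y)) (ContinuousLinearMap.inl ℝ ℝ E3) r :=
    hasFDerivAt_prodMk_left r y
  have h2 := ((hf.differentiable (by simp)) (r, y)).hasFDerivAt.comp r h1
  have h3 : HasDerivAt (fun r => f (r, y)) _ r := h2.hasDerivAt
  refine h3.congr_deriv ?_
  simp [dT]

theorem fderiv_fderiv_apply_comm {X : Type*} [NormedAddCommGroup X] [NormedSpace ℝ X] {g : X → ℂ}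
    (hg : ContDiff ℝ ∞ g) (v w : X) (z : X) :
    fderiv ℝ (fun z => fderiv ℝ g z v) z w = fderiv ℝ (fun z => fderiv ℝ g z w) z v := by
  have h1 : IsSymmSndFDerivAt ℝ g z := hg.contDiffAt.isSymmSndFDerivAt
    (by rw [minSmoothness_of_isRCLikeNormedField]; exact WithTop.coe_le_coe.2 le_top)
  have h2 : DifferentiableAt ℝ (fderiv ℝ g) z :=
    ((hg.fderiv_right (m := ∞) (by simp)).differentiable (by simp)) z
  rw [fderiv_clm_apply h2 (differentiableAt_const v), fderiv_clm_apply h2 (differentiableAt_const w)]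
  simp only [fderiv_fun_const, Pi.zero_apply, ContinuousLinearMap.comp_zero, zero_add,
    ContinuousLinearMap.flip_apply]
  exact (h1.eq v w).symm

theorem dT_dX_comm (hf : ContDiff ℝ ∞ f) (a : Fin 3) : dT (dX a f) = dX a (dT f) := by
  funext z
  exact fderiv_fderiv_apply_comm hf _ _ z

theorem pd_comm {w : E3 → ℂ} (hw : ContDiff ℝ ∞ w) (a c : Fin 3) :
    pd a (pd c w) = pd c (pd a w) := by
  funext z
  exact fderiv_fderiv_apply_comm hw _ _ z

end spacetime

end NSLorentz

namespace NSLorentz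

/-! ### The weak formulation, tested with divergence-free fields -/

/-- The divergence-free field `e_i Δw - ∇∂_i w`. -/
noncomputable def solField (i : Fin 3) (w : E3 → ℂ) (j : Fin 3) : E3 → ℂ :=
  fun y => (if j = i then lap w y else 0) - pd j (pd i w) y

theorem solField_self (i : Fin 3) (w : E3 → ℂ) :
    solField i w i = fun y => lap w y - pd i (pd i w) y := by
  funext y
  simp [solField]

theorem solField_of_ne {i j : Fin 3} (hj : j ≠ i) (w : E3 → ℂ) :
    solField i w j = fun y => (0 : ℂ) - pd j (pd i w) y := by
  funext y
  simp [solField, hj]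

theorem pd_zero (a : Fin 3) : pd a (fun _ : E3 => (0 : ℂ)) = fun _ => 0 := by
  funext y
  simp [pd]

/-- `solField` on the time slices of a function on space-time. -/
noncomputable def solFieldX (i : Fin 3) (f : ℝ × E3 → ℂ) (j : Fin 3) : ℝ × E3 → ℂ :=
  fun z => (if j = i then ∑ a, dX a (dX a f) z else 0) - dX j (dX i f) z

theorem contDiff_solField {w : E3 → ℂ} (hw : ContDiff ℝ ∞ w) (i j : Fin 3) :
    ContDiff ℝ ∞ (solField i w j) := by
  unfold solField
  refine ContDiff.sub ?_ (contDiff_pd (contDiff_pd hw i) j)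
  split_ifs
  · exact contDiff_lap hw
  · exact contDiff_const

theorem hasCompactSupport_solField {w : E3 → ℂ} (hw : HasCompactSupport w) (i j : Fin 3) :
    HasCompactSupport (solField i w j) := by
  unfold solField
  refine HasCompactSupport.sub ?_ (hasCompactSupport_pd (hasCompactSupport_pd hw i) j)
  split_ifs
  · exact hasCompactSupport_lap hw
  · exact HasCompactSupport.zero

theorem pd_sub {f g : E3 → ℂ} (hf : ContDiff ℝ ∞ f) (hg : ContDiff ℝ ∞ g) (a : Fin 3) :
    pd a (fun y => f y - g y) = fun y => pd a f y - pd a g y := by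
  funext y
  simp only [pd]
  rw [fderiv_fun_sub ((hf.differentiable (by simp)) y) ((hg.differentiable (by simp)) y)]
  rfl

theorem pd_add {f g : E3 → ℂ} (hf : ContDiff ℝ ∞ f) (hg : ContDiff ℝ ∞ g) (a : Fin 3) :
    pd a (fun y => f y + g y) = fun y => pd a f y + pd a g y := by
  funext y
  simp only [pd]
  rw [fderiv_fun_add ((hf.differentiable (by simp)) y) ((hg.differentiable (by simp)) y)]
  rfl

theorem lap_add {f g : E3 → ℂ} (hf : ContDiff ℝ ∞ f) (hg : ContDiff ℝ ∞ g) :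
    lap (fun y => f y + g y) = fun y => lap f y + lap g y := by
  funext y
  simp only [lap, pd_add hf hg, pd_add (contDiff_pd hf _) (contDiff_pd hg _),
    Finset.sum_add_distrib]

theorem lap_sub {f g : E3 → ℂ} (hf : ContDiff ℝ ∞ f) (hg : ContDiff ℝ ∞ g) :
    lap (fun y => f y - g y) = fun y => lap f y - lap g y := by
  funext y
  simp only [lap, pd_sub hf hg, pd_sub (contDiff_pd hf _) (contDiff_pd hg _),
    Finset.sum_sub_distrib]

theorem pd_lap_comm {w : E3 → ℂ} (hw : ContDiff ℝ ∞ w) (a : Fin 3) :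
    pd a (lap w) = lap (pd a w) := by
  have h : lap w = fun y => pd 0 (pd 0 w) y + pd 1 (pd 1 w) y + pd 2 (pd 2 w) y := by
    funext y
    simp [lap, Fin.sum_univ_three]
  have hd : ∀ c, ContDiff ℝ ∞ (pd c (pd c w)) := fun c => contDiff_pd (contDiff_pd hw c) c
  rw [h, pd_add ((hd 0).add (hd 1)) (hd 2), pd_add (hd 0) (hd 1)]
  funext y
  simp only [lap, Fin.sum_univ_three]
  simp only [pd_comm (contDiff_pd hw _) a, pd_comm hw a]

/-- Constant-coefficient operators commute. Hence the divergence-free field built from `w` inherits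
the backward heat equation of `w`, up to the field built from the error. -/
theorem lap_solField {w : E3 → ℂ} (hw : ContDiff ℝ ∞ w) (i j : Fin 3) :
    lap (solField i w j) = solField i (lap w) j := by
  have h1 : lap (pd j (pd i w)) = pd j (pd i (lap w)) := by
    rw [pd_lap_comm hw, pd_lap_comm (contDiff_pd hw i)]
  by_cases hj : j = i
  · subst hj
    rw [solField_self, solField_self,
      lap_sub (contDiff_lap hw) (contDiff_pd (contDiff_pd hw j) j), h1]
  · rw [solField_of_ne hj, solField_of_ne hj,
      lap_sub contDiff_const (contDiff_pd (contDiff_pd hw i) j), h1]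
    funext y
    simp [lap, pd_zero]

theorem solField_add {f g : E3 → ℂ} (hf : ContDiff ℝ ∞ f) (hg : ContDiff ℝ ∞ g) (i j : Fin 3) :
    solField i (fun y => f y + g y) j = fun y => solField i f j y + solField i g j y := by
  funext y
  simp only [solField, lap_add hf hg, pd_add hf hg, pd_add (contDiff_pd hf _) (contDiff_pd hg _)]
  split_ifs <;> ring

/-- The divergence is `∂_i Δw - Δ∂_i w`. This cancellation is what removes the pressure. -/
theorem sum_pd_solField {w : E3 → ℂ} (hw : ContDiff ℝ ∞ w) (i : Fin 3) (y : E3) :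
    ∑ j, pd j (solField i w j) y = 0 := by
  have h1 : ∀ j, pd j (solField i w j) y =
      (if j = i then pd i (lap w) y else 0) - pd j (pd j (pd i w)) y := by
    intro j
    by_cases hj : j = i
    · subst hj
      rw [solField_self, pd_sub (contDiff_lap hw) (contDiff_pd (contDiff_pd hw j) j)]
      simp
    · rw [solField_of_ne hj, pd_sub contDiff_const (contDiff_pd (contDiff_pd hw i) j)]
      simp [hj, pd_zero]
  rw [Finset.sum_congr rfl fun j _ => h1 j, Finset.sum_sub_distrib, Finset.sum_ite_eq',
    if_pos (Finset.mem_univ i), pd_lap_comm hw]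
  simp [lap]

/-! ### Size of the divergence-free test fields -/

section norm

variable {w : E3 → ℂ}

theorem norm_lap_le (hw : ContDiff ℝ ∞ w) (y : E3) : ‖lap w y‖ ≤ 3 * ‖iteratedFDeriv ℝ 2 w y‖ := by
  simpa using norm_iteratedFDeriv_lap_le hw 0 y

theorem norm_iteratedFDeriv_solField_le (hw : ContDiff ℝ ∞ w) (i j : Fin 3) (n : ℕ) (y : E3) :
    ‖iteratedFDeriv ℝ n (solField i w j) y‖ ≤ 4 * ‖iteratedFDeriv ℝ (n + 2) w y‖ := by
  have hpp := contDiff_pd (contDiff_pd hw i) j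
  have h2 : ‖iteratedFDeriv ℝ n (pd j (pd i w)) y‖ ≤ ‖iteratedFDeriv ℝ (n + 2) w y‖ :=
    (norm_iteratedFDeriv_pd_le (contDiff_pd hw i) j n y).trans
      (norm_iteratedFDeriv_pd_le hw i (n + 1) y)
  have h3 : ContDiff ℝ ∞ (fun y => if j = i then lap w y else 0) := by
    split_ifs
    · exact contDiff_lap hw
    · exact contDiff_const
  have h4 : ‖iteratedFDeriv ℝ n (fun y => if j = i then lap w y else 0) y‖ ≤
      3 * ‖iteratedFDeriv ℝ (n + 2) w y‖ := by
    split_ifs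
    · exact norm_iteratedFDeriv_lap_le hw n y
    · have : iteratedFDeriv ℝ n (fun _ : E3 => (0 : ℂ)) y = 0 := by
        simp
      rw [this, norm_zero]
      positivity
  have h1 : iteratedFDeriv ℝ n (solField i w j) y =
      iteratedFDeriv ℝ n (fun y => if j = i then lap w y else 0) y -
        iteratedFDeriv ℝ n (pd j (pd i w)) y :=
    iteratedFDeriv_sub_apply (h3.contDiffAt.of_le (by exact_mod_cast le_top))
      (hpp.contDiffAt.of_le (by exact_mod_cast le_top))
  rw [h1]
  refine (norm_sub_le _ _).trans ?_
  linarith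

theorem norm_solField_le (hw : ContDiff ℝ ∞ w) (i j : Fin 3) (y : E3) :
    ‖solField i w j y‖ ≤ 4 * ‖iteratedFDeriv ℝ 2 w y‖ := by
  simpa using norm_iteratedFDeriv_solField_le hw i j 0 y

theorem norm_pd_solField_le (hw : ContDiff ℝ ∞ w) (i j l : Fin 3) (y : E3) :
    ‖pd l (solField i w j) y‖ ≤ 4 * ‖iteratedFDeriv ℝ 3 w y‖ :=
  (norm_pd_le (contDiff_solField hw i j) l y).trans (norm_iteratedFDeriv_solField_le hw i j 1 y)

end norm

section spacetime

variable {f : ℝ × E3 → ℂ}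

theorem contDiff_solFieldX (hf : ContDiff ℝ ∞ f) (i j : Fin 3) :
    ContDiff ℝ ∞ (solFieldX i f j) := by
  unfold solFieldX
  refine ContDiff.sub ?_ (contDiff_dX (contDiff_dX hf i) j)
  split_ifs
  · exact ContDiff.sum fun a _ => contDiff_dX (contDiff_dX hf a) a
  · exact contDiff_const

theorem solFieldX_apply (hf : ContDiff ℝ ∞ f) (i j : Fin 3) (r : ℝ) (y : E3) :
    solFieldX i f j (r, y) = solField i (slice f r) j y := by
  simp only [solFieldX, solField, lap, pd_slice hf, pd_slice (contDiff_dX hf _)]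
  rfl

theorem dT_solFieldX (hf : ContDiff ℝ ∞ f) (i j : Fin 3) :
    dT (solFieldX i f j) = solFieldX i (dT f) j := by
  have h2 : ∀ a c, dT (dX a (dX c f)) = dX a (dX c (dT f)) := fun a c => by
    rw [dT_dX_comm (contDiff_dX hf c), dT_dX_comm hf]
  have hd : ∀ a c z, DifferentiableAt ℝ (dX a (dX c f)) z := fun a c z =>
    ((contDiff_dX (contDiff_dX hf c) a).differentiable (by simp)) z
  funext z
  have h3 : dT (solFieldX i f j) z =
      (if j = i then ∑ a, dT (dX a (dX a f)) z else 0) - dT (dX j (dX i f)) z := by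
    simp only [dT]
    unfold solFieldX
    rw [fderiv_fun_sub]
    · by_cases hj : j = i
      · simp only [hj, if_true]
        rw [fderiv_fun_sum fun a _ => hd a a z]
        simp
      · simp [hj]
    · by_cases hj : j = i
      · simp only [hj, if_true]
        exact DifferentiableAt.fun_sum fun a _ => hd a a z
      · simp [hj]
    · exact hd j i z
  rw [h3]
  simp only [h2, solFieldX]

end spacetime

end NSLorentz

namespace NSLorentz

/-! ### Spatial supports of space-time test functions -/

section vanish

variable {f : ℝ × E3 → ℂ} {R : ℝ}

theorem fderiv_eq_zero_of_vanish (h : ∀ r y, R < ‖y‖ → f (r, y) = 0) (r : ℝ) (y : E3)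
    (hy : R < ‖y‖) : fderiv ℝ f (r, y) = 0 := by
  have : f =ᶠ[nhds (r, y)] fun _ => 0 := by
    have ho : IsOpen {z : ℝ × E3 | R < ‖z.2‖} := isOpen_lt continuous_const continuous_snd.norm
    filter_upwards [ho.mem_nhds hy] with z hz
    exact h z.1 z.2 hz
  rw [this.fderiv_eq]
  simp

theorem dT_eq_zero_of_vanish (h : ∀ r y, R < ‖y‖ → f (r, y) = 0) (r : ℝ) (y : E3)
    (hy : R < ‖y‖) : dT f (r, y) = 0 := by
  simp [dT, fderiv_eq_zero_of_vanish h r y hy]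

theorem dX_eq_zero_of_vanish (h : ∀ r y, R < ‖y‖ → f (r, y) = 0) (a : Fin 3) (r : ℝ) (y : E3)
    (hy : R < ‖y‖) : dX a f (r, y) = 0 := by
  simp [dX, fderiv_eq_zero_of_vanish h r y hy]

theorem solFieldX_eq_zero_of_vanish (h : ∀ r y, R < ‖y‖ → f (r, y) = 0) (i j : Fin 3) (r : ℝ)
    (y : E3) (hy : R < ‖y‖) : solFieldX i f j (r, y) = 0 := by
  have h2 : ∀ a c, dX a (dX c f) (r, y) = 0 := fun a c =>
    dX_eq_zero_of_vanish (fun r y hy => dX_eq_zero_of_vanish h c r y hy) a r y hy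
  simp [solFieldX, h2]

theorem hasCompactSupport_slice (h : ∀ r y, R < ‖y‖ → f (r, y) = 0) (r : ℝ) :
    HasCompactSupport (slice f r) :=
  HasCompactSupport.intro (isCompact_closedBall (0 : E3) R) fun y hy => by
    refine h r y ?_
    simpa using hy

end vanish

/-! ### The equation in components, integrated against test fields -/

variable {a b : ℝ} {u : ℝ → E3 → E3} {p : ℝ → E3 → ℝ}

theorem lap_comp {v : E3 → E3} (hv : ContDiff ℝ 2 v) (j : Fin 3) (y : E3) :
    lap (comp v j) y = Laplacian.laplacian v y j := by
  rw [InnerProductSpace.laplacian_eq_iteratedFDeriv_orthonormalBasis v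
    (EuclideanSpace.basisFun (Fin 3) ℝ)]
  have hv1 : ContDiff ℝ 1 v := hv.of_le (by norm_num)
  have hd : Differentiable ℝ (fderiv ℝ v) :=
    (hv.fderiv_right (m := 1) (by norm_num)).differentiable (by simp)
  simp only [lap, WithLp.ofLp_sum, Finset.sum_apply]
  refine Finset.sum_congr rfl fun c _ => ?_
  have h1 : pd c (comp v j) = comp (pd c v) j :=
    funext fun z => pd_comp ((hv1.differentiable (by simp)) z) c j
  rw [h1, pd_comp (((contDiff_one_pd hv c).differentiable (by simp)) y), iteratedFDeriv_two_apply]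
  simp only [EuclideanSpace.basisFun_apply, Matrix.cons_val_zero, Matrix.cons_val_one, pd]
  have h2 : pd c v = fun y => fderiv ℝ v y (EuclideanSpace.single c 1) := rfl
  rw [h2, fderiv_clm_apply (hd y) (differentiableAt_const _)]
  simp

theorem gradient_apply {q : E3 → ℝ} {y : E3} (hq : DifferentiableAt ℝ q y) (j : Fin 3) :
    gradient q y j = pd j q y := by
  have h := hq.hasGradientAt.hasFDerivAt.fderiv
  rw [pd, h, InnerProductSpace.toDual_apply_apply, EuclideanSpace.inner_single_right]
  simp

theorem convective_apply {v : E3 → E3} {y : E3} (hv : DifferentiableAt ℝ v y) (j : Fin 3) :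
    fderiv ℝ v y (v y) j = ∑ l, comp v l y * pd l (comp v j) y := by
  have h1 : v y = ∑ l, v y l • (EuclideanSpace.single l (1 : ℝ) : E3) := by
    have := (EuclideanSpace.basisFun (Fin 3) ℝ).sum_repr (v y)
    simpa using this.symm
  conv_lhs => rw [h1]
  rw [map_sum]
  simp only [map_smul, WithLp.ofLp_sum, Finset.sum_apply, WithLp.ofLp_smul, Pi.smul_apply,
    smul_eq_mul]
  exact Finset.sum_congr rfl fun l _ => by rw [pd_comp hv]; rfl

namespace IsClassicalSolution

theorem momentum_comp (hu : IsClassicalSolution a b u p) {r : ℝ} (hr : r ∈ Ioo a b) (j : Fin 3)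
    (y : E3) :
    deriv (fun s => u s y) r j = lap (comp (u r) j) y
      - (∑ l, comp (u r) l y * pd l (comp (u r) j) y) - pd j (p r) y := by
  have h := congrArg (fun v : E3 => v j) (hu.momentum r hr y)
  have hd : DifferentiableAt ℝ (u r) y := ((hu.contDiff_space r hr).differentiable (by simp)) y
  simp only [WithLp.ofLp_add, WithLp.ofLp_sub, Pi.add_apply, Pi.sub_apply, WithLp.ofLp_zero,
    Pi.zero_apply] at h
  rw [lap_comp (hu.contDiff_space r hr), ← convective_apply hd,
    ← gradient_apply (hu.differentiable_pressure r hr y)]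
  linarith

theorem continuous_pd_pressure (hu : IsClassicalSolution a b u p) {r : ℝ} (hr : r ∈ Ioo a b)
    (j : Fin 3) : Continuous (pd j (p r)) := by
  have h1 : Continuous fun y : E3 => gradient (p r) y := by
    have := hu.continuousOn_gradient_pressure.comp_continuous
      (f := fun y : E3 => ((r, y) : ℝ × E3)) (by fun_prop) (fun y => ⟨hr, mem_univ y⟩)
    exact this
  have h2 : pd j (p r) = fun y => gradient (p r) y j :=
    funext fun y => (gradient_apply (hu.differentiable_pressure r hr y) j).symm
  rw [h2]
  exact (EuclideanSpace.proj (𝕜 := ℝ) j : E3 →L[ℝ] ℝ).continuous.comp h1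

/-- After integration by parts the pressure meets the divergence of the test field, which is zero.
As `w` has compact support, no growth condition on `u`, its derivatives or `p` is involved. -/
theorem sum_integral_deriv_smul (hu : IsClassicalSolution a b u p) {r : ℝ} (hr : r ∈ Ioo a b)
    {w : E3 → ℂ} (hw : ContDiff ℝ ∞ w) (hc : HasCompactSupport w) (i : Fin 3) :
    ∑ j, ∫ y, (deriv (fun s => u s y) r j) • solField i w j y =
      (∑ j, ∫ y, comp (u r) j y • solField i (lap w) j y) +
        ∑ j, ∑ l, ∫ y, (comp (u r) j y * comp (u r) l y) • pd l (solField i w j) y := by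
  have hv := hu.contDiff_space r hr
  have hv1 : ContDiff ℝ 1 (u r) := hv.of_le (by norm_num)
  have hdiv := hu.div_free r hr
  have hW := fun j => contDiff_solField hw i j
  have hWc := fun j => hasCompactSupport_solField hc i j
  have c1 : ∀ j, Continuous (lap (comp (u r) j)) := fun j =>
    continuous_finsetSum _ fun a _ => continuous_pd (contDiff_one_pd (contDiff_comp hv j) a) a
  have c2 : ∀ j, Continuous (fun y => ∑ l, comp (u r) l y * pd l (comp (u r) j) y) := fun j =>
    continuous_finsetSum _ fun l _ => (contDiff_comp hv l).continuous.mul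
      (continuous_pd (contDiff_comp hv1 j) l)
  have c3 := fun j => hu.continuous_pd_pressure hr j
  have h1 : ∀ j, ∫ y, (deriv (fun s => u s y) r j) • solField i w j y =
      (∫ y, comp (u r) j y • solField i (lap w) j y) +
        (∑ l, ∫ y, (comp (u r) j y * comp (u r) l y) • pd l (solField i w j) y) +
        ∫ y, p r y • pd j (solField i w j) y := by
    intro j
    have e1 : ∀ y, (deriv (fun s => u s y) r j) • solField i w j y =
        lap (comp (u r) j) y • solField i w j y -
        (∑ l, comp (u r) l y * pd l (comp (u r) j) y) • solField i w j y -
        pd j (p r) y • solField i w j y := by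
      intro y
      rw [hu.momentum_comp hr, sub_smul, sub_smul]
    have i1 := integrable_smul_of_compactSupport (c1 j) (hW j).continuous (hWc j)
    have i2 := integrable_smul_of_compactSupport (c2 j) (hW j).continuous (hWc j)
    have i3 := integrable_smul_of_compactSupport (c3 j) (hW j).continuous (hWc j)
    simp only [e1]
    rw [integral_sub (f := fun y => _ - _) (i1.sub i2) i3, integral_sub i1 i2,
      integral_lap_smul (contDiff_comp hv j) (hW j) (hWc j),
      sum_integral_transport hv1 hdiv (hW j) (hWc j) j,
      integral_pd_smul (hu.differentiable_pressure r hr) j (c3 j) (hW j) (hWc j),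
      lap_solField hw]
    ring
  rw [Finset.sum_congr rfl fun j _ => h1 j, Finset.sum_add_distrib, Finset.sum_add_distrib,
    ← integral_finsetSum _ fun j _ => integrable_smul_of_compactSupport
      (hu.differentiable_pressure r hr).continuous (contDiff_pd (hW j) j).continuous
      (hasCompactSupport_pd (hWc j) j)]
  simp only [← Finset.smul_sum, sum_pd_solField hw]
  simp

/-- The gradient part `∇∂_i w` of the test field is orthogonal to the divergence-free field `u`, so
only the single component `u_i` is seen. -/
theorem sum_integral_solField (hu : IsClassicalSolution a b u p) {r : ℝ} (hr : r ∈ Ioo a b)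
    {w : E3 → ℂ} (hw : ContDiff ℝ ∞ w) (hc : HasCompactSupport w) (i : Fin 3) :
    ∑ j, ∫ y, comp (u r) j y • solField i w j y = ∫ y, comp (u r) i y • lap w y := by
  have hv1 : ContDiff ℝ 1 (u r) := (hu.contDiff_space r hr).of_le (by norm_num)
  have hcomp := fun j => (contDiff_comp hv1 j).continuous
  have h2 : ∀ j, ∫ y, comp (u r) j y • solField i w j y =
      (if j = i then ∫ y, comp (u r) i y • lap w y else 0) -
        ∫ y, comp (u r) j y • pd j (pd i w) y := by
    intro j
    have i2 := integrable_smul_of_compactSupport (hcomp j)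
      (contDiff_pd (contDiff_pd hw i) j).continuous
      (hasCompactSupport_pd (hasCompactSupport_pd hc i) j)
    by_cases hj : j = i
    · subst hj
      rw [if_pos rfl, ← integral_sub _ i2]
      · simp only [solField_self, smul_sub]
      · exact integrable_smul_of_compactSupport (hcomp j) (contDiff_lap hw).continuous
          (hasCompactSupport_lap hc)
    · rw [if_neg hj, zero_sub, ← integral_neg]
      simp only [solField_of_ne hj, zero_sub, smul_neg]
  rw [Finset.sum_congr rfl fun j _ => h2 j, Finset.sum_sub_distrib,
    sum_integral_comp_smul_pd hv1 (hu.div_free r hr) (contDiff_pd hw i)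
      (hasCompactSupport_pd hc i)]
  simp

theorem hasDerivAt_integral_comp_smul (hu : IsClassicalSolution a b u p) {r : ℝ}
    (hr : r ∈ Ioo a b) {X : ℝ × E3 → ℂ} (hX : ContDiff ℝ ∞ X) {R : ℝ}
    (hR : ∀ r y, R < ‖y‖ → X (r, y) = 0) (j : Fin 3) :
    HasDerivAt (fun s => ∫ y, comp (u s) j y • X (s, y))
      ((∫ y, (deriv (fun s => u s y) r j) • X (r, y)) + ∫ y, comp (u r) j y • dT X (r, y)) r := by
  -- On `K` times the closed ball of radius `R` the differentiated integrand is continuous, hence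
  -- bounded; this gives the dominating function.
  obtain ⟨K, hK, hrK, hKs⟩ := exists_compact_subset isOpen_Ioo hr
  have hproj : Continuous fun v : E3 => v j :=
    (EuclideanSpace.proj (𝕜 := ℝ) j : E3 →L[ℝ] ℝ).continuous
  have hXT := contDiff_dT hX
  have hRT := dT_eq_zero_of_vanish hR
  have cu : ContinuousOn (fun z : ℝ × E3 => comp (u z.1) j z.2) (Ioo a b ×ˢ univ) :=
    hproj.comp_continuousOn
      (hu.continuousOn_u.mono (prod_mono_left Ioo_subset_Icc_self))
  have cd : ContinuousOn (fun z : ℝ × E3 => deriv (fun s => u s z.2) z.1 j) (Ioo a b ×ˢ univ) :=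
    hproj.comp_continuousOn hu.continuousOn_deriv_time
  have c1 : ContinuousOn (fun z : ℝ × E3 => deriv (fun s => u s z.2) z.1 j • X z)
      (Ioo a b ×ˢ univ) := cd.smul hX.continuous.continuousOn
  have c2 : ContinuousOn (fun z : ℝ × E3 => comp (u z.1) j z.2 • dT X z)
      (Ioo a b ×ˢ univ) := cu.smul hXT.continuous.continuousOn
  have c0 : ContinuousOn (fun z : ℝ × E3 => comp (u z.1) j z.2 • X z)
      (Ioo a b ×ˢ univ) := cu.smul hX.continuous.continuousOn
  have sl : ∀ {F : ℝ × E3 → ℂ}, ContinuousOn F (Ioo a b ×ˢ univ) → ∀ s ∈ Ioo a b,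
      Continuous fun y => F (s, y) := fun {F} hF s hs =>
    hF.comp_continuous (f := fun y : E3 => (s, y)) (by fun_prop) fun y => ⟨hs, mem_univ y⟩
  have hint : ∀ {F : ℝ × E3 → ℂ}, ContinuousOn F (Ioo a b ×ˢ univ) →
      (∀ r y, R < ‖y‖ → F (r, y) = 0) → ∀ s ∈ Ioo a b, Integrable fun y => F (s, y) :=
    fun {F} hF hF0 s hs => (sl hF s hs).integrable_of_hasCompactSupport
      (hasCompactSupport_slice hF0 s)
  have z1 : ∀ r y, R < ‖y‖ → (fun z : ℝ × E3 => deriv (fun s => u s z.2) z.1 j • X z) (r, y) = 0 :=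
    fun r y hy => by simp [hR r y hy]
  have z2 : ∀ r y, R < ‖y‖ → (fun z : ℝ × E3 => comp (u z.1) j z.2 • dT X z) (r, y) = 0 :=
    fun r y hy => by simp [hRT r y hy]
  have z0 : ∀ r y, R < ‖y‖ → (fun z : ℝ × E3 => comp (u z.1) j z.2 • X z) (r, y) = 0 :=
    fun r y hy => by simp [hR r y hy]
  obtain ⟨C, hC⟩ := (hK.prod (isCompact_closedBall (0 : E3) R)).exists_bound_of_continuousOn
    ((c1.add c2).mono (prod_mono hKs (subset_univ _)))
  rw [← integral_add (hint c1 z1 r hr) (hint c2 z2 r hr)]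
  refine (hasDerivAt_integral_of_dominated_loc_of_deriv_le (𝕜 := ℝ) (s := interior K)
    (bound := (Metric.closedBall (0 : E3) R).indicator fun _ => C)
    (F := fun s y => comp (u s) j y • X (s, y))
    (F' := fun s y => deriv (fun s => u s y) s j • X (s, y) + comp (u s) j y • dT X (s, y))
    (isOpen_interior.mem_nhds hrK) ?_ (hint c0 z0 r hr) ?_ ?_ ?_ ?_).2
  · filter_upwards [isOpen_Ioo.mem_nhds hr] with s hs
    exact (hint c0 z0 s hs).1
  · exact ((hint c1 z1 r hr).add (hint c2 z2 r hr)).1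
  · refine Filter.Eventually.of_forall fun y s hs => ?_
    by_cases hy : y ∈ Metric.closedBall (0 : E3) R
    · rw [indicator_of_mem hy]
      exact hC (s, y) ⟨interior_subset hs, hy⟩
    · rw [indicator_of_notMem hy]
      have hy' : R < ‖y‖ := by simpa using hy
      simp [hR s y hy', hRT s y hy']
  · exact (integrable_indicator_iff Metric.isClosed_closedBall.measurableSet).2
      (integrableOn_const (measure_closedBall_lt_top.ne))
  · refine Filter.Eventually.of_forall fun y s hs => ?_
    have hs' := hKs (interior_subset hs)
    have h1 : HasDerivAt (fun s => comp (u s) j y) (deriv (fun s => u s y) s j) s := by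
      have := (EuclideanSpace.proj (𝕜 := ℝ) j : E3 →L[ℝ] ℝ).hasFDerivAt.comp_hasDerivAt s
        (hu.differentiableAt_time s hs' y).hasDerivAt
      exact this
    have h2 := h1.smul (hasDerivAt_slice hX s y)
    rwa [add_comm] at h2

/-- The derivative of a divergence-free test of the solution; the pressure has disappeared. -/
theorem hasDerivAt_integral_comp_smul_lap (hu : IsClassicalSolution a b u p) {r : ℝ}
    (hr : r ∈ Ioo a b) {f : ℝ × E3 → ℂ} (hf : ContDiff ℝ ∞ f) {R : ℝ}
    (hR : ∀ r y, R < ‖y‖ → f (r, y) = 0) (i : Fin 3) :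
    HasDerivAt (fun s => ∫ y, comp (u s) i y • lap (slice f s) y)
      ((∑ j, ∫ y, comp (u r) j y •
          solField i (fun y => lap (slice f r) y + slice (dT f) r y) j y) +
        ∑ j, ∑ l, ∫ y, (comp (u r) j y * comp (u r) l y) •
          pd l (solField i (slice f r) j) y) r := by
  have hfT := contDiff_dT hf
  have hRT := dT_eq_zero_of_vanish hR
  -- Near `r` the single-component pairing equals the full divergence-free test, and it is the
  -- latter that the equation allows one to differentiate without the pressure.
  have h1 : (fun s => ∫ y, comp (u s) i y • lap (slice f s) y) =ᶠ[nhds r]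
      fun s => ∑ j, ∫ y, comp (u s) j y • solFieldX i f j (s, y) := by
    filter_upwards [isOpen_Ioo.mem_nhds hr] with s hs
    simp only [solFieldX_apply hf]
    exact (hu.sum_integral_solField hs (contDiff_slice hf s) (hasCompactSupport_slice hR s) i).symm
  have h2 := HasDerivAt.fun_sum (u := Finset.univ) fun j _ =>
    hu.hasDerivAt_integral_comp_smul hr (contDiff_solFieldX hf i j)
      (solFieldX_eq_zero_of_vanish hR i j) j
  refine (h2.congr_of_eventuallyEq h1).congr_deriv ?_
  rw [Finset.sum_add_distrib]
  simp only [dT_solFieldX hf, solFieldX_apply hf, solFieldX_apply hfT]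
  rw [hu.sum_integral_deriv_smul hr (contDiff_slice hf r) (hasCompactSupport_slice hR r) i]
  have h3 : ∀ j, ∫ y, comp (u r) j y •
        solField i (fun y => lap (slice f r) y + slice (dT f) r y) j y =
      (∫ y, comp (u r) j y • solField i (lap (slice f r)) j y) +
        ∫ y, comp (u r) j y • solField i (slice (dT f) r) j y := by
    intro j
    have hc := (contDiff_comp (hu.contDiff_space r hr) j).continuous
    have hl := contDiff_lap (contDiff_slice hf r)
    have ht := contDiff_slice hfT r
    rw [solField_add hl ht, ← integral_add]
    · simp only [smul_add]
    · exact integrable_smul_of_compactSupport hc (contDiff_solField hl i j).continuous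
        (hasCompactSupport_solField (hasCompactSupport_lap (hasCompactSupport_slice hR r)) i j)
    · exact integrable_smul_of_compactSupport hc (contDiff_solField ht i j).continuous
        (hasCompactSupport_solField (hasCompactSupport_slice hRT r) i j)
  rw [Finset.sum_congr rfl fun j _ => h3 j, Finset.sum_add_distrib]
  ring

end IsClassicalSolution

end NSLorentz

namespace NSLorentz

/-! ### Weak `L³` -/

/-- `v` is continuous and its weak `L³` quasinorm is at most `m`. -/
structure IsWeakL3 (m : ℝ) (v : E3 → E3) : Prop where
  pos : 0 < m
  continuous : Continuous v
  measure_le : ∀ α : ℝ, 0 < α → volume {x | α < ‖v x‖} ≤ ENNReal.ofReal ((m / α) ^ 3)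

theorem measurableSet_lt_norm {v : E3 → E3} (hv : Continuous v) (α : ℝ) :
    MeasurableSet {x | α < ‖v x‖} :=
  (isOpen_lt continuous_const hv.norm).measurableSet

namespace IsWeakL3

variable {m : ℝ} {v : E3 → E3}

/-- Dyadic layers: the part where `‖v‖ ~ 2^j λ` has measure at most `8m³/(2^j λ)³`, and the
resulting series in `2^(j(k-3))` converges because `k < 3`. -/
theorem setLIntegral_pow_le (hv : IsWeakL3 m v) {lam : ℝ} (hl : 0 < lam) {k : ℕ}
    (hk : k = 1 ∨ k = 2) :
    ∫⁻ x in {x | lam < ‖v x‖}, ‖v x‖ₑ ^ k ≤ ENNReal.ofReal (64 * m ^ 3 * lam ^ k / lam ^ 3) := by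
  have hm := hv.pos
  have h1 : ∀ x, {x | lam < ‖v x‖}.indicator (fun x => ‖v x‖ₑ ^ k) x ≤
      -- Each layer is placed in a superlevel set at half its height, since the weak bound concerns
      -- strict inequalities while the layer allows `‖v x‖ = 2^j λ`.
      ∑' j : ℕ, {x | 2 ^ j * lam / 2 < ‖v x‖}.indicator
        (fun _ => ENNReal.ofReal ((2 ^ (j + 1) * lam) ^ k)) x := by
    intro x
    by_cases hx : lam < ‖v x‖
    · obtain ⟨j, hj1, hj2⟩ := exists_nat_pow_near (x := ‖v x‖ / lam) (y := 2)
        ((one_le_div hl).2 hx.le) one_lt_two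
      rw [le_div_iff₀ hl] at hj1
      rw [div_lt_iff₀ hl] at hj2
      refine le_trans ?_ (ENNReal.le_tsum j)
      rw [indicator_of_mem (show x ∈ {x | lam < ‖v x‖} from hx), indicator_of_mem]
      · rw [← ofReal_norm, ← ENNReal.ofReal_pow (norm_nonneg _)]
        exact ENNReal.ofReal_le_ofReal (pow_le_pow_left₀ (norm_nonneg _) hj2.le k)
      · have : 0 < 2 ^ j * lam := by positivity
        show 2 ^ j * lam / 2 < ‖v x‖
        linarith
    · rw [indicator_of_notMem (show x ∉ {x | lam < ‖v x‖} from hx)]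
      exact zero_le
  rw [← lintegral_indicator (measurableSet_lt_norm hv.continuous lam)]
  refine (lintegral_mono h1).trans ?_
  rw [lintegral_tsum fun j => (measurable_const.indicator
    (measurableSet_lt_norm hv.continuous _)).aemeasurable]
  have h2 : ∀ j : ℕ, ∫⁻ x, {x | 2 ^ j * lam / 2 < ‖v x‖}.indicator
        (fun _ => ENNReal.ofReal ((2 ^ (j + 1) * lam) ^ k)) x ≤
      ENNReal.ofReal (32 * m ^ 3 * lam ^ k / lam ^ 3 * (1 / 2) ^ j) := by
    intro j
    rw [lintegral_indicator_const (measurableSet_lt_norm hv.continuous _)]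
    refine (mul_le_mul_right (hv.measure_le _ (by positivity)) _).trans ?_
    rw [← ENNReal.ofReal_mul (by positivity)]
    refine ENNReal.ofReal_le_ofReal ?_
    have e1 : (m / (2 ^ j * lam / 2)) ^ 3 = 8 * m ^ 3 / ((2 ^ j) ^ 3 * lam ^ 3) := by
      field_simp
      ring
    have e3 : (1 : ℝ) ≤ 2 ^ j := one_le_pow₀ one_le_two
    rw [e1, div_pow, one_pow, div_mul_div_comm, ← mul_div_assoc,
      div_le_div_iff₀ (by positivity) (by positivity)]
    rcases hk with rfl | rfl
    · rw [pow_one, pow_one, pow_succ]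
      have e4 : (2 : ℝ) ^ j * 2 ^ j ≤ (2 ^ j) ^ 3 := by
        nlinarith [mul_pos (show (0:ℝ) < 2 ^ j by positivity) (show (0:ℝ) < 2 ^ j by positivity)]
      have e5 : 0 ≤ 16 * m ^ 3 * lam ^ 4 := by positivity
      nlinarith [mul_le_mul_of_nonneg_left e4 e5]
    · rw [pow_succ]
      apply le_of_eq
      ring
  refine (ENNReal.tsum_le_tsum h2).trans ?_
  rw [← ENNReal.ofReal_tsum_of_nonneg (fun j => by positivity)
    (summable_geometric_two.mul_left _), tsum_mul_left, tsum_geometric_two]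
  refine ENNReal.ofReal_le_ofReal (le_of_eq ?_)
  ring

/-- Split at the height `λ`: where `‖v‖ ≤ λ` the mass of `κ` is used, elsewhere its supremum
together with the weak `L³` tail. -/
theorem lintegral_mul_pow_le (hv : IsWeakL3 m v) {lam : ℝ} (hl : 0 < lam) {k : ℕ}
    (hk : k = 1 ∨ k = 2) {κ : E3 → ℝ≥0∞} (hκm : Measurable κ) {B : ℝ≥0∞} (hB : ∀ y, κ y ≤ B) :
    ∫⁻ y, κ y * ‖v y‖ₑ ^ k ≤ ENNReal.ofReal (lam ^ k) * (∫⁻ y, κ y) +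
      B * ENNReal.ofReal (64 * m ^ 3 * lam ^ k / lam ^ 3) := by
  have hms := measurableSet_lt_norm hv.continuous lam
  have h1 : ∀ y, κ y * ‖v y‖ₑ ^ k ≤ ENNReal.ofReal (lam ^ k) * κ y +
      B * {x | lam < ‖v x‖}.indicator (fun x => ‖v x‖ₑ ^ k) y := by
    intro y
    by_cases hy : lam < ‖v y‖
    · rw [indicator_of_mem (show y ∈ {x | lam < ‖v x‖} from hy)]
      exact (mul_le_mul_left (hB y) _).trans le_add_self
    · refine le_trans ?_ le_self_add
      rw [mul_comm]
      gcongr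
      rw [← ofReal_norm, ← ENNReal.ofReal_pow (norm_nonneg _)]
      exact ENNReal.ofReal_le_ofReal (pow_le_pow_left₀ (norm_nonneg _) (not_lt.1 hy) k)
  refine (lintegral_mono h1).trans ?_
  have hvm : Measurable fun x => ‖v x‖ₑ ^ k := (hv.continuous.measurable.enorm).pow_const k
  rw [lintegral_add_left (hκm.const_mul _), lintegral_const_mul _ hκm,
    lintegral_const_mul _ (hvm.indicator hms), lintegral_indicator hms]
  gcongr
  exact hv.setLIntegral_pow_le hl hk

end IsWeakL3

/-! ### The basic majorant -/

/-- The majorant `N³ (1 + N|y|)^(-5)`. -/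
noncomputable def maj (N : ℝ) (y : E3) : ℝ := N ^ 3 * ((1 + N * ‖y‖) ^ 5)⁻¹

/-- The integral of the majorants. -/
noncomputable def majInt : ℝ := ∫ y : E3, maj 1 y

theorem continuous_maj {N : ℝ} (hN : 0 < N) : Continuous (maj N) := by
  unfold maj
  refine continuous_const.mul (Continuous.inv₀ (by fun_prop) fun y => ?_)
  positivity

theorem maj_nonneg {N : ℝ} (hN : 0 < N) (y : E3) : 0 ≤ maj N y := by
  unfold maj
  positivity

theorem maj_le {N : ℝ} (hN : 0 < N) (y : E3) : maj N y ≤ N ^ 3 := by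
  unfold maj
  refine mul_le_of_le_one_right (by positivity) (inv_le_one_of_one_le₀ (one_le_pow₀ ?_))
  have : 0 ≤ N * ‖y‖ := by positivity
  linarith

theorem integrable_inv_one_add_norm_pow {k : ℕ} (hk : 4 ≤ k) :
    Integrable (fun y : E3 => ((1 + ‖y‖) ^ k)⁻¹) := by
  have h := integrable_one_add_norm (E := E3) (μ := volume) (r := (k : ℝ)) (by
    rw [finrank_euclideanSpace_fin]
    exact_mod_cast hk)
  refine h.congr (Filter.Eventually.of_forall fun y => ?_)
  simp only
  rw [Real.rpow_neg (by positivity), Real.rpow_natCast]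

theorem integrable_maj_one : Integrable (maj 1) := by
  have := integrable_inv_one_add_norm_pow (k := 5) (by norm_num)
  refine this.congr (Filter.Eventually.of_forall fun y => ?_)
  simp [maj]

theorem majInt_nonneg : 0 ≤ majInt := integral_nonneg fun y => maj_nonneg one_pos y

theorem measurable_ofReal_maj {N : ℝ} (hN : 0 < N) :
    Measurable fun y => ENNReal.ofReal (maj N y) :=
  (continuous_maj hN).measurable.ennreal_ofReal

theorem lintegral_comp_smul_pos {N : ℝ} (hN : 0 < N) {f : E3 → ℝ≥0∞} (hf : Measurable f) :
    ∫⁻ y, ENNReal.ofReal (N ^ 3) * f (N • y) = ∫⁻ y, f y := by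
  have h1 := Measure.map_addHaar_smul (volume : Measure E3) hN.ne'
  rw [finrank_euclideanSpace_fin] at h1
  have h2 : ∫⁻ y, f (N • y) = ∫⁻ y, f y ∂(Measure.map (fun y : E3 => N • y) volume) :=
    (lintegral_map hf (measurable_const_smul N)).symm
  have h3 : Measurable fun y : E3 => f (N • y) := hf.comp (measurable_const_smul N)
  rw [lintegral_const_mul _ h3, h2]
  erw [h1]
  rw [lintegral_smul_measure, smul_eq_mul, ← mul_assoc, ← ENNReal.ofReal_mul (by positivity),
    abs_of_pos (by positivity), mul_inv_cancel₀ (by positivity)]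
  simp

theorem lintegral_maj {N : ℝ} (hN : 0 < N) :
    ∫⁻ y, ENNReal.ofReal (maj N y) = ENNReal.ofReal majInt := by
  have h := lintegral_comp_smul_pos hN (measurable_ofReal_maj one_pos)
  rw [majInt, ofReal_integral_eq_lintegral_ofReal integrable_maj_one
    (Filter.Eventually.of_forall fun y => maj_nonneg one_pos y), ← h]
  refine lintegral_congr fun y => ?_
  rw [← ENNReal.ofReal_mul (by positivity)]
  congr 1
  simp [maj, norm_smul, abs_of_pos hN]

/-- The constant in the tail estimate for the majorant. -/
noncomputable def majTail : ℝ := ∫ y : E3, ((1 + ‖y‖) ^ 4)⁻¹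

theorem majTail_nonneg : 0 ≤ majTail := integral_nonneg fun y => by positivity

/-- One of the five powers gives the factor `(Nρ)⁻¹`; the four that remain are integrable in
dimension three. -/
theorem lintegral_maj_tail_le {N ρ : ℝ} (hN : 0 < N) (hρ : 0 < ρ) :
    ∫⁻ y in {y : E3 | ρ ≤ ‖y‖}, ENNReal.ofReal (maj N y) ≤
      ENNReal.ofReal (majTail / (N * ρ)) := by
  have hm : Measurable fun y : E3 => ENNReal.ofReal (((1 + ‖y‖) ^ 4)⁻¹) := by fun_prop
  have hm' : Measurable fun y : E3 => ENNReal.ofReal (N ^ 3) *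
      ENNReal.ofReal (((1 + ‖N • y‖) ^ 4)⁻¹) := by fun_prop
  have hs : MeasurableSet {y : E3 | ρ ≤ ‖y‖} := (isClosed_le continuous_const continuous_norm).measurableSet
  have h := lintegral_comp_smul_pos hN hm
  have h0 : ENNReal.ofReal majTail = ∫⁻ y : E3, ENNReal.ofReal (((1 + ‖y‖) ^ 4)⁻¹) :=
    ofReal_integral_eq_lintegral_ofReal (integrable_inv_one_add_norm_pow le_rfl)
      (Filter.Eventually.of_forall fun y => by positivity)
  rw [div_eq_inv_mul, ENNReal.ofReal_mul (by positivity), h0, ← h,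
    ← lintegral_const_mul _ hm', ← lintegral_indicator hs]
  refine lintegral_mono fun y => ?_
  by_cases hy : ρ ≤ ‖y‖
  · rw [indicator_of_mem (show y ∈ {y : E3 | ρ ≤ ‖y‖} from hy),
      ← ENNReal.ofReal_mul (by positivity), ← ENNReal.ofReal_mul (by positivity)]
    refine ENNReal.ofReal_le_ofReal ?_
    rw [maj, norm_smul, Real.norm_eq_abs, abs_of_pos hN]
    have h1 : N * ρ ≤ 1 + N * ‖y‖ := by nlinarith
    have h2 : 0 < 1 + N * ‖y‖ := by positivity
    have h3 : ((1 + N * ‖y‖) ^ 5)⁻¹ = (1 + N * ‖y‖)⁻¹ * ((1 + N * ‖y‖) ^ 4)⁻¹ := by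
      rw [← mul_inv]
      congr 1
      ring
    rw [h3]
    have h4 : (1 + N * ‖y‖)⁻¹ ≤ (N * ρ)⁻¹ := inv_anti₀ (by positivity) h1
    have h5 : 0 ≤ N ^ 3 * ((1 + N * ‖y‖) ^ 4)⁻¹ := by positivity
    nlinarith [mul_le_mul_of_nonneg_right h4 h5]
  · rw [indicator_of_notMem (show y ∉ {y : E3 | ρ ≤ ‖y‖} from hy)]
    exact zero_le

namespace IsWeakL3

variable {m : ℝ} {v : E3 → E3}

/-- The height `λ = mN` balances the two parts: the kernel has mass `majInt` and supremum at most
`N³`, so both contribute multiples of `mN`. -/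
theorem lintegral_maj_mul_le (hv : IsWeakL3 m v) {N : ℝ} (hN : 0 < N) (x : E3) :
    ∫⁻ y, ENNReal.ofReal (maj N (y - x)) * ‖v y‖ₑ ≤
      ENNReal.ofReal ((majInt + 64) * m * N) := by
  have hm := hv.pos
  have h1 := hv.lintegral_mul_pow_le (lam := m * N) (by positivity) (k := 1) (Or.inl rfl)
    (κ := fun y => ENNReal.ofReal (maj N (y - x)))
    ((measurable_ofReal_maj hN).comp (measurable_id.sub_const x))
    (fun y => ENNReal.ofReal_le_ofReal (maj_le hN (y - x)))
  simp only [pow_one] at h1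
  refine h1.trans ?_
  rw [lintegral_sub_right_eq_self (fun y => ENNReal.ofReal (maj N y)) x, lintegral_maj hN,
    ← ENNReal.ofReal_mul (by positivity), ← ENNReal.ofReal_mul (by positivity),
    ← ENNReal.ofReal_add (mul_nonneg (by positivity) majInt_nonneg) (by positivity)]
  refine ENNReal.ofReal_le_ofReal (le_of_eq ?_)
  field_simp

theorem lintegral_maj_mul_sq_le (hv : IsWeakL3 m v) {N : ℝ} (hN : 0 < N) (x : E3) :
    ∫⁻ y, ENNReal.ofReal (maj N (y - x)) * ‖v y‖ₑ ^ 2 ≤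
      ENNReal.ofReal ((majInt + 64) * m ^ 2 * N ^ 2) := by
  have hm := hv.pos
  have h1 := hv.lintegral_mul_pow_le (lam := m * N) (by positivity) (k := 2) (Or.inr rfl)
    (κ := fun y => ENNReal.ofReal (maj N (y - x)))
    ((measurable_ofReal_maj hN).comp (measurable_id.sub_const x))
    (fun y => ENNReal.ofReal_le_ofReal (maj_le hN (y - x)))
  refine h1.trans ?_
  rw [lintegral_sub_right_eq_self (fun y => ENNReal.ofReal (maj N y)) x, lintegral_maj hN,
    ← ENNReal.ofReal_mul (by positivity), ← ENNReal.ofReal_mul (by positivity),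
    ← ENNReal.ofReal_add (mul_nonneg (by positivity) majInt_nonneg) (by positivity)]
  refine ENNReal.ofReal_le_ofReal (le_of_eq ?_)
  field_simp

end IsWeakL3

end NSLorentz

namespace NSLorentz

/-! ### The truncated test functions -/

theorem inv_pow_six_le_maj (y : E3) : ((1 + ‖y‖) ^ 6)⁻¹ ≤ maj 1 y := by
  have h : 1 ≤ 1 + ‖y‖ := by have := norm_nonneg y; linarith
  simp only [maj, one_pow, one_mul]
  exact inv_anti₀ (by positivity) (pow_le_pow_right₀ h (by norm_num))

/-- The heat kernels decay with one power more than `maj`. Beyond radius `R` the spare power becomes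
the gain `R⁻¹` that makes truncation errors vanish. -/
theorem inv_pow_six_le_div_maj {R : ℝ} (hR : 0 < R) {y : E3} (hy : R ≤ ‖y‖) :
    ((1 + ‖y‖) ^ 6)⁻¹ ≤ R⁻¹ * maj 1 y := by
  simp only [maj, one_pow, one_mul]
  rw [← mul_inv]
  refine inv_anti₀ (by positivity) ?_
  have h : R ≤ 1 + ‖y‖ := by linarith
  calc R * (1 + ‖y‖) ^ 5 ≤ (1 + ‖y‖) * (1 + ‖y‖) ^ 5 := by gcongr
    _ = (1 + ‖y‖) ^ 6 := by ring

theorem cutoff_eventuallyEq_one {R : ℝ} (hR : 0 < R) {y : E3} (hy : ‖y‖ < R) :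
    cutoff R =ᶠ[nhds y] fun _ => 1 := by
  have ho : IsOpen {z : E3 | ‖z‖ < R} := isOpen_lt continuous_norm continuous_const
  filter_upwards [ho.mem_nhds hy] with z hz
  exact cutoff_eq_one hR (le_of_lt hz)

theorem lap_congr_nhds {f g : E3 → ℂ} {y : E3} (h : f =ᶠ[nhds y] g) :
    lap f =ᶠ[nhds y] lap g := by
  have hpd : ∀ {f g : E3 → ℂ} (a : Fin 3), f =ᶠ[nhds y] g → pd a f =ᶠ[nhds y] pd a g := by
    intro f g a h
    filter_upwards [h.fderiv (𝕜 := ℝ)] with z hz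
    simp [pd, hz]
  have h2 : ∀ a, pd a (pd a f) =ᶠ[nhds y] pd a (pd a g) := fun a => hpd a (hpd a h)
  filter_upwards [h2 0, h2 1, h2 2] with z h0 h1 h2
  simp [lap, Fin.sum_univ_three, h0, h1, h2]

/-- The truncated, backward heat evolution of the kernel. -/
noncomputable def truncKer (b : E3 → ℂ) (t R : ℝ) : ℝ × E3 → ℂ :=
  fun z => cutoff R z.2 • heatKer b (t - z.1) z.2

/-- The error caused by the truncation. -/
noncomputable def truncErr (b : E3 → ℂ) (t R r : ℝ) : E3 → ℂ :=
  fun y => lap (slice (truncKer b t R) r) y + slice (dT (truncKer b t R)) r y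

namespace IsAnnular

variable {b : E3 → ℂ}

theorem contDiff_heatKer (hb : IsAnnular b) (σ : ℝ) : ContDiff ℝ ∞ (heatKer b σ) :=
  ContDiff.comp (g := fun q : ℝ × E3 => heatKer b q.1 q.2) (f := fun ξ : E3 => (σ, ξ))
    hb.contDiff_heatKer_uncurry (contDiff_const.prodMk contDiff_id)

theorem contDiff_truncKer (hb : IsAnnular b) (t R : ℝ) : ContDiff ℝ ∞ (truncKer b t R) := by
  unfold truncKer
  refine ContDiff.smul ((contDiff_cutoff R).comp contDiff_snd) ?_
  exact ContDiff.comp (g := fun q : ℝ × E3 => heatKer b q.1 q.2)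
    (f := fun z : ℝ × E3 => (t - z.1, z.2)) hb.contDiff_heatKer_uncurry
    ((contDiff_const.sub contDiff_fst).prodMk contDiff_snd)

theorem truncKer_eq_zero {t R : ℝ} (hR : 0 < R) (r : ℝ) (y : E3) (hy : 2 * R < ‖y‖) :
    truncKer b t R (r, y) = 0 := by
  simp [truncKer, cutoff_eq_zero hR hy.le]

theorem slice_truncKer (t R r : ℝ) :
    slice (truncKer b t R) r = fun y => cutoff R y • heatKer b (t - r) y := rfl

theorem dT_truncKer (hb : IsAnnular b) (t R r : ℝ) (y : E3) :
    dT (truncKer b t R) (r, y) = -(cutoff R y • lap (heatKer b (t - r)) y) := by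
  have h1 := hasDerivAt_slice (hb.contDiff_truncKer t R) r y
  have h2 : HasDerivAt (fun s => truncKer b t R (s, y))
      (cutoff R y • -lap (heatKer b (t - r)) y) r := by
    have := ((hb.hasDerivAt_heatKer (t - r) y).scomp r ((hasDerivAt_id r).const_sub t)).const_smul
      (cutoff R y)
    refine this.congr_deriv ?_
    simp
  rw [h1.unique h2, smul_neg]

theorem truncErr_eq (hb : IsAnnular b) (t R r : ℝ) :
    truncErr b t R r = fun y => lap (slice (truncKer b t R) r) y -
      cutoff R y • lap (heatKer b (t - r)) y := by
  funext y
  simp only [truncErr, slice, hb.dT_truncKer, sub_eq_add_neg]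

theorem contDiff_truncErr (hb : IsAnnular b) (t R r : ℝ) : ContDiff ℝ ∞ (truncErr b t R r) :=
  (contDiff_lap (contDiff_slice (hb.contDiff_truncKer t R) r)).add
    (contDiff_slice (contDiff_dT (hb.contDiff_truncKer t R)) r)

/-- The first two bounds keep the decay in time, for the free and the quadratic term of Duhamel. The
last two measure truncation: these quantities vanish on `‖y‖ < R`, so they gain `R⁻¹`, and decay in
time is not needed there. -/
theorem exists_truncKer_bounds (hb : IsAnnular b) :
    ∃ C : ℝ, 0 ≤ C ∧ ∀ t r R : ℝ, r ≤ t → 1 ≤ R → ∀ y : E3,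
      ‖lap (heatKer b (t - r)) y‖ ≤ C * ((1 + (t - r)) ^ 2)⁻¹ * maj 1 y ∧
      ‖iteratedFDeriv ℝ 3 (slice (truncKer b t R) r) y‖ ≤
        C * ((1 + (t - r)) ^ 2)⁻¹ * maj 1 y ∧
      ‖lap (slice (truncKer b t R) r) y - lap (heatKer b (t - r)) y‖ ≤ C * R⁻¹ * maj 1 y ∧
      ‖iteratedFDeriv ℝ 2 (truncErr b t R r) y‖ ≤ C * R⁻¹ * maj 1 y := by
  obtain ⟨B, hB0, hB⟩ := hb.exists_norm_iteratedFDeriv_heatKer_le 4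
  obtain ⟨D, hD0, hD⟩ := exists_norm_iteratedFDeriv_cutoff_smul_le 4
  refine ⟨3 * B + D * B + 6 * D * B, by positivity, fun t r R hrt hR y => ?_⟩
  have hR0 : 0 < R := by linarith
  have hσ : 0 ≤ t - r := by linarith
  have hs := hb.contDiff_heatKer (t - r)
  have hts := contDiff_slice (hb.contDiff_truncKer t R) r
  have hm := maj_nonneg one_pos y
  set τ : ℝ := ((1 + (t - r)) ^ 2)⁻¹ with hτ
  have hτ0 : 0 ≤ τ := by positivity
  have hτ1 : τ ≤ 1 := inv_le_one_of_one_le₀ (one_le_pow₀ (by linarith))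
  set q : ℝ := ((1 + ‖y‖) ^ 6)⁻¹ with hq
  have hq0 : 0 ≤ q := by positivity
  have hqm : q ≤ maj 1 y := inv_pow_six_le_maj y
  have k1 : ∀ n ≤ 4, ‖iteratedFDeriv ℝ n (heatKer b (t - r)) y‖ ≤ B * τ * q :=
    fun n hn => hB n hn (t - r) hσ y
  have k2 : ∀ n ≤ 4, ‖iteratedFDeriv ℝ n (slice (truncKer b t R) r) y‖ ≤ D * (B * τ * q) :=
    fun n hn => hD R hR _ hs y _ n hn fun i hi => k1 i (hi.trans hn)
  have k3 : ‖lap (heatKer b (t - r)) y‖ ≤ 3 * (B * τ * q) :=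
    (norm_lap_le hs y).trans (by have := k1 2 (by norm_num); linarith)
  have k4 : ‖lap (slice (truncKer b t R) r) y‖ ≤ 3 * (D * (B * τ * q)) :=
    (norm_lap_le hts y).trans (by have := k2 2 (by norm_num); linarith)
  have hτq : τ * q ≤ τ * maj 1 y := mul_le_mul_of_nonneg_left hqm hτ0
  have hBD : 0 ≤ D * B := by positivity
  refine ⟨?_, ?_, ?_, ?_⟩
  · have e : 3 * B * (τ * q) ≤ (3 * B + D * B + 6 * D * B) * (τ * maj 1 y) := by
      refine mul_le_mul ?_ hτq (by positivity) (by positivity)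
      nlinarith
    nlinarith
  · have e : D * B * (τ * q) ≤ (3 * B + D * B + 6 * D * B) * (τ * maj 1 y) := by
      refine mul_le_mul ?_ hτq (by positivity) (by positivity)
      nlinarith
    have := k2 3 (by norm_num)
    nlinarith
  · rcases lt_or_ge ‖y‖ R with hy | hy
    · have h1 : slice (truncKer b t R) r =ᶠ[nhds y] heatKer b (t - r) := by
        filter_upwards [cutoff_eventuallyEq_one hR0 hy] with z hz
        rw [slice_truncKer]
        simp [hz]
      rw [(lap_congr_nhds h1).eq_of_nhds, sub_self, norm_zero]
      positivity
    · have hqR : q ≤ R⁻¹ * maj 1 y := inv_pow_six_le_div_maj hR0 hy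
      have h2 : τ * q ≤ R⁻¹ * maj 1 y := (mul_le_of_le_one_left hq0 hτ1).trans hqR
      refine (norm_sub_le _ _).trans ((add_le_add k4 k3).trans ?_)
      have e : (3 * D * B + 3 * B) * (τ * q) ≤
          (3 * B + D * B + 6 * D * B) * (R⁻¹ * maj 1 y) := by
        refine mul_le_mul ?_ h2 (by positivity) (by positivity)
        nlinarith
      nlinarith
  · rcases lt_or_ge ‖y‖ R with hy | hy
    · have h1 : truncErr b t R r =ᶠ[nhds y] fun _ => 0 := by
        have h1 : slice (truncKer b t R) r =ᶠ[nhds y] heatKer b (t - r) := by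
          filter_upwards [cutoff_eventuallyEq_one hR0 hy] with z hz
          rw [slice_truncKer]
          simp [hz]
        filter_upwards [lap_congr_nhds h1, cutoff_eventuallyEq_one hR0 hy] with z hz hz2
        simp [hb.truncErr_eq, hz, hz2]
      rw [(h1.iteratedFDeriv ℝ 2).eq_of_nhds]
      simp only [iteratedFDeriv_fun_zero, Pi.zero_apply, norm_zero]
      positivity
    · have hqR : q ≤ R⁻¹ * maj 1 y := inv_pow_six_le_div_maj hR0 hy
      have h2 : τ * q ≤ R⁻¹ * maj 1 y := (mul_le_of_le_one_left hq0 hτ1).trans hqR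
      have hl := contDiff_lap hs
      have k5 : ∀ n ≤ 2, ‖iteratedFDeriv ℝ n (lap (heatKer b (t - r))) y‖ ≤ 3 * (B * τ * q) :=
        fun n hn => (norm_iteratedFDeriv_lap_le hs n y).trans
          (by have := k1 (n + 2) (by omega); linarith)
      have k6 : ‖iteratedFDeriv ℝ 2 (fun z => cutoff R z • lap (heatKer b (t - r)) z) y‖ ≤
          D * (3 * (B * τ * q)) := by
        exact hD R hR _ hl y _ 2 (by norm_num) k5
      have k7 : ‖iteratedFDeriv ℝ 2 (lap (slice (truncKer b t R) r)) y‖ ≤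
          3 * (D * (B * τ * q)) :=
        (norm_iteratedFDeriv_lap_le hts 2 y).trans (by have := k2 4 le_rfl; linarith)
      rw [hb.truncErr_eq]
      have h3 : iteratedFDeriv ℝ 2 (fun y => lap (slice (truncKer b t R) r) y -
          cutoff R y • lap (heatKer b (t - r)) y) y =
          iteratedFDeriv ℝ 2 (lap (slice (truncKer b t R) r)) y -
          iteratedFDeriv ℝ 2 (fun z => cutoff R z • lap (heatKer b (t - r)) z) y :=
        iteratedFDeriv_sub_apply ((contDiff_lap hts).contDiffAt.of_le (WithTop.coe_le_coe.2 le_top))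
          (((contDiff_cutoff R).smul hl).contDiffAt.of_le (WithTop.coe_le_coe.2 le_top))
      rw [h3]
      refine (norm_sub_le _ _).trans ((add_le_add k7 k6).trans ?_)
      have e : (6 * D * B) * (τ * q) ≤
          (3 * B + D * B + 6 * D * B) * (R⁻¹ * maj 1 y) := by
        refine mul_le_mul ?_ h2 (by positivity) (by positivity)
        nlinarith
      nlinarith

end IsAnnular

end NSLorentz

namespace NSLorentz

/-! ### The Duhamel inequality at unit frequency -/

theorem abs_comp_le (v : E3 → E3) (j : Fin 3) (y : E3) : |comp v j y| ≤ ‖v y‖ := by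
  have := PiLp.norm_apply_le (v y) j
  simpa [comp] using this

theorem measurable_maj_mul {g : E3 → ℝ≥0∞} (hg : Measurable g) :
    Measurable fun y => ENNReal.ofReal (maj 1 y) * g y :=
  (measurable_ofReal_maj one_pos).mul hg

theorem enorm_integral_comp_smul_le {v : E3 → E3} (hv : Continuous v) {w : E3 → ℂ} {B : ℝ}
    (hB : 0 ≤ B) (hw : ∀ y, ‖w y‖ ≤ B * maj 1 y) (j : Fin 3) :
    ‖∫ y, comp v j y • w y‖ₑ ≤
      ENNReal.ofReal B * ∫⁻ y, ENNReal.ofReal (maj 1 y) * ‖v y‖ₑ := by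
  rw [← lintegral_const_mul _ (measurable_maj_mul hv.measurable.enorm)]
  refine (enorm_integral_le_lintegral_enorm _).trans (lintegral_mono fun y => ?_)
  rw [← mul_assoc, ← ENNReal.ofReal_mul hB, ← ofReal_norm (v y), ← ENNReal.ofReal_mul
    (mul_nonneg hB (maj_nonneg one_pos y)), ← ofReal_norm, norm_smul, Real.norm_eq_abs, mul_comm]
  exact ENNReal.ofReal_le_ofReal (mul_le_mul (hw y) (abs_comp_le v j y) (abs_nonneg _)
    (mul_nonneg hB (maj_nonneg one_pos y)))

theorem enorm_integral_comp_mul_comp_smul_le {v : E3 → E3} (hv : Continuous v) {w : E3 → ℂ} {B : ℝ}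
    (hB : 0 ≤ B) (hw : ∀ y, ‖w y‖ ≤ B * maj 1 y) (j l : Fin 3) :
    ‖∫ y, (comp v j y * comp v l y) • w y‖ₑ ≤
      ENNReal.ofReal B * ∫⁻ y, ENNReal.ofReal (maj 1 y) * ‖v y‖ₑ ^ 2 := by
  rw [← lintegral_const_mul _ (measurable_maj_mul (hv.measurable.enorm.pow_const 2))]
  refine (enorm_integral_le_lintegral_enorm _).trans (lintegral_mono fun y => ?_)
  rw [← mul_assoc, ← ENNReal.ofReal_mul hB, ← ofReal_norm (v y),
    ← ENNReal.ofReal_pow (norm_nonneg _), ← ENNReal.ofReal_mul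
    (mul_nonneg hB (maj_nonneg one_pos y)), ← ofReal_norm, norm_smul, Real.norm_eq_abs, mul_comm,
    abs_mul, sq]
  exact ENNReal.ofReal_le_ofReal (mul_le_mul (hw y)
    (mul_le_mul (abs_comp_le v j y) (abs_comp_le v l y) (abs_nonneg _) (norm_nonneg _))
    (by positivity) (mul_nonneg hB (maj_nonneg one_pos y)))

theorem IsWeakL3.enorm_integral_comp_smul_le {m : ℝ} {v : E3 → E3} (hv : IsWeakL3 m v)
    {w : E3 → ℂ} {B : ℝ} (hB : 0 ≤ B) (hw : ∀ y, ‖w y‖ ≤ B * maj 1 y) (j : Fin 3) :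
    ‖∫ y, comp v j y • w y‖ₑ ≤ ENNReal.ofReal (B * ((majInt + 64) * m)) := by
  refine (NSLorentz.enorm_integral_comp_smul_le hv.continuous hB hw j).trans ?_
  rw [ENNReal.ofReal_mul hB]
  gcongr
  have := hv.lintegral_maj_mul_le one_pos 0
  simpa using this

theorem IsWeakL3.integrable_comp_smul {m : ℝ} {v : E3 → E3} (hv : IsWeakL3 m v)
    {w : E3 → ℂ} (hwc : Continuous w) {B : ℝ} (hB : 0 ≤ B) (hw : ∀ y, ‖w y‖ ≤ B * maj 1 y)
    (j : Fin 3) : Integrable fun y => comp v j y • w y := by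
  have hc : Continuous (comp v j) :=
    (EuclideanSpace.proj (𝕜 := ℝ) j : E3 →L[ℝ] ℝ).continuous.comp hv.continuous
  refine ⟨(hc.smul hwc).aestronglyMeasurable, ?_⟩
  refine lt_of_le_of_lt (b := ENNReal.ofReal B * ∫⁻ y, ENNReal.ofReal (maj 1 y) * ‖v y‖ₑ) ?_ ?_
  · rw [← lintegral_const_mul _ (measurable_maj_mul hv.continuous.measurable.enorm)]
    refine lintegral_mono fun y => ?_
    rw [← mul_assoc, ← ENNReal.ofReal_mul hB, ← ofReal_norm (v y), ← ENNReal.ofReal_mul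
      (mul_nonneg hB (maj_nonneg one_pos y)), ← ofReal_norm, norm_smul, Real.norm_eq_abs, mul_comm]
    exact ENNReal.ofReal_le_ofReal (mul_le_mul (hw y) (abs_comp_le v j y) (abs_nonneg _)
      (mul_nonneg hB (maj_nonneg one_pos y)))
  · have := hv.lintegral_maj_mul_le one_pos 0
    simp only [sub_zero] at this
    exact ENNReal.mul_lt_top ENNReal.ofReal_lt_top (this.trans_lt ENNReal.ofReal_lt_top)

/-- The pairing of `u(r)` with the backward heat evolution of the kernel changes in time only
through `u ⊗ u`, since the two Laplacians cancel. Integration from `s` to `t` leaves the pairing at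
time `s`, small by the decay of the heat kernel, and the quadratic term. The argument runs with the
truncated kernel, followed by `R → ∞`. -/
theorem IsAnnular.exists_duhamel (hb : IsAnnular b) :
    ∃ C : ℝ, 0 ≤ C ∧ ∀ {α β : ℝ} {u : ℝ → E3 → E3} {p : ℝ → E3 → ℝ} {m : ℝ},
      IsClassicalSolution α β u p → (∀ r ∈ Ioo α β, IsWeakL3 m (u r)) →
      ∀ {s t : ℝ}, α < s → s < t → t < β → ∀ i : Fin 3,
      ‖∫ y, comp (u t) i y • lap (heatKer b 0) y‖ₑ ≤
        ENNReal.ofReal (C * m * ((1 + (t - s)) ^ 2)⁻¹) +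
        ENNReal.ofReal C * ∫⁻ r in Ioo s t, ENNReal.ofReal (((1 + (t - r)) ^ 2)⁻¹) *
          ∫⁻ y, ENNReal.ofReal (maj 1 y) * ‖u r y‖ₑ ^ 2 := by
  obtain ⟨C, hC0, hC⟩ := hb.exists_truncKer_bounds
  obtain ⟨cm, hcm⟩ : ∃ cm : ℝ, cm = majInt + 64 := ⟨_, rfl⟩
  have hcm0 : 0 ≤ cm := by have := majInt_nonneg; rw [hcm]; linarith
  -- The `36` is `9 · 4`: nine pairs `(j, l)` and the factor `4` of `norm_pd_solField_le`.
  refine ⟨C * cm + 36 * C, by positivity, fun {α β u p m} hu hw {s t} hs hst ht i => ?_⟩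
  have htI : t ∈ Ioo α β := ⟨hs.trans hst, ht⟩
  have hsI : s ∈ Ioo α β := ⟨hs, hst.trans ht⟩
  have hm : 0 < m := (hw t htI).pos
  have hI : ∀ r ∈ Icc s t, r ∈ Ioo α β := fun r hr => ⟨hs.trans_le hr.1, hr.2.trans_lt ht⟩
  have hP : ∀ r ∈ Ioo α β, ∀ {w : E3 → ℂ} {B : ℝ}, 0 ≤ B → (∀ y, ‖w y‖ ≤ B * maj 1 y) →
      ∀ j, ‖∫ y, comp (u r) j y • w y‖ₑ ≤ ENNReal.ofReal (B * (cm * m)) := by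
    intro r hr w B hB hwB j
    rw [hcm]
    exact (hw r hr).enorm_integral_comp_smul_le hB hwB j
  set G : ℝ → ℝ≥0∞ := fun r => ENNReal.ofReal (((1 + (t - r)) ^ 2)⁻¹) *
    ∫⁻ y, ENNReal.ofReal (maj 1 y) * ‖u r y‖ₑ ^ 2 with hG
  set V : ℝ → ℂ := fun r => ∫ y, comp (u r) i y • lap (heatKer b (t - r)) y with hV
  -- the derivative of the truncated pairing
  have hD : ∀ R : ℝ, 1 ≤ R → ∀ r ∈ Icc s t,
      DifferentiableAt ℝ (fun s => ∫ y, comp (u s) i y • lap (slice (truncKer b t R) s) y) r ∧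
      ‖deriv (fun s => ∫ y, comp (u s) i y • lap (slice (truncKer b t R) s) y) r‖ₑ ≤
        ENNReal.ofReal (12 * C * cm * m * R⁻¹) + ENNReal.ofReal (36 * C) * G r := by
    intro R hR r hr
    have hR0 : 0 < R := by linarith
    have hwr := hw r (hI r hr)
    have h1 := hu.hasDerivAt_integral_comp_smul_lap (hI r hr) (hb.contDiff_truncKer t R)
      (IsAnnular.truncKer_eq_zero hR0) i
    refine ⟨h1.differentiableAt, ?_⟩
    rw [h1.deriv]
    refine (enorm_add_le _ _).trans (add_le_add ?_ ?_)
    · refine (enorm_sum_le _ _).trans ?_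
      refine (Finset.sum_le_card_nsmul _ _ (ENNReal.ofReal (4 * (C * R⁻¹) * (cm * m)))
        fun j _ => ?_).trans ?_
      · refine hP r (hI r hr) (by positivity) (fun y => ?_) j
        refine (norm_solField_le (hb.contDiff_truncErr t R r) i j y).trans ?_
        have := (hC t r R hr.2 hR y).2.2.2
        linarith
      · rw [Finset.card_univ, Fintype.card_fin, nsmul_eq_mul, ← ENNReal.ofReal_natCast,
          ← ENNReal.ofReal_mul (by positivity)]
        refine ENNReal.ofReal_le_ofReal (le_of_eq ?_)
        push_cast
        ring
    · have e : ∀ j l : Fin 3, ‖∫ y, (comp (u r) j y * comp (u r) l y) •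
          pd l (solField i (slice (truncKer b t R) r) j) y‖ₑ ≤ ENNReal.ofReal (4 * C) * G r := by
        intro j l
        have hτ : 0 ≤ ((1 + (t - r)) ^ 2)⁻¹ := by positivity
        refine (enorm_integral_comp_mul_comp_smul_le hwr.continuous
          (B := 4 * C * ((1 + (t - r)) ^ 2)⁻¹) (by positivity) (fun y => ?_) j l).trans ?_
        · refine (norm_pd_solField_le (contDiff_slice (hb.contDiff_truncKer t R) r) i j l y).trans ?_
          have := (hC t r R hr.2 hR y).2.1
          linarith
        · rw [hG, ENNReal.ofReal_mul (by positivity), mul_assoc]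
      refine (enorm_sum_le _ _).trans ?_
      refine (Finset.sum_le_card_nsmul _ _ (ENNReal.ofReal (12 * C) * G r) fun j _ => ?_).trans ?_
      · refine (enorm_sum_le _ _).trans ?_
        refine (Finset.sum_le_card_nsmul _ _ _ fun l _ => e j l).trans ?_
        rw [Finset.card_univ, Fintype.card_fin, nsmul_eq_mul, ← ENNReal.ofReal_natCast, ← mul_assoc,
          ← ENNReal.ofReal_mul (by positivity)]
        refine le_of_eq ?_
        congr 2
        push_cast
        ring
      · rw [Finset.card_univ, Fintype.card_fin, nsmul_eq_mul, ← ENNReal.ofReal_natCast, ← mul_assoc,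
          ← ENNReal.ofReal_mul (by positivity)]
        refine le_of_eq ?_
        congr 2
        push_cast
        ring
  have hGle : ∀ r ∈ Icc s t, G r ≤ ENNReal.ofReal (cm * m ^ 2) := by
    intro r hr
    have h1 : ((1 + (t - r)) ^ 2)⁻¹ ≤ 1 :=
      inv_le_one_of_one_le₀ (one_le_pow₀ (by linarith [hr.2]))
    have h2 := (hw r (hI r hr)).lintegral_maj_mul_sq_le one_pos 0
    simp only [sub_zero, one_pow, mul_one, ← hcm] at h2
    calc G r ≤ 1 * ENNReal.ofReal (cm * m ^ 2) := by
          refine mul_le_mul' ?_ h2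
          simpa using ENNReal.ofReal_le_ofReal h1
      _ = _ := one_mul _
  -- integration in time
  have hF : ∀ R : ℝ, 1 ≤ R →
      ‖∫ y, comp (u t) i y • lap (slice (truncKer b t R) t) y‖ₑ ≤
        ‖∫ y, comp (u s) i y • lap (slice (truncKer b t R) s) y‖ₑ +
        (ENNReal.ofReal (12 * C * cm * m * R⁻¹ * (t - s)) +
          ENNReal.ofReal (36 * C) * ∫⁻ r in Ioo s t, G r) := by
    intro R hR
    have hR0 : 0 < R := by linarith
    set F : ℝ → ℂ := fun s => ∫ y, comp (u s) i y • lap (slice (truncKer b t R) s) y with hFdef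
    -- Continuity of the derivative in time is not required: derivatives are automatically
    -- measurable, and the crude energy bound makes this one bounded on `[s, t]`.
    have hmeas : StronglyMeasurable (deriv F) := stronglyMeasurable_deriv F
    have hbd : ∀ r ∈ Icc s t, ‖deriv F r‖ₑ ≤
        ENNReal.ofReal (12 * C * cm * m * R⁻¹) + ENNReal.ofReal (36 * C) *
          ENNReal.ofReal (cm * m ^ 2) := fun r hr =>
      ((hD R hR r hr).2).trans (by gcongr; exact hGle r hr)
    have hii : IntervalIntegrable (deriv F) volume s t := by
      rw [intervalIntegrable_iff_integrableOn_Ioc_of_le hst.le]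
      refine ⟨hmeas.aestronglyMeasurable, ?_⟩
      refine lt_of_le_of_lt (setLIntegral_mono measurable_const
        fun r hr => hbd r (Ioc_subset_Icc_self hr)) ?_
      rw [setLIntegral_const]
      refine ENNReal.mul_lt_top (ENNReal.add_lt_top.2 ⟨ENNReal.ofReal_lt_top,
        ENNReal.mul_lt_top ENNReal.ofReal_lt_top ENNReal.ofReal_lt_top⟩) ?_
      simp
    have hftc := intervalIntegral.integral_eq_sub_of_hasDerivAt (f := F) (f' := deriv F)
      (fun r hr => ((hD R hR r (by rwa [uIcc_of_le hst.le] at hr)).1).hasDerivAt) hii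
    have hFt : F t = F s + ∫ r in s..t, deriv F r := by rw [hftc]; ring
    show ‖F t‖ₑ ≤ ‖F s‖ₑ + _
    rw [hFt]
    refine (enorm_add_le _ _).trans (add_le_add le_rfl ?_)
    rw [intervalIntegral.integral_of_le hst.le]
    refine (enorm_integral_le_lintegral_enorm _).trans ?_
    rw [← restrict_Ioo_eq_restrict_Ioc]
    refine (setLIntegral_mono' measurableSet_Ioo
      fun r hr => (hD R hR r (Ioo_subset_Icc_self hr)).2).trans ?_
    rw [lintegral_add_left measurable_const, setLIntegral_const, Real.volume_Ioo,
      ← ENNReal.ofReal_mul (by positivity), lintegral_const_mul' _ _ ENNReal.ofReal_ne_top]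
  -- removal of the truncation
  have hE : ∀ R : ℝ, 1 ≤ R → ∀ r ∈ Icc s t,
      ‖(∫ y, comp (u r) i y • lap (slice (truncKer b t R) r) y) - V r‖ₑ ≤
        ENNReal.ofReal (C * R⁻¹ * (cm * m)) := by
    intro R hR r hr
    have hR0 : 0 < R := by linarith
    have hwr := hw r (hI r hr)
    have hcl : ContDiff ℝ ∞ (lap (heatKer b (t - r))) := contDiff_lap (hb.contDiff_heatKer _)
    have hct : ContDiff ℝ ∞ (lap (slice (truncKer b t R) r)) :=
      contDiff_lap (contDiff_slice (hb.contDiff_truncKer t R) r)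
    have hi1 : Integrable fun y => comp (u r) i y • lap (heatKer b (t - r)) y :=
      hwr.integrable_comp_smul hcl.continuous (B := C * ((1 + (t - r)) ^ 2)⁻¹) (by positivity)
        (fun y => (hC t r R hr.2 hR y).1) i
    have hi2 : Integrable fun y => comp (u r) i y • lap (slice (truncKer b t R) r) y :=
      hwr.integrable_comp_smul hct.continuous
        (B := C * R⁻¹ + C * ((1 + (t - r)) ^ 2)⁻¹) (by positivity)
        (fun y => by
          have h1 := (hC t r R hr.2 hR y).1
          have h2 := (hC t r R hr.2 hR y).2.2.1
          have h3 := norm_le_norm_sub_add (lap (slice (truncKer b t R) r) y)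
            (lap (heatKer b (t - r)) y)
          rw [add_mul]
          linarith) i
    rw [hV, ← integral_sub hi2 hi1]
    simp only [← smul_sub]
    exact hP r (hI r hr) (by positivity) (fun y => (hC t r R hr.2 hR y).2.2.1) i
  have hVs : ‖V s‖ₑ ≤ ENNReal.ofReal (C * cm * m * ((1 + (t - s)) ^ 2)⁻¹) := by
    have := hP s hsI (w := lap (heatKer b (t - s)))
      (B := C * ((1 + (t - s)) ^ 2)⁻¹) (by positivity)
      (fun y => (hC t s 1 hst.le le_rfl y).1) i
    refine this.trans (ENNReal.ofReal_le_ofReal (le_of_eq ?_))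
    ring
  have hfin : ∀ R : ℝ, 1 ≤ R → ‖V t‖ₑ ≤
      (ENNReal.ofReal (C * cm * m * ((1 + (t - s)) ^ 2)⁻¹) +
        ENNReal.ofReal (36 * C) * ∫⁻ r in Ioo s t, G r) +
        ENNReal.ofReal ((2 * C * (cm * m) + 12 * C * cm * m * (t - s)) * R⁻¹) := by
    intro R hR
    have hR0 : 0 < R := by linarith
    have e1 := hE R hR t ⟨hst.le, le_rfl⟩
    have e2 := hE R hR s ⟨le_rfl, hst.le⟩
    set Ft : ℂ := ∫ y, comp (u t) i y • lap (slice (truncKer b t R) t) y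
    set Fs : ℂ := ∫ y, comp (u s) i y • lap (slice (truncKer b t R) s) y
    have h3 : ‖Ft‖ₑ ≤ _ := hF R hR
    have h4 : ‖V t‖ₑ ≤ ‖Ft - V t‖ₑ + ‖Ft‖ₑ := by
      have : V t = Ft - (Ft - V t) := by ring
      calc ‖V t‖ₑ = ‖Ft - (Ft - V t)‖ₑ := by rw [← this]
        _ ≤ ‖Ft‖ₑ + ‖Ft - V t‖ₑ := enorm_sub_le
        _ = _ := add_comm _ _
    have h5 : ‖Fs‖ₑ ≤ ‖Fs - V s‖ₑ + ‖V s‖ₑ := by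
      have : Fs = (Fs - V s) + V s := by ring
      calc ‖Fs‖ₑ = ‖(Fs - V s) + V s‖ₑ := by rw [← this]
        _ ≤ _ := enorm_add_le _ _
    refine h4.trans ((add_le_add e1 (h3.trans (add_le_add (h5.trans (add_le_add e2 hVs))
      le_rfl))).trans (le_of_eq ?_))
    have hts : 0 ≤ t - s := by linarith
    rw [add_mul, ENNReal.ofReal_add (by positivity) (by positivity)]
    have e3 : (2 * C * (cm * m) * R⁻¹) = C * R⁻¹ * (cm * m) + C * R⁻¹ * (cm * m) := by ring
    have e4 : 12 * C * cm * m * (t - s) * R⁻¹ = 12 * C * cm * m * R⁻¹ * (t - s) := by ring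
    rw [e3, e4, ENNReal.ofReal_add (by positivity) (by positivity)]
    ring
  -- For fixed `s` and `t` the whole truncation error is a constant times `R⁻¹`.
  have hlim : ‖V t‖ₑ ≤ ENNReal.ofReal (C * cm * m * ((1 + (t - s)) ^ 2)⁻¹) +
        ENNReal.ofReal (36 * C) * ∫⁻ r in Ioo s t, G r := by
    have h1 : Filter.Tendsto (fun R : ℝ => ENNReal.ofReal
        ((2 * C * (cm * m) + 12 * C * cm * m * (t - s)) * R⁻¹)) Filter.atTop (nhds 0) := by
      have := (tendsto_inv_atTop_zero (𝕜 := ℝ)).const_mul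
        (2 * C * (cm * m) + 12 * C * cm * m * (t - s))
      rw [mul_zero] at this
      rw [← ENNReal.ofReal_zero]
      exact (ENNReal.continuous_ofReal.tendsto 0).comp this
    have h2 := h1.const_add (ENNReal.ofReal (C * cm * m * ((1 + (t - s)) ^ 2)⁻¹) +
        ENNReal.ofReal (36 * C) * ∫⁻ r in Ioo s t, G r)
    rw [add_zero] at h2
    refine ge_of_tendsto h2 ?_
    filter_upwards [Filter.eventually_ge_atTop 1] with R hR
    exact hfin R hR
  have hVt : V t = ∫ y, comp (u t) i y • lap (heatKer b 0) y := by
    rw [hV]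
    simp
  rw [← hVt]
  refine hlim.trans (add_le_add (ENNReal.ofReal_le_ofReal ?_) ?_)
  · have : 0 ≤ m * ((1 + (t - s)) ^ 2)⁻¹ := by positivity
    nlinarith [mul_nonneg hC0 this]
  · gcongr
    nlinarith [mul_nonneg hC0 hcm0]

end NSLorentz

namespace NSLorentz

/-! ### Scaling of solutions -/

/-- The velocity field rescaled about `(t, x)` by the factor `l`. -/
def scaleVel (l t : ℝ) (x : E3) (u : ℝ → E3 → E3) : ℝ → E3 → E3 :=
  fun s y => l • u (t + l ^ 2 * s) (x + l • y)

/-- The pressure rescaled about `(t, x)` by the factor `l`. -/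
def scalePre (l t : ℝ) (x : E3) (p : ℝ → E3 → ℝ) : ℝ → E3 → ℝ :=
  fun s y => l ^ 2 • p (t + l ^ 2 * s) (x + l • y)

theorem fderiv_comp_affine {F : Type*} [NormedAddCommGroup F] [NormedSpace ℝ F] (g : E3 → F)
    (x : E3) (l : ℝ) (y : E3) :
    fderiv ℝ (fun y => g (x + l • y)) y = l • fderiv ℝ g (x + l • y) := by
  rw [fderiv_comp_smul (f := fun z => g (x + z)) l, fderiv_comp_add_left]

theorem fderiv_smul_comp_affine {F : Type*} [NormedAddCommGroup F] [NormedSpace ℝ F] (g : E3 → F)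
    (x : E3) {c : ℝ} (l : ℝ) (y : E3) :
    fderiv ℝ (fun y => c • g (x + l • y)) y = (c * l) • fderiv ℝ g (x + l • y) := by
  have h : (fun y => c • g (x + l • y)) = c • fun y => g (x + l • y) := rfl
  rw [h, fderiv_const_smul_field, Pi.smul_apply, fderiv_comp_affine, smul_smul]

theorem laplacian_eq_sum_fderiv (v : E3 → E3) (y : E3) :
    Laplacian.laplacian v y = ∑ c : Fin 3, fderiv ℝ (fderiv ℝ v) y (EuclideanSpace.single c 1)
      (EuclideanSpace.single c 1) := by
  rw [InnerProductSpace.laplacian_eq_iteratedFDeriv_orthonormalBasis v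
    (EuclideanSpace.basisFun (Fin 3) ℝ)]
  refine Finset.sum_congr rfl fun c _ => ?_
  rw [iteratedFDeriv_two_apply]
  simp

theorem gradient_smul_comp_affine (q : E3 → ℝ) (x : E3) (c l : ℝ) (y : E3) :
    gradient (fun y => c • q (x + l • y)) y = (c * l) • gradient q (x + l • y) := by
  rw [gradient, gradient, fderiv_smul_comp_affine]
  simp

namespace IsClassicalSolution

variable {a b : ℝ} {u : ℝ → E3 → E3} {p : ℝ → E3 → ℝ}

theorem scale (hu : IsClassicalSolution a b u p) {l : ℝ} (hl : 0 < l) (t : ℝ) (x : E3) :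
    IsClassicalSolution ((a - t) / l ^ 2) ((b - t) / l ^ 2) (scaleVel l t x u)
      (scalePre l t x p) := by
  have hl2 : 0 < l ^ 2 := by positivity
  have hIoo : ∀ s ∈ Ioo ((a - t) / l ^ 2) ((b - t) / l ^ 2), t + l ^ 2 * s ∈ Ioo a b := by
    intro s hs
    have h1 := (div_lt_iff₀ hl2).1 hs.1
    have h2 := (lt_div_iff₀ hl2).1 hs.2
    constructor <;> nlinarith
  have hIcc : ∀ s ∈ Icc ((a - t) / l ^ 2) ((b - t) / l ^ 2), t + l ^ 2 * s ∈ Icc a b := by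
    intro s hs
    have h1 := (div_le_iff₀ hl2).1 hs.1
    have h2 := (le_div_iff₀ hl2).1 hs.2
    constructor <;> nlinarith
  have hA : Continuous fun z : ℝ × E3 => ((t + l ^ 2 * z.1, x + l • z.2) : ℝ × E3) := by fun_prop
  have hmap : MapsTo (fun z : ℝ × E3 => ((t + l ^ 2 * z.1, x + l • z.2) : ℝ × E3))
      (Ioo ((a - t) / l ^ 2) ((b - t) / l ^ 2) ×ˢ univ) (Ioo a b ×ˢ univ) :=
    fun z hz => ⟨hIoo z.1 hz.1, mem_univ _⟩
  have hmap' : MapsTo (fun z : ℝ × E3 => ((t + l ^ 2 * z.1, x + l • z.2) : ℝ × E3))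
      (Icc ((a - t) / l ^ 2) ((b - t) / l ^ 2) ×ˢ univ) (Icc a b ×ˢ univ) :=
    fun z hz => ⟨hIcc z.1 hz.1, mem_univ _⟩
  have htime : ∀ s ∈ Ioo ((a - t) / l ^ 2) ((b - t) / l ^ 2), ∀ y,
      HasDerivAt (fun s => scaleVel l t x u s y)
        (l ^ 3 • deriv (fun s => u s (x + l • y)) (t + l ^ 2 * s)) s := by
    intro s hs y
    have h1 := (hu.differentiableAt_time _ (hIoo s hs) (x + l • y)).hasDerivAt
    have h2 : HasDerivAt (fun s : ℝ => t + l ^ 2 * s) (l ^ 2) s := by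
      simpa using ((hasDerivAt_id s).const_mul (l ^ 2)).const_add t
    have h3 := (h1.scomp s h2).const_smul l
    refine h3.congr_deriv ?_
    rw [smul_smul]
    congr 1
    ring
  have hf1 : ∀ s y, fderiv ℝ (scaleVel l t x u s) y =
      (l * l) • fderiv ℝ (u (t + l ^ 2 * s)) (x + l • y) := fun s y =>
    fderiv_smul_comp_affine (u (t + l ^ 2 * s)) x l y
  have hf2 : ∀ s y, fderiv ℝ (fderiv ℝ (scaleVel l t x u s)) y =
      (l * l * l) • fderiv ℝ (fderiv ℝ (u (t + l ^ 2 * s))) (x + l • y) := by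
    intro s y
    have : fderiv ℝ (scaleVel l t x u s) =
        fun y => (l * l) • fderiv ℝ (u (t + l ^ 2 * s)) (x + l • y) := funext (hf1 s)
    rw [this]
    exact fderiv_smul_comp_affine (fderiv ℝ (u (t + l ^ 2 * s))) x l y
  have hg : ∀ s y, gradient (scalePre l t x p s) y =
      (l ^ 2 * l) • gradient (p (t + l ^ 2 * s)) (x + l • y) := fun s y =>
    gradient_smul_comp_affine (p (t + l ^ 2 * s)) x (l ^ 2) l y
  refine ⟨?_, ?_, ?_, ?_, ?_, ?_, ?_, ?_, ?_, ?_⟩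
  · exact (hu.continuousOn_u.comp hA.continuousOn hmap').const_smul l
  · exact fun s hs y => (htime s hs y).differentiableAt
  · refine ((hu.continuousOn_deriv_time.comp hA.continuousOn hmap).const_smul (l ^ 3)).congr ?_
    intro z hz
    exact (htime z.1 hz.1 z.2).deriv
  · intro s hs
    exact ((hu.contDiff_space _ (hIoo s hs)).comp
      (contDiff_const.add (contDiff_const_smul l))).const_smul l
  · refine ((hu.continuousOn_fderiv.comp hA.continuousOn hmap).const_smul (l * l)).congr ?_
    intro z hz
    exact hf1 z.1 z.2
  · refine ((hu.continuousOn_fderiv_fderiv.comp hA.continuousOn hmap).const_smul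
      (l * l * l)).congr ?_
    intro z hz
    exact hf2 z.1 z.2
  · intro s hs
    exact ((hu.differentiable_pressure _ (hIoo s hs)).comp
      ((differentiable_id.const_smul l).const_add x)).const_smul (l ^ 2)
  · refine ((hu.continuousOn_gradient_pressure.comp hA.continuousOn hmap).const_smul
      (l ^ 2 * l)).congr ?_
    intro z hz
    exact hg z.1 z.2
  · intro s hs y
    rw [(htime s hs y).deriv, laplacian_eq_sum_fderiv, hf1, hg]
    simp only [hf2]
    have h := congrArg (fun v => l ^ 3 • v) (hu.momentum _ (hIoo s hs) (x + l • y))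
    simp only [smul_zero, laplacian_eq_sum_fderiv] at h
    rw [← h]
    simp only [scaleVel, smul_apply, map_smul, smul_add, smul_sub, smul_smul,
      Finset.smul_sum]
    ring_nf
  · intro s hs y
    have h := hu.div_free _ (hIoo s hs) (x + l • y)
    simp only [divergence] at h ⊢
    simp only [hf1, smul_apply, WithLp.ofLp_smul, Pi.smul_apply, smul_eq_mul]
    rw [← Finset.mul_sum, h, mul_zero]

end IsClassicalSolution

/-- The space is critical: dilation divides the measure of the level set by `l³`, while the level
becomes `α/l`. -/
theorem IsWeakL3.scale {m : ℝ} {v : E3 → E3} (hv : IsWeakL3 m v) {l : ℝ} (hl : 0 < l) (x : E3) :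
    IsWeakL3 m fun y => l • v (x + l • y) where
  pos := hv.pos
  continuous := by
    have := hv.continuous
    fun_prop
  measure_le α hα := by
    have hm := hv.pos
    have h1 : {y | α < ‖l • v (x + l • y)‖} =
        (fun y : E3 => l • y) ⁻¹' ((fun y => x + y) ⁻¹' {y | α / l < ‖v y‖}) := by
      ext y
      simp only [mem_ofPred_eq, mem_preimage, norm_smul, Real.norm_eq_abs, abs_of_pos hl]
      rw [div_lt_iff₀ hl, mul_comm]
    rw [h1, Measure.addHaar_preimage_smul _ hl.ne', measure_preimage_add,
      finrank_euclideanSpace_fin]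
    refine (mul_le_mul_right (hv.measure_le (α / l) (by positivity)) _).trans ?_
    rw [← ENNReal.ofReal_mul (by positivity), abs_of_pos (by positivity)]
    refine ENNReal.ofReal_le_ofReal (le_of_eq ?_)
    field_simp

end NSLorentz

namespace NSLorentz

/-! ### The Littlewood-Paley kernels -/

variable {φ : E3 → ℝ}

theorem fourierInv_comp_smul {f : E3 → ℂ} {N : ℝ} (hN : 0 < N) (y : E3) :
    𝓕⁻ (fun ξ => f (N⁻¹ • ξ)) y = ((N ^ 3 : ℝ) : ℂ) * 𝓕⁻ f (N • y) := by
  rw [Real.fourierInv_eq, Real.fourierInv_eq]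
  have h := Measure.integral_comp_inv_smul (volume : Measure E3)
    (fun ξ : E3 => Real.fourierChar (inner ℝ ξ (N • y)) • f ξ) N
  rw [finrank_euclideanSpace_fin, abs_of_pos (by positivity), Complex.real_smul] at h
  rw [← h]
  refine integral_congr_ae (Filter.Eventually.of_forall fun ξ => ?_)
  simp only
  rw [inner_smul_left, inner_smul_right]
  simp only [conj_trivial]
  rw [← mul_assoc, inv_mul_cancel₀ hN.ne', one_mul]

theorem kernelLe_eq {N : ℝ} (hN : 0 < N) (y : E3) :
    kernelLe φ N y = ((N ^ 3 : ℝ) : ℂ) * kernelLe φ 1 (N • y) := by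
  have h := fourierInv_comp_smul (f := symbolLe φ 1) hN y
  have h2 : (fun ξ => symbolLe φ 1 (N⁻¹ • ξ)) = symbolLe φ N := by
    funext ξ
    simp [symbolLe]
  rw [h2] at h
  exact h

theorem kernelLe_eq_schwartz (hφ : IsBump φ) {N : ℝ} (hN : 0 < N) :
    ∃ g : SchwartzMap E3 ℂ, kernelLe φ N = g := by
  obtain ⟨g, hg⟩ := exists_schwartz_symbolLe hφ hN
  refine ⟨(𝓕⁻ g : SchwartzMap E3 ℂ), ?_⟩
  rw [kernelLe, show symbolLe φ N = g from (funext hg).symm, SchwartzMap.fourierInv_coe]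

theorem continuous_kernelLe (hφ : IsBump φ) {N : ℝ} (hN : 0 < N) : Continuous (kernelLe φ N) := by
  obtain ⟨g, hg⟩ := kernelLe_eq_schwartz hφ hN
  rw [hg]
  exact g.continuous

theorem exists_norm_kernelLe_le (hφ : IsBump φ) :
    ∃ C : ℝ, 0 ≤ C ∧ ∀ N : ℝ, 0 < N → ∀ y, ‖kernelLe φ N y‖ ≤ C * maj N y := by
  obtain ⟨g, hg⟩ := kernelLe_eq_schwartz hφ one_pos
  have h := SchwartzMap.one_add_le_sup_seminorm_apply (𝕜 := ℝ) (m := (5, 0)) (k := 5) (n := 0)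
    le_rfl le_rfl g
  set C : ℝ := 2 ^ 5 * (Finset.Iic (5, 0)).sup (fun m => SchwartzMap.seminorm ℝ m.1 m.2) g with hCd
  have h1 : ∀ y, ‖kernelLe φ 1 y‖ ≤ C * maj 1 y := by
    intro y
    have h2 := h y
    rw [norm_iteratedFDeriv_zero] at h2
    simp only [maj, one_pow, one_mul]
    rw [← div_eq_mul_inv, le_div_iff₀ (by positivity), mul_comm, hg]
    exact h2
  have hC0 : 0 ≤ C := by
    have h3 := (norm_nonneg _).trans (h1 0)
    have h4 : maj 1 (0 : E3) = 1 := by simp [maj]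
    rwa [h4, mul_one] at h3
  refine ⟨C, hC0, fun N hN y => ?_⟩
  rw [kernelLe_eq hN, norm_mul, Complex.norm_real, Real.norm_eq_abs, abs_of_pos (by positivity)]
  refine (mul_le_mul_of_nonneg_left (h1 (N • y)) (by positivity)).trans (le_of_eq ?_)
  simp only [maj, norm_smul, Real.norm_eq_abs, abs_of_pos hN]
  ring

theorem norm_toC3 (v : E3) : ‖toC3 v‖ = ‖v‖ := by
  simp [toC3, EuclideanSpace.norm_eq]

theorem continuous_toC3 : Continuous toC3 := by
  unfold toC3
  fun_prop

theorem maj_neg (N : ℝ) (y : E3) : maj N (-y) = maj N y := by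
  simp [maj]

section projLe

variable {m : ℝ} {v : E3 → E3}

theorem exists_lintegral_kernelLe_le (hφ : IsBump φ) :
    ∃ C : ℝ, 0 ≤ C ∧ ∀ {m : ℝ} {v : E3 → E3}, IsWeakL3 m v → ∀ N : ℝ, 0 < N → ∀ x,
      ∫⁻ y, ‖kernelLe φ N (x - y) • toC3 (v y)‖ₑ ≤ ENNReal.ofReal (C * m * N) := by
  obtain ⟨C, hC0, hC⟩ := exists_norm_kernelLe_le hφ
  have hM := majInt_nonneg
  refine ⟨C * (majInt + 64), by positivity, fun {m v} hv N hN x => ?_⟩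
  have h1 : ∀ y, ‖kernelLe φ N (x - y) • toC3 (v y)‖ₑ ≤
      ENNReal.ofReal C * (ENNReal.ofReal (maj N (y - x)) * ‖v y‖ₑ) := by
    intro y
    rw [← mul_assoc, ← ENNReal.ofReal_mul hC0, ← maj_neg, neg_sub, ← ofReal_norm,
      norm_smul, norm_toC3, ENNReal.ofReal_mul (norm_nonneg _), ofReal_norm (v y)]
    gcongr
    exact hC N hN _
  refine (lintegral_mono h1).trans ?_
  rw [lintegral_const_mul' _ _ ENNReal.ofReal_ne_top]
  refine (mul_le_mul_right (hv.lintegral_maj_mul_le hN x) _).trans ?_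
  rw [← ENNReal.ofReal_mul hC0]
  refine ENNReal.ofReal_le_ofReal (le_of_eq ?_)
  ring

theorem IsWeakL3.integrable_kernelLe_smul (hφ : IsBump φ) (hv : IsWeakL3 m v) {N : ℝ} (hN : 0 < N)
    (x : E3) : Integrable fun y => kernelLe φ N (x - y) • toC3 (v y) := by
  obtain ⟨C, hC0, hC⟩ := exists_lintegral_kernelLe_le hφ
  refine ⟨Continuous.aestronglyMeasurable ?_, (hC hv N hN x).trans_lt ENNReal.ofReal_lt_top⟩
  exact ((continuous_kernelLe hφ hN).comp (continuous_const.sub continuous_id)).smul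
    (continuous_toC3.comp hv.continuous)

theorem projLe_eq (N : ℝ) (x : E3) :
    projLe φ N (fun y => toC3 (v y)) x = ∫ y, kernelLe φ N (x - y) • toC3 (v y) := by
  rw [projLe, convolution_eq_swap]
  rfl

/-- Bernstein's inequality from weak `L³` to `L^∞`. -/
theorem exists_norm_projLe_le (hφ : IsBump φ) :
    ∃ C : ℝ, 0 ≤ C ∧ ∀ {m : ℝ} {v : E3 → E3}, IsWeakL3 m v → ∀ N : ℝ, 0 < N → ∀ x,
      ‖projLe φ N (fun y => toC3 (v y)) x‖ ≤ C * m * N := by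
  obtain ⟨C, hC0, hC⟩ := exists_lintegral_kernelLe_le hφ
  refine ⟨C, hC0, fun {m v} hv N hN x => ?_⟩
  have hm := hv.pos
  rw [projLe_eq]
  have h := (enorm_integral_le_lintegral_enorm _).trans (hC hv N hN x)
  rw [← ofReal_norm] at h
  exact (ENNReal.ofReal_le_ofReal_iff (by positivity)).1 h

theorem exists_norm_proj_le (hφ : IsBump φ) :
    ∃ C : ℝ, 0 ≤ C ∧ ∀ {m : ℝ} {v : E3 → E3}, IsWeakL3 m v → ∀ N : ℝ, 0 < N → ∀ x,
      ‖proj φ N v x‖ ≤ C * m * N := by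
  obtain ⟨C, hC0, hC⟩ := exists_norm_projLe_le hφ
  refine ⟨2 * C, by positivity, fun {m v} hv N hN x => ?_⟩
  have hm := hv.pos
  rw [proj]
  refine (norm_sub_le _ _).trans ((add_le_add (hC hv N hN x) (hC hv (N / 2) (by positivity) x)).trans ?_)
  have : 0 ≤ C * m * N := by positivity
  nlinarith

theorem projLe_scale {N l : ℝ} (hN : 0 < N) (hl : 0 < l) (x y : E3) :
    projLe φ N (fun z => toC3 (l • v (x + l • z))) y =
      (l : ℂ) • projLe φ (N / l) (fun z => toC3 (v z)) (x + l • y) := by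
  rw [projLe_eq (v := fun z => l • v (x + l • z)), projLe_eq]
  have h1 : ∀ z, kernelLe φ N (y - z) • toC3 (l • v (x + l • z)) =
      ((l ^ 3 : ℝ) : ℂ) • (l : ℂ) •
        (kernelLe φ (N / l) (x + l • y - (x + l • z)) • toC3 (v (x + l • z))) := by
    intro z
    have e1 : x + l • y - (x + l • z) = l • (y - z) := by rw [smul_sub]; abel
    have e2 : toC3 (l • v (x + l • z)) = (l : ℂ) • toC3 (v (x + l • z)) := by
      ext j
      simp [toC3]
    rw [e1, kernelLe_eq hN, kernelLe_eq (div_pos hN hl) (l • (y - z)), e2, smul_smul, smul_smul,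
      smul_smul, smul_smul]
    congr 1
    rw [div_mul_cancel₀ _ hl.ne']
    push_cast
    field_simp
  simp only [h1]
  rw [integral_smul, integral_smul]
  have h2 := Measure.integral_comp_smul (volume : Measure E3)
    (fun z : E3 => kernelLe φ (N / l) (x + l • y - (x + z)) • toC3 (v (x + z))) l
  rw [finrank_euclideanSpace_fin, abs_of_pos (by positivity)] at h2
  rw [h2, integral_add_left_eq_self
    (fun z : E3 => kernelLe φ (N / l) (x + l • y - z) • toC3 (v z)) x, smul_comm,
    ← Complex.coe_smul, smul_smul ((l ^ 3 : ℝ) : ℂ), ← Complex.ofReal_mul,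
    mul_inv_cancel₀ (by positivity)]
  simp

theorem proj_scale {N l : ℝ} (hN : 0 < N) (hl : 0 < l) (x y : E3) :
    proj φ N (fun z => l • v (x + l • z)) y = (l : ℂ) • proj φ (N / l) v (x + l • y) := by
  rw [proj, proj, projLe_scale hN hl, projLe_scale (by positivity) hl, smul_sub, div_right_comm]

end projLe

/-! ### The Littlewood-Paley projection at unit frequency -/

/-- The symbol `φ(ξ) - φ(2ξ)` of `P_1`. -/
noncomputable def symbolOne (φ : E3 → ℝ) (ξ : E3) : ℂ := symbolLe φ 1 ξ - symbolLe φ (1 / 2) ξ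

/-- The symbol of the inverse Laplacian of `P_1`. -/
noncomputable def symbolPot (φ : E3 → ℝ) (ξ : E3) : ℂ :=
  (((4 * Real.pi ^ 2 * ‖ξ‖ ^ 2)⁻¹ : ℝ) : ℂ) * symbolOne φ ξ

theorem contDiff_symbolLe (hφ : IsBump φ) {N : ℝ} (hN : 0 < N) : ContDiff ℝ ∞ (symbolLe φ N) := by
  obtain ⟨g, hg⟩ := exists_schwartz_symbolLe hφ hN
  rw [show symbolLe φ N = g from (funext hg).symm]
  exact g.smooth'

theorem symbolOne_eq_zero (hφ : IsBump φ) {ξ : E3} (hξ : ‖ξ‖ < 1 / 4) : symbolOne φ ξ = 0 := by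
  have h1 : φ ((1 : ℝ)⁻¹ • ξ) = 1 := hφ.eq_one _ (by simp; linarith)
  have h2 : φ (((1 : ℝ) / 2)⁻¹ • ξ) = 1 := hφ.eq_one _ (by simp [norm_smul]; linarith)
  simp only [symbolOne, symbolLe, h1, h2, sub_self]

theorem isAnnular_symbolOne (hφ : IsBump φ) : IsAnnular (symbolOne φ) where
  smooth := (contDiff_symbolLe hφ one_pos).sub (contDiff_symbolLe hφ (by norm_num))
  support ξ h := by
    constructor
    · by_contra h2
      exact h (symbolOne_eq_zero hφ (not_le.1 h2))
    · by_contra h2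
      apply h
      have h3 : φ ((1 : ℝ)⁻¹ • ξ) = 0 := by
        by_contra h4
        exact h2 (by simpa using hφ.support_subset h4)
      have h5 : φ (((1 : ℝ) / 2)⁻¹ • ξ) = 0 := by
        by_contra h4
        have := hφ.support_subset h4
        simp [norm_smul] at this
        linarith
      simp only [symbolOne, symbolLe, h3, h5, sub_self]

/-- Division by `‖ξ‖²` is harmless because the symbol of `P_1` vanishes on `‖ξ‖ < 1/4`. -/
theorem isAnnular_symbolPot (hφ : IsBump φ) : IsAnnular (symbolPot φ) where
  smooth := by
    rw [contDiff_iff_contDiffAt]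
    intro ξ
    by_cases hξ : ‖ξ‖ < 1 / 4
    · have : symbolPot φ =ᶠ[nhds ξ] fun _ => 0 := by
        have ho : IsOpen {z : E3 | ‖z‖ < 1 / 4} := isOpen_lt continuous_norm continuous_const
        filter_upwards [ho.mem_nhds hξ] with z hz
        simp only [symbolPot, symbolOne_eq_zero hφ hz, mul_zero]
      exact contDiffAt_const.congr_of_eventuallyEq this
    · have h0 : ξ ≠ 0 := by
        rintro rfl
        simp at hξ
      refine ContDiffAt.mul ?_ (isAnnular_symbolOne hφ).smooth.contDiffAt
      refine Complex.ofRealCLM.contDiff.contDiffAt.comp ξ ?_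
      refine ContDiffAt.inv ?_ (by positivity)
      exact (contDiff_const.mul (contDiff_norm_sq ℝ)).contDiffAt
  support ξ h := (isAnnular_symbolOne hφ).support ξ (right_ne_zero_of_mul h)

theorem lap_heatKer_symbolPot (hφ : IsBump φ) (y : E3) :
    lap (heatKer (symbolPot φ) 0) y = -(𝓕 (symbolOne φ) y) := by
  rw [(isAnnular_symbolPot hφ).lap_heatKer, heatKer, Real.fourier_eq, Real.fourier_eq,
    ← integral_neg]
  refine integral_congr_ae (Filter.Eventually.of_forall fun ξ => ?_)
  simp only
  rw [← smul_neg]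
  congr 1
  simp only [heatSym, mul_zero, Real.exp_zero, one_smul, symbolPot]
  by_cases hξ : symbolOne φ ξ = 0
  · simp [hξ]
  · have h0 : ξ ≠ 0 := by
      rintro rfl
      have := ((isAnnular_symbolOne hφ).support 0 hξ).1
      norm_num at this
    have h1 : (4 * Real.pi ^ 2 * ‖ξ‖ ^ 2 : ℝ) ≠ 0 := by positivity
    rw [← mul_assoc, neg_mul, ← Complex.ofReal_mul, mul_inv_cancel₀ h1]
    simp

/-- Convolution at the origin pairs with the reflected kernel, and reflection exchanges the inverse
and the forward Fourier transform; this is why `heatKer` is a forward transform. -/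
theorem kernelLe_neg_sub (hφ : IsBump φ) (y : E3) :
    kernelLe φ 1 (-y) - kernelLe φ (1 / 2) (-y) = 𝓕 (symbolOne φ) y := by
  have hi : ∀ {N : ℝ}, 0 < N → Integrable (symbolLe φ N) := by
    intro N hN
    obtain ⟨g, hg⟩ := exists_schwartz_symbolLe hφ hN
    rw [show symbolLe φ N = g from (funext hg).symm]
    exact g.integrable
  rw [kernelLe, kernelLe, Real.fourierInv_eq_fourier_neg, Real.fourierInv_eq_fourier_neg, neg_neg,
    Real.fourier_eq, Real.fourier_eq, Real.fourier_eq, ← integral_sub]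
  · simp only [symbolOne, smul_sub]
  · exact (Real.fourierIntegral_convergent_iff y).2 (hi one_pos)
  · exact (Real.fourierIntegral_convergent_iff y).2 (hi (by norm_num))

/-- Identifies the quantity bounded in `IsAnnular.exists_duhamel` with the projection at unit
frequency and at the origin. All other frequencies and points follow by scaling and translation. -/
theorem proj_one_zero_apply (hφ : IsBump φ) {m : ℝ} {v : E3 → E3} (hv : IsWeakL3 m v) (i : Fin 3) :
    proj φ 1 v 0 i = -∫ y, comp v i y • lap (heatKer (symbolPot φ) 0) y := by
  have h1 := hv.integrable_kernelLe_smul hφ one_pos 0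
  have h2 := hv.integrable_kernelLe_smul hφ (by norm_num : (0 : ℝ) < 1 / 2) 0
  rw [proj, projLe_eq, projLe_eq, ← integral_sub h1 h2]
  have h3 := (EuclideanSpace.proj (𝕜 := ℂ) i : C3 →L[ℂ] ℂ).integral_comp_comm (h1.sub h2)
  have h4 : (∫ y, kernelLe φ 1 (0 - y) • toC3 (v y) - kernelLe φ (1 / 2) (0 - y) • toC3 (v y)) i =
      (EuclideanSpace.proj (𝕜 := ℂ) i : C3 →L[ℂ] ℂ) (∫ y, ((fun y => kernelLe φ 1 (0 - y) •
        toC3 (v y)) - fun y => kernelLe φ (1 / 2) (0 - y) • toC3 (v y)) y) := rfl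
  rw [h4, ← h3, ← integral_neg]
  refine integral_congr_ae (Filter.Eventually.of_forall fun y => ?_)
  simp only [Pi.sub_apply, zero_sub]
  rw [lap_heatKer_symbolPot hφ, smul_neg, neg_neg, ← sub_smul, kernelLe_neg_sub hφ]
  simp [toC3, comp, mul_comm]

end NSLorentz

namespace NSLorentz

/-! ### The Duhamel inequality at every frequency -/

variable {φ : E3 → ℝ}

theorem enorm_le_sum_enorm (z : C3) : ‖z‖ₑ ≤ ∑ i, ‖z i‖ₑ := by
  have h : z = ∑ i, z i • EuclideanSpace.single i (1 : ℂ) := by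
    ext j
    simp [Finset.sum_apply, Pi.single_apply]
  conv_lhs => rw [h]
  refine (enorm_sum_le _ _).trans (Finset.sum_le_sum fun i _ => ?_)
  rw [enorm_smul]
  simp [enorm_eq_nnnorm]

theorem lintegral_Ioo_comp_affine {c : ℝ} (hc : 0 < c) (s t : ℝ) (G : ℝ → ℝ≥0∞) :
    ∫⁻ σ in Ioo (c * (s - t)) 0, G σ =
      ENNReal.ofReal c * ∫⁻ r in Ioo s t, G (c * (r - t)) := by
  have himg : (fun r => c * (r - t)) '' Ioo s t = Ioo (c * (s - t)) 0 := by
    ext σ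
    constructor
    · rintro ⟨r, hr, rfl⟩
      exact ⟨mul_lt_mul_of_pos_left (by linarith [hr.1]) hc,
        mul_neg_of_pos_of_neg hc (by linarith [hr.2])⟩
    · intro hσ
      refine ⟨t + σ / c, ⟨?_, ?_⟩, ?_⟩
      · have : s - t < σ / c := (lt_div_iff₀ hc).2 (by linarith [hσ.1])
        linarith
      · have : σ / c < 0 := div_neg_of_neg_of_pos hσ.2 hc
        linarith
      · simp only
        field_simp
        ring
  have h := lintegral_image_eq_lintegral_abs_deriv_mul (s := Ioo s t)
    (f := fun r => c * (r - t)) (f' := fun _ => c) measurableSet_Ioo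
    (fun r _ => by simpa using (((hasDerivAt_id r).sub_const t).const_mul c).hasDerivWithinAt)
    (fun r _ r' _ h => by
      have := mul_left_cancel₀ hc.ne' h
      linarith) G
  rw [himg, abs_of_pos hc] at h
  rw [h, lintegral_const_mul' _ _ ENNReal.ofReal_ne_top]

theorem lintegral_maj_comp_scale {N : ℝ} (hN : 0 < N) (x : E3) {g : E3 → ℝ≥0∞}
    (hg : Measurable g) :
    ∫⁻ y, ENNReal.ofReal (maj 1 y) * g (x + N⁻¹ • y) =
      ∫⁻ y, ENNReal.ofReal (maj N (y - x)) * g y := by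
  have hm : Measurable fun y : E3 => ENNReal.ofReal (maj 1 y) * g (x + N⁻¹ • y) :=
    (measurable_ofReal_maj one_pos).mul (hg.comp (by fun_prop))
  rw [← lintegral_comp_smul_pos hN hm,
    ← lintegral_add_right_eq_self (μ := volume)
      (fun y : E3 => ENNReal.ofReal (maj N (y - x)) * g y) x]
  refine lintegral_congr fun y => ?_
  rw [← mul_assoc, ← ENNReal.ofReal_mul (by positivity), smul_smul, inv_mul_cancel₀ hN.ne',
    one_smul, add_sub_cancel_right, add_comm x y]
  congr 2
  simp [maj, norm_smul, abs_of_pos hN]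

/-- The Duhamel inequality for `P_N u`. -/
theorem IsBump.exists_duhamel (hφ : IsBump φ) :
    ∃ C : ℝ, 0 ≤ C ∧ ∀ {a b : ℝ} {u : ℝ → E3 → E3} {p : ℝ → E3 → ℝ} {m : ℝ},
      IsClassicalSolution a b u p → (∀ r ∈ Ioo a b, IsWeakL3 m (u r)) →
      ∀ {s t : ℝ}, a < s → s < t → t < b → ∀ {N : ℝ}, 0 < N → ∀ x : E3,
      ‖proj φ N (u t) x‖ₑ ≤ ENNReal.ofReal (C * m * N * ((1 + N ^ 2 * (t - s)) ^ 2)⁻¹) +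
        ENNReal.ofReal C * ∫⁻ r in Ioo s t, ENNReal.ofReal (N * ((1 + N ^ 2 * (t - r)) ^ 2)⁻¹) *
          ∫⁻ y, ENNReal.ofReal (maj N (y - x)) * ‖u r y‖ₑ ^ 2 := by
  obtain ⟨C, hC0, hC⟩ := (isAnnular_symbolPot hφ).exists_duhamel
  -- The factor `3` comes from bounding the norm in `ℂ³` by the sum over the components.
  refine ⟨3 * C, by positivity, ?_⟩
  intro a b u p m hu hm s t has hst htb N hN x
  have hl : 0 < N⁻¹ := inv_pos.2 hN
  have hN2 : 0 < N ^ 2 := by positivity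
  have hdiv : ∀ r : ℝ, r / N⁻¹ ^ 2 = N ^ 2 * r := fun r => by field_simp
  have hsol := hu.scale hl t x
  simp only [hdiv] at hsol
  have hw : ∀ r ∈ Ioo (N ^ 2 * (a - t)) (N ^ 2 * (b - t)), IsWeakL3 m (scaleVel N⁻¹ t x u r) := by
    intro r hr
    refine (hm (t + N⁻¹ ^ 2 * r) ?_).scale hl x
    have e : N⁻¹ ^ 2 * r = r / N ^ 2 := by field_simp
    have h1 : a - t < r / N ^ 2 := (lt_div_iff₀ hN2).2 (by linarith [hr.1])
    have h2 : r / N ^ 2 < b - t := (div_lt_iff₀ hN2).2 (by linarith [hr.2])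
    rw [e]
    constructor <;> linarith
  have has' : N ^ 2 * (a - t) < N ^ 2 * (s - t) := mul_lt_mul_of_pos_left (by linarith) hN2
  have hs0 : N ^ 2 * (s - t) < 0 := mul_neg_of_pos_of_neg hN2 (by linarith)
  have h0b : 0 < N ^ 2 * (b - t) := mul_pos hN2 (by linarith)
  -- After rescaling by `N⁻¹` about `(t, x)`, the final time is `0` and the initial time `N²(s -
  -- t)`.
  have key := hC hsol hw has' hs0 h0b
  have hw0 := hw 0 ⟨has'.trans hs0, h0b⟩
  have hproj : proj φ 1 (scaleVel N⁻¹ t x u 0) 0 = ((N⁻¹ : ℝ) : ℂ) • proj φ N (u t) x := by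
    have h := proj_scale (φ := φ) (v := u t) one_pos hl x 0
    simp only [smul_zero, add_zero, one_div, inv_inv] at h
    rw [← h]
    congr 1
    funext z
    simp only [scaleVel, mul_zero, add_zero]
  have hint : ∀ r ∈ Ioo s t, ∫⁻ y, ENNReal.ofReal (maj 1 y) *
      ‖scaleVel N⁻¹ t x u (N ^ 2 * (r - t)) y‖ₑ ^ 2 =
      ENNReal.ofReal (N⁻¹ ^ 2) * ∫⁻ y, ENNReal.ofReal (maj N (y - x)) * ‖u r y‖ₑ ^ 2 := by
    intro r hr
    have e : t + N⁻¹ ^ 2 * (N ^ 2 * (r - t)) = r := by field_simp; ring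
    have hc := (hm r ⟨has.trans hr.1, hr.2.trans htb⟩).continuous
    simp only [scaleVel, e]
    rw [← lintegral_maj_comp_scale hN x (g := fun y => ‖u r y‖ₑ ^ 2)
      (hc.enorm.measurable.pow_const 2), ← lintegral_const_mul' _ _ ENNReal.ofReal_ne_top]
    refine lintegral_congr fun y => ?_
    rw [enorm_smul, mul_pow, ← ofReal_norm N⁻¹, Real.norm_eq_abs, abs_of_pos hl,
      ENNReal.ofReal_pow hl.le]
    ring
  have hbd : ∀ i, ‖proj φ 1 (scaleVel N⁻¹ t x u 0) 0 i‖ₑ ≤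
      ENNReal.ofReal (C * m * ((1 + N ^ 2 * (t - s)) ^ 2)⁻¹) +
        ENNReal.ofReal C * ∫⁻ r in Ioo s t, ENNReal.ofReal (((1 + N ^ 2 * (t - r)) ^ 2)⁻¹) *
          ∫⁻ y, ENNReal.ofReal (maj N (y - x)) * ‖u r y‖ₑ ^ 2 := by
    intro i
    rw [proj_one_zero_apply hφ hw0, enorm_neg]
    refine (key i).trans (le_of_eq ?_)
    rw [lintegral_Ioo_comp_affine hN2]
    congr 1
    · congr 5
      ring
    · congr 1
      rw [← lintegral_const_mul' _ _ ENNReal.ofReal_ne_top]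
      refine setLIntegral_congr_fun measurableSet_Ioo fun r hr => ?_
      rw [hint r hr]
      have e1 : (0 - N ^ 2 * (r - t)) = N ^ 2 * (t - r) := by ring
      have e2 : ENNReal.ofReal (N ^ 2) * ENNReal.ofReal (N⁻¹ ^ 2) = 1 := by
        rw [← ENNReal.ofReal_mul hN2.le, inv_pow, mul_inv_cancel₀ hN2.ne', ENNReal.ofReal_one]
      rw [e1, mul_left_comm, ← mul_assoc (ENNReal.ofReal (N ^ 2)), e2, one_mul]
  have hfin : ‖proj φ N (u t) x‖ₑ =
      ENNReal.ofReal N * ‖proj φ 1 (scaleVel N⁻¹ t x u 0) 0‖ₑ := by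
    rw [hproj, enorm_smul, ← mul_assoc, ← ofReal_norm ((N⁻¹ : ℝ) : ℂ), Complex.norm_real,
      Real.norm_eq_abs, abs_of_pos hl, ← ENNReal.ofReal_mul hN.le, mul_inv_cancel₀ hN.ne',
      ENNReal.ofReal_one, one_mul]
  rw [hfin]
  refine (mul_le_mul_right ((enorm_le_sum_enorm _).trans
    (Finset.sum_le_sum fun i _ => hbd i)) _).trans (le_of_eq ?_)
  rw [Finset.sum_const, Finset.card_univ, Fintype.card_fin, nsmul_eq_mul, ← mul_assoc, mul_add]
  have e3 : ENNReal.ofReal N * ((3 : ℕ) : ℝ≥0∞) = ENNReal.ofReal (3 * N) := by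
    rw [ENNReal.ofReal_mul (by norm_num), mul_comm]
    simp
  rw [e3]
  congr 1
  · rw [← ENNReal.ofReal_mul (by positivity)]
    congr 1
    ring
  · rw [← mul_assoc, ← ENNReal.ofReal_mul (by positivity),
      show 3 * N * C = 3 * C * N by ring, ENNReal.ofReal_mul (by positivity), mul_assoc,
      ← lintegral_const_mul' (ENNReal.ofReal N) _ ENNReal.ofReal_ne_top]
    congr 1
    refine lintegral_congr fun r => ?_
    rw [← mul_assoc, ← ENNReal.ofReal_mul hN.le]

end NSLorentz

namespace NSLorentz

/-! ### From Lorentz norms to weak `L³` bounds at every time -/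

/-- The distribution function is nonincreasing, so keeping only the heights in `(α/2, α)` bounds the
norm below by `(α/2) d_f(α)^(1/3)`. The constant does not depend on `q`; the factor `p = 3 ≥ 1` is
dropped. -/
theorem distFun_le_of_lorentzNorm_le {f : E3 → E3} {q M α : ℝ} (hq : 3 ≤ q) (hM : 0 < M)
    (hα : 0 < α) (h : lorentzNorm 3 q f ≤ ENNReal.ofReal M) :
    distFun f α ≤ ENNReal.ofReal ((2 * M / α) ^ 3) := by
  have hq0 : 0 < q := by linarith
  rw [lorentzNorm, one_div, ENNReal.rpow_inv_le_iff hq0, ENNReal.ofReal_rpow_of_pos hM] at h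
  have h1 : ∀ β ∈ Ioo (α / 2) α, ENNReal.ofReal ((α / 2) ^ (q - 1)) * distFun f α ^ (q / 3) ≤
      ENNReal.ofReal (β ^ q) * distFun f β ^ (q / 3) / ENNReal.ofReal β := by
    intro β hβ
    have hβ0 : 0 < β := by linarith [hβ.1]
    rw [mul_comm (ENNReal.ofReal (β ^ q)), mul_div_assoc, ← ENNReal.ofReal_div_of_pos hβ0,
      ← Real.rpow_sub_one hβ0.ne', mul_comm]
    refine mul_le_mul' (ENNReal.rpow_le_rpow (measure_mono fun x hx => hβ.2.trans hx)
      (by positivity)) (ENNReal.ofReal_le_ofReal ?_)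
    exact Real.rpow_le_rpow (by positivity) hβ.1.le (by linarith)
  have h2 : ENNReal.ofReal ((α / 2) ^ q) * distFun f α ^ (q / 3) ≤ ENNReal.ofReal (M ^ q) := by
    refine le_trans ?_ h
    have h3 : ENNReal.ofReal ((α / 2) ^ q) * distFun f α ^ (q / 3) =
        ∫⁻ _ in Ioo (α / 2) α, ENNReal.ofReal ((α / 2) ^ (q - 1)) * distFun f α ^ (q / 3) := by
      rw [setLIntegral_const, Real.volume_Ioo, mul_right_comm,
        ← ENNReal.ofReal_mul (by positivity), show α - α / 2 = α / 2 by ring,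
        Real.rpow_sub_one (by positivity), div_mul_cancel₀ _ (by positivity)]
    rw [h3]
    refine (setLIntegral_mono' measurableSet_Ioo h1).trans ?_
    refine (lintegral_mono_set fun β hβ => ?_).trans (le_mul_of_one_le_left zero_le ?_)
    · exact mem_Ioi.2 (by linarith [hβ.1])
    · simp
  have h4 : distFun f α ^ (q / 3) ≤ ENNReal.ofReal ((2 * M / α) ^ 3) ^ (q / 3) := by
    rw [ENNReal.ofReal_rpow_of_pos (by positivity), ← Real.rpow_natCast,
      ← Real.rpow_mul (by positivity)]
    have e : ((3 : ℕ) : ℝ) * (q / 3) = q := by push_cast; ring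
    have e2 : (2 * M / α) ^ q = M ^ q / (α / 2) ^ q := by
      rw [← Real.div_rpow (by positivity) (by positivity)]
      congr 1
      field_simp
    rw [e, e2, ENNReal.ofReal_div_of_pos (by positivity), ENNReal.le_div_iff_mul_le
      (Or.inl (by simpa using by positivity)) (Or.inl ENNReal.ofReal_ne_top), mul_comm]
    exact h2
  exact (ENNReal.rpow_le_rpow_iff (by positivity)).1 h4

theorem exists_mem_Icc_of_ae {a b t : ℝ} (hab : a < b) (ht : t ∈ Icc a b) {P Q : ℝ → Prop}
    (hP : ∀ᵐ s ∂(volume.restrict (Icc a b)), P s) (hQ : ∀ᶠ s in nhds t, Q s) :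
    ∃ s ∈ Icc a b, P s ∧ Q s := by
  rw [ae_restrict_iff' measurableSet_Icc] at hP
  obtain ⟨δ, hδ, hb⟩ := Metric.eventually_nhds_iff.1 hQ
  by_contra! hcon
  have hlt : max a (t - δ) < min b (t + δ) := by
    rw [max_lt_iff, lt_min_iff, lt_min_iff]
    exact ⟨⟨hab, by linarith [ht.1]⟩, by linarith [ht.2], by linarith⟩
  have hnull : volume (Ioo (max a (t - δ)) (min b (t + δ))) = 0 := by
    refine measure_mono_null (t := {s | ¬(s ∈ Icc a b → P s)}) (fun s hs hPs => ?_) (ae_iff.1 hP)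
    obtain ⟨h1, h2⟩ := hs
    rw [max_lt_iff] at h1
    rw [lt_min_iff] at h2
    have hs' : s ∈ Icc a b := ⟨h1.1.le, h2.1.le⟩
    refine hcon s hs' (hPs hs') (hb ?_)
    rw [Real.dist_eq, abs_lt]
    constructor <;> linarith
  rw [Real.volume_Ioo, ENNReal.ofReal_eq_zero] at hnull
  linarith

namespace IsClassicalSolution

variable {a b : ℝ} {u : ℝ → E3 → E3} {p : ℝ → E3 → ℝ}

theorem continuous_slice (hu : IsClassicalSolution a b u p) {t : ℝ} (ht : t ∈ Icc a b) :
    Continuous (u t) :=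
  hu.continuousOn_u.comp_continuous (f := fun x : E3 => (t, x)) (by fun_prop)
    fun x => ⟨ht, mem_univ x⟩

/-- The essential supremum controls almost every time only. A compact part of the open level set at
time `t` stays in the level set at nearby times, and some nearby time is controlled; exhausting by
compact sets gives the bound at `t`. -/
theorem isWeakL3 (hu : IsClassicalSolution a b u p) (hab : a < b) {q M : ℝ} (hq : 3 ≤ q)
    (hM : 0 < M) (h : supLorentzNorm 3 q a b u ≤ ENNReal.ofReal M) {t : ℝ} (ht : t ∈ Icc a b) :
    IsWeakL3 (2 * M) (u t) where
  pos := by positivity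
  continuous := hu.continuous_slice ht
  measure_le α hα := by
    have hae : ∀ᵐ s ∂(volume.restrict (Icc a b)), distFun (u s) α ≤
        ENNReal.ofReal ((2 * M / α) ^ 3) := by
      filter_upwards [ENNReal.ae_le_essSup (μ := volume.restrict (Icc a b))
        fun s => lorentzNorm 3 q (u s)] with s hs
      exact distFun_le_of_lorentzNorm_le hq hM hα (hs.trans h)
    have ho : IsOpen {x | α < ‖u t x‖} :=
      isOpen_lt continuous_const (hu.continuous_slice ht).norm
    rw [ho.measure_eq_iSup_isCompact]
    refine iSup_le fun K => iSup_le fun hKs => iSup_le fun hK => ?_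
    have hev : ∀ᶠ s in nhds t, ∀ x ∈ K, s ∈ Icc a b → α < ‖u s x‖ := by
      refine hK.eventually_forall_of_forall_eventually
        (P := fun s x => s ∈ Icc a b → α < ‖u s x‖) fun x hx => ?_
      have hc := hu.continuousOn_u (t, x) ⟨ht, mem_univ x⟩
      have h1 := hc.norm.eventually (lt_mem_nhds (hKs hx))
      rw [eventually_nhdsWithin_iff] at h1
      filter_upwards [h1] with z hz hz1
      exact hz ⟨hz1, mem_univ _⟩
    obtain ⟨s, hs, hPs, hQs⟩ := exists_mem_Icc_of_ae hab ht hae hev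
    exact (measure_mono fun x hx => hQs x hx hs).trans hPs

end IsClassicalSolution

/-! ### Tails -/

variable {m : ℝ} {v : E3 → E3}

theorem maj_le_of_le {N ρ : ℝ} (hN : 0 < N) (hρ : 0 < ρ) {y : E3} (hy : ρ ≤ ‖y‖) :
    maj N y ≤ (N ^ 2 * ρ ^ 5)⁻¹ := by
  have h1 : (N * ρ) ^ 5 ≤ (1 + N * ‖y‖) ^ 5 := by
    refine pow_le_pow_left₀ (by positivity) ?_ 5
    have := mul_le_mul_of_nonneg_left hy hN.le
    linarith
  refine (mul_le_mul_of_nonneg_left (inv_anti₀ (by positivity) h1) (by positivity)).trans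
    (le_of_eq ?_)
  field_simp

theorem IsWeakL3.lintegral_maj_tail_mul_le (hv : IsWeakL3 m v) {N ρ : ℝ} (hN : 0 < N)
    (hρ : 0 < ρ) {k : ℕ} (hk : k = 1 ∨ k = 2) (x : E3) :
    ∫⁻ y in {y | ρ ≤ ‖y - x‖}, ENNReal.ofReal (maj N (y - x)) * ‖v y‖ₑ ^ k ≤
      ENNReal.ofReal (majTail / (N * ρ) + 64 * m ^ 3 * (N ^ 2 * ρ ^ 5)⁻¹) := by
  have hm := hv.pos
  have hT := majTail_nonneg
  have hs : MeasurableSet {y : E3 | ρ ≤ ‖y - x‖} :=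
    (isClosed_le continuous_const (by fun_prop)).measurableSet
  have hs0 : MeasurableSet {y : E3 | ρ ≤ ‖y‖} :=
    (isClosed_le continuous_const (by fun_prop)).measurableSet
  have hκ : Measurable fun y : E3 => ENNReal.ofReal (maj N (y - x)) :=
    (measurable_ofReal_maj hN).comp (measurable_id.sub_const x)
  have h := hv.lintegral_mul_pow_le one_pos hk (hκ.indicator hs)
    (B := ENNReal.ofReal (N ^ 2 * ρ ^ 5)⁻¹) (fun y => by
      by_cases hy : ρ ≤ ‖y - x‖
      · rw [indicator_of_mem (show y ∈ {y | ρ ≤ ‖y - x‖} from hy)]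
        exact ENNReal.ofReal_le_ofReal (maj_le_of_le hN hρ hy)
      · rw [indicator_of_notMem (show y ∉ {y | ρ ≤ ‖y - x‖} from hy)]
        exact zero_le)
  rw [← lintegral_indicator hs]
  have e1 : ∀ y, {y | ρ ≤ ‖y - x‖}.indicator (fun y => ENNReal.ofReal (maj N (y - x)) * ‖v y‖ₑ ^ k) y
      = {y | ρ ≤ ‖y - x‖}.indicator (fun y => ENNReal.ofReal (maj N (y - x))) y * ‖v y‖ₑ ^ k := by
    intro y
    rw [indicator_mul_left]
  simp only [e1]
  refine h.trans ?_
  have e2 : ∫⁻ y, {y | ρ ≤ ‖y - x‖}.indicator (fun y => ENNReal.ofReal (maj N (y - x))) y =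
      ∫⁻ y in {y : E3 | ρ ≤ ‖y‖}, ENNReal.ofReal (maj N y) := by
    rw [← lintegral_indicator hs0, ← lintegral_sub_right_eq_self (μ := volume)
      ({y : E3 | ρ ≤ ‖y‖}.indicator fun y => ENNReal.ofReal (maj N y)) x]
    rfl
  rw [e2, one_pow, ENNReal.ofReal_one, one_mul, ENNReal.ofReal_add (by positivity) (by positivity),
    ← ENNReal.ofReal_mul (by positivity)]
  refine add_le_add (lintegral_maj_tail_le hN hρ) (ENNReal.ofReal_le_ofReal (le_of_eq ?_))
  ring

end NSLorentz

namespace NSLorentz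

/-! ### Convergence of `P_{≤N}` and continuity in time -/

variable {φ : E3 → ℝ} {m : ℝ} {v w : E3 → E3}

theorem lintegral_maj_sub {N : ℝ} (hN : 0 < N) (x : E3) :
    ∫⁻ y, ENNReal.ofReal (maj N (y - x)) = ENNReal.ofReal majInt := by
  rw [lintegral_sub_right_eq_self (fun y => ENNReal.ofReal (maj N y)) x, lintegral_maj hN]

theorem lintegral_maj_sub_tail_le {N ρ : ℝ} (hN : 0 < N) (hρ : 0 < ρ) (x : E3) :
    ∫⁻ y in {y : E3 | ρ ≤ ‖y - x‖}, ENNReal.ofReal (maj N (y - x)) ≤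
      ENNReal.ofReal (majTail / (N * ρ)) := by
  have hs : MeasurableSet {y : E3 | ρ ≤ ‖y - x‖} :=
    (isClosed_le continuous_const (by fun_prop)).measurableSet
  have hs0 : MeasurableSet {y : E3 | ρ ≤ ‖y‖} :=
    (isClosed_le continuous_const (by fun_prop)).measurableSet
  refine le_trans (le_of_eq ?_) (lintegral_maj_tail_le hN hρ)
  rw [← lintegral_indicator hs, ← lintegral_indicator hs0,
    ← lintegral_sub_right_eq_self (μ := volume)
      ({y : E3 | ρ ≤ ‖y‖}.indicator fun y => ENNReal.ofReal (maj N y)) x]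
  rfl

/-- The right side becomes small when `η` is small and either `N` or `ρ` tends to infinity with the
other fixed. The first regime gives convergence of `P_{≤N}`, the second continuity in time. -/
theorem lintegral_maj_mul_le_of_local (hv : IsWeakL3 m v) (hw : IsWeakL3 m w) {N ρ η c : ℝ}
    (hN : 0 < N) (hρ : 0 < ρ) (hη : 0 ≤ η) (hc : 0 ≤ c) (x : E3) {g : E3 → ℝ≥0∞}
    (h1 : ∀ y, ‖y - x‖ < ρ → g y ≤ ENNReal.ofReal η)
    (h2 : ∀ y, g y ≤ ENNReal.ofReal c + (‖v y‖ₑ + ‖w y‖ₑ)) :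
    ∫⁻ y, ENNReal.ofReal (maj N (y - x)) * g y ≤
      ENNReal.ofReal (η * majInt + (c * (majTail / (N * ρ)) +
        2 * (majTail / (N * ρ) + 64 * m ^ 3 * (N ^ 2 * ρ ^ 5)⁻¹))) := by
  have hm := hv.pos
  have hT := majTail_nonneg
  have hI := majInt_nonneg
  have hs : MeasurableSet {y : E3 | ρ ≤ ‖y - x‖} :=
    (isClosed_le continuous_const (by fun_prop)).measurableSet
  have hκ : Measurable fun y : E3 => ENNReal.ofReal (maj N (y - x)) :=
    (measurable_ofReal_maj hN).comp (measurable_id.sub_const x)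
  have hvm : Measurable fun y => ENNReal.ofReal (maj N (y - x)) * ‖v y‖ₑ ^ 1 :=
    hκ.mul (hv.continuous.enorm.measurable.pow_const 1)
  have hp : ∀ y, ENNReal.ofReal (maj N (y - x)) * g y ≤
      ENNReal.ofReal η * ENNReal.ofReal (maj N (y - x)) + {y | ρ ≤ ‖y - x‖}.indicator (fun y =>
        ENNReal.ofReal c * ENNReal.ofReal (maj N (y - x)) +
          (ENNReal.ofReal (maj N (y - x)) * ‖v y‖ₑ ^ 1 +
            ENNReal.ofReal (maj N (y - x)) * ‖w y‖ₑ ^ 1)) y := by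
    intro y
    by_cases hy : ‖y - x‖ < ρ
    · refine le_trans ?_ le_self_add
      rw [mul_comm]
      exact mul_le_mul_left (h1 y hy) _
    · rw [indicator_of_mem (show y ∈ {y | ρ ≤ ‖y - x‖} from not_lt.1 hy)]
      refine le_trans (mul_le_mul_right (h2 y) _) (le_trans (le_of_eq ?_) le_add_self)
      ring
  refine (lintegral_mono hp).trans ?_
  rw [lintegral_add_left (hκ.const_mul _), lintegral_const_mul' _ _ ENNReal.ofReal_ne_top,
    lintegral_maj_sub hN, lintegral_indicator hs, lintegral_add_left (hκ.const_mul _),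
    lintegral_const_mul' _ _ ENNReal.ofReal_ne_top,
    lintegral_add_left hvm, ENNReal.ofReal_add (by positivity)
      (by positivity), ENNReal.ofReal_add (by positivity) (by positivity), two_mul,
    ENNReal.ofReal_add (by positivity) (by positivity), ← ENNReal.ofReal_mul hη,
    ENNReal.ofReal_mul hc]
  gcongr
  · exact lintegral_maj_sub_tail_le hN hρ x
  · exact hv.lintegral_maj_tail_mul_le hN hρ (Or.inl rfl) x
  · exact hw.lintegral_maj_tail_mul_le hN hρ (Or.inl rfl) x

/-- The mass of the kernel is its symbol at the origin, `φ(0) = 1`. -/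
theorem integral_kernelLe (hφ : IsBump φ) {N : ℝ} (hN : 0 < N) (x : E3) :
    ∫ y, kernelLe φ N (x - y) = 1 := by
  rw [integral_sub_left_eq_self (fun y => kernelLe φ N y) volume x]
  obtain ⟨g, hg⟩ := exists_schwartz_symbolLe hφ hN
  have hg' : symbolLe φ N = g := (funext hg).symm
  have hk : kernelLe φ N = (𝓕⁻ g : SchwartzMap E3 ℂ) := by
    rw [kernelLe, hg', SchwartzMap.fourierInv_coe]
  have h1 : (𝓕 (𝓕⁻ g : SchwartzMap E3 ℂ) : SchwartzMap E3 ℂ) 0 = g 0 := by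
    rw [FourierTransform.fourier_fourierInv_eq]
  have h2 : φ 0 = 1 := hφ.eq_one 0 (by simp)
  rw [SchwartzMap.fourier_coe, Real.fourier_eq] at h1
  simp only [inner_zero_right, neg_zero, AddChar.map_zero_eq_one, one_smul] at h1
  rw [hk, h1, hg]
  simp [symbolLe, h2]

theorem toC3_sub (v w : E3) : toC3 (v - w) = toC3 v - toC3 w := by
  ext j
  simp [toC3]

theorem exists_projLe_sub_le (hφ : IsBump φ) : ∃ C : ℝ, 0 ≤ C ∧
    (∀ {m : ℝ} {v w : E3 → E3}, IsWeakL3 m v → IsWeakL3 m w → ∀ {N : ℝ}, 0 < N → ∀ x,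
      ‖projLe φ N (fun y => toC3 (v y)) x - projLe φ N (fun y => toC3 (w y)) x‖ₑ ≤
        ENNReal.ofReal C * ∫⁻ y, ENNReal.ofReal (maj N (y - x)) * ‖v y - w y‖ₑ) ∧
    (∀ {m : ℝ} {v : E3 → E3}, IsWeakL3 m v → ∀ {N : ℝ}, 0 < N → ∀ x,
      ‖projLe φ N (fun y => toC3 (v y)) x - toC3 (v x)‖ₑ ≤
        ENNReal.ofReal C * ∫⁻ y, ENNReal.ofReal (maj N (y - x)) * ‖v y - v x‖ₑ) := by
  obtain ⟨C, hC0, hC⟩ := exists_norm_kernelLe_le hφ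
  have hb : ∀ {N : ℝ}, 0 < N → ∀ (x : E3) (f : E3 → E3),
      ‖∫ y, kernelLe φ N (x - y) • toC3 (f y)‖ₑ ≤
        ENNReal.ofReal C * ∫⁻ y, ENNReal.ofReal (maj N (y - x)) * ‖f y‖ₑ := by
    intro N hN x f
    refine (enorm_integral_le_lintegral_enorm _).trans ?_
    rw [← lintegral_const_mul' _ _ ENNReal.ofReal_ne_top]
    refine lintegral_mono fun y => ?_
    simp only
    rw [← mul_assoc, ← ENNReal.ofReal_mul hC0, ← maj_neg, neg_sub, ← ofReal_norm,
      norm_smul, norm_toC3, ENNReal.ofReal_mul (norm_nonneg _), ofReal_norm (f y)]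
    gcongr
    exact hC N hN _
  refine ⟨C, hC0, fun {m v w} hv hw N hN x => ?_, fun {m v} hv N hN x => ?_⟩
  · rw [projLe_eq, projLe_eq, ← integral_sub (hv.integrable_kernelLe_smul hφ hN x)
      (hw.integrable_kernelLe_smul hφ hN x)]
    simp only [← smul_sub, ← toC3_sub]
    exact hb hN x fun y => v y - w y
  · have hi : Integrable fun y => kernelLe φ N (x - y) := by
      by_contra h
      have := integral_kernelLe hφ hN x
      rw [integral_undef h] at this
      exact zero_ne_one this
    have h1 : toC3 (v x) = ∫ y, kernelLe φ N (x - y) • toC3 (v x) := by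
      rw [integral_smul_const, integral_kernelLe hφ hN x, one_smul]
    rw [projLe_eq]
    conv_lhs => rw [h1]
    rw [← integral_sub (hv.integrable_kernelLe_smul hφ hN x) (hi.smul_const _)]
    simp only [← smul_sub, ← toC3_sub]
    exact hb hN x fun y => v y - v x

/-- An approximate identity acts on a function that is continuous at `x`; weak `L³` controls the far
part. It makes the Littlewood-Paley decomposition available pointwise. -/
theorem IsWeakL3.tendsto_projLe (hφ : IsBump φ) (hv : IsWeakL3 m v) (x : E3) :
    Filter.Tendsto (fun N => projLe φ N (fun y => toC3 (v y)) x) Filter.atTop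
      (nhds (toC3 (v x))) := by
  obtain ⟨C, hC0, -, hC⟩ := exists_projLe_sub_le hφ
  have hI := majInt_nonneg
  have hT := majTail_nonneg
  have hm := hv.pos
  rw [Metric.tendsto_atTop']
  intro ε hε
  obtain ⟨η, hη, hη2⟩ : ∃ η : ℝ, 0 < η ∧ C * (η * majInt) < ε := by
    refine ⟨ε / (C * majInt + 1), by positivity, ?_⟩
    have h0 : C * (ε / (C * majInt + 1) * majInt) = ε * (C * majInt / (C * majInt + 1)) := by
      ring
    have h00 : C * majInt / (C * majInt + 1) < 1 := by
      rw [div_lt_one (by positivity)]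
      linarith
    rw [h0]
    nlinarith
  obtain ⟨ρ, hρ, hloc⟩ := Metric.continuousAt_iff.1 (hv.continuous.continuousAt (x := x)) η hη
  have hlim : Filter.Tendsto (fun N : ℝ => C * (η * majInt + (‖v x‖ * (majTail / (N * ρ)) +
        2 * (majTail / (N * ρ) + 64 * m ^ 3 * (N ^ 2 * ρ ^ 5)⁻¹)))) Filter.atTop
      (nhds (C * (η * majInt + (‖v x‖ * 0 + 2 * (0 + 64 * m ^ 3 * 0))))) := by
    have h1 : Filter.Tendsto (fun N : ℝ => N * ρ) Filter.atTop Filter.atTop :=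
      Filter.tendsto_id.atTop_mul_const hρ
    have h2 : Filter.Tendsto (fun N : ℝ => N ^ 2 * ρ ^ 5) Filter.atTop Filter.atTop :=
      (Filter.tendsto_pow_atTop (by norm_num)).atTop_mul_const (by positivity)
    have h3 := (tendsto_const_nhds (x := majTail)).div_atTop h1
    have h4 := h2.inv_tendsto_atTop
    exact (tendsto_const_nhds.add ((h3.const_mul _).add
      ((h3.add (h4.const_mul _)).const_mul 2))).const_mul C
  obtain ⟨N₀, hN₀⟩ := Filter.eventually_atTop.1
    ((hlim.eventually_lt_const (u := ε) (by simpa only [mul_zero, add_zero] using hη2)).and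
      (Filter.eventually_gt_atTop 0))
  refine ⟨N₀, fun N hN => ?_⟩
  obtain ⟨h1, hNpos⟩ := hN₀ N hN.le
  rw [dist_eq_norm]
  refine lt_of_le_of_lt ?_ h1
  have h2 := (hC hv hNpos x).trans (mul_le_mul_right (lintegral_maj_mul_le_of_local hv hv
    hNpos hρ hη.le (norm_nonneg (v x)) x (g := fun y => ‖v y - v x‖ₑ) (fun y hy => by
      rw [← ofReal_norm]
      refine ENNReal.ofReal_le_ofReal ?_
      have := hloc (x := y) (by rwa [dist_eq_norm])
      rw [dist_eq_norm] at this
      exact this.le) (fun y => by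
        rw [ofReal_norm]
        refine enorm_sub_le.trans ?_
        rw [add_comm]
        gcongr
        exact le_self_add)) _)
  rw [← ENNReal.ofReal_mul hC0, ← ofReal_norm] at h2
  exact (ENNReal.ofReal_le_ofReal_iff (by positivity)).1 h2

namespace IsClassicalSolution

variable {a b : ℝ} {u : ℝ → E3 → E3} {p : ℝ → E3 → ℝ}

/-- The ball is chosen first, so large that the tails of the kernel are negligible; on it `u(s)`
converges uniformly to `u(t)` by compactness. Endpoints are included. -/
theorem continuousOn_projLe (hφ : IsBump φ) (hu : IsClassicalSolution a b u p)
    (hm : ∀ t ∈ Icc a b, IsWeakL3 m (u t)) {N : ℝ} (hN : 0 < N) (x : E3) :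
    ContinuousOn (fun t => projLe φ N (fun y => toC3 (u t y)) x) (Icc a b) := by
  obtain ⟨C, hC0, hC, -⟩ := exists_projLe_sub_le hφ
  have hI := majInt_nonneg
  have hT := majTail_nonneg
  intro t ht
  have hmp := (hm t ht).pos
  refine Metric.tendsto_nhds.2 fun ε hε => ?_
  obtain ⟨η, hη, hη2⟩ : ∃ η : ℝ, 0 < η ∧ C * (η * majInt) < ε := by
    refine ⟨ε / (C * majInt + 1), by positivity, ?_⟩
    have h0 : C * (ε / (C * majInt + 1) * majInt) = ε * (C * majInt / (C * majInt + 1)) := by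
      ring
    have h00 : C * majInt / (C * majInt + 1) < 1 := by
      rw [div_lt_one (by positivity)]
      linarith
    rw [h0]
    nlinarith
  have hlim : Filter.Tendsto (fun ρ : ℝ => C * (η * majInt + (0 * (majTail / (N * ρ)) +
        2 * (majTail / (N * ρ) + 64 * m ^ 3 * (N ^ 2 * ρ ^ 5)⁻¹)))) Filter.atTop
      (nhds (C * (η * majInt + (0 * 0 + 2 * (0 + 64 * m ^ 3 * 0))))) := by
    have h1 : Filter.Tendsto (fun ρ : ℝ => N * ρ) Filter.atTop Filter.atTop :=
      Filter.tendsto_id.const_mul_atTop hN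
    have h2 : Filter.Tendsto (fun ρ : ℝ => N ^ 2 * ρ ^ 5) Filter.atTop Filter.atTop :=
      (Filter.tendsto_pow_atTop (by norm_num)).const_mul_atTop (by positivity)
    have h3 := (tendsto_const_nhds (x := majTail)).div_atTop h1
    have h4 := h2.inv_tendsto_atTop
    exact (tendsto_const_nhds.add ((h3.const_mul _).add
      ((h3.add (h4.const_mul _)).const_mul 2))).const_mul C
  have hlt : C * (η * majInt + (0 * 0 + 2 * (0 + 64 * m ^ 3 * 0))) < ε := by
    simpa only [mul_zero, add_zero] using hη2
  obtain ⟨ρ, h1, hρ⟩ := ((hlim.eventually (gt_mem_nhds hlt)).and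
      (Filter.eventually_gt_atTop 0)).exists
  have hev : ∀ᶠ s in nhds t, ∀ y ∈ Metric.closedBall x ρ, s ∈ Icc a b → ‖u s y - u t y‖ < η := by
    refine (isCompact_closedBall x ρ).eventually_forall_of_forall_eventually
      (P := fun s y => s ∈ Icc a b → ‖u s y - u t y‖ < η) fun y hy => ?_
    have hc := hu.continuousOn_u (t, y) ⟨ht, mem_univ y⟩
    have hc2 : ContinuousWithinAt (fun z : ℝ × E3 => u t z.2) (Icc a b ×ˢ univ) (t, y) :=
      ((hu.continuous_slice ht).comp continuous_snd).continuousWithinAt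
    have h1 := (hc.sub hc2).norm.eventually_lt_const (u := η) (by simpa using hη)
    rw [eventually_nhdsWithin_iff] at h1
    filter_upwards [h1] with z hz hz1
    exact hz ⟨hz1, mem_univ _⟩
  filter_upwards [nhdsWithin_le_nhds hev, self_mem_nhdsWithin] with s hs hsI
  rw [dist_eq_norm]
  refine lt_of_le_of_lt ?_ h1
  have h2 := (hC (hm s hsI) (hm t ht) hN x).trans (mul_le_mul_right
    (lintegral_maj_mul_le_of_local (hm s hsI) (hm t ht) hN hρ hη.le le_rfl x
      (g := fun y => ‖u s y - u t y‖ₑ) (fun y hy => by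
        rw [← ofReal_norm]
        exact ENNReal.ofReal_le_ofReal (hs y (by simpa [dist_eq_norm] using hy.le) hsI).le)
      (fun y => enorm_sub_le.trans le_add_self)) _)
  rw [← ENNReal.ofReal_mul hC0, ← ofReal_norm] at h2
  exact (ENNReal.ofReal_le_ofReal_iff (by positivity)).1 h2

theorem continuousOn_proj (hφ : IsBump φ) (hu : IsClassicalSolution a b u p)
    (hm : ∀ t ∈ Icc a b, IsWeakL3 m (u t)) {N : ℝ} (hN : 0 < N) (x : E3) :
    ContinuousOn (fun t => proj φ N (u t) x) (Icc a b) :=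
  (hu.continuousOn_projLe hφ hm hN x).sub (hu.continuousOn_projLe hφ hm (by positivity) x)

end IsClassicalSolution

end NSLorentz

namespace NSLorentz

/-! ### Averaged Duhamel bounds -/

variable {φ : E3 → ℝ}

/-- The weight in time of the Duhamel inequality for `P_N u` at time `t`. -/
noncomputable def timeWeight (N t r : ℝ) : ℝ≥0∞ :=
  ENNReal.ofReal (N * ((1 + N ^ 2 * (t - r)) ^ 2)⁻¹)

theorem measurable_timeWeight (N t : ℝ) : Measurable (timeWeight N t) := by
  unfold timeWeight
  fun_prop

/-- This is the parabolic gain: one derivative costs `N`, and the time of decay is `N⁻²`. An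
antiderivative of the weight is `N⁻¹(1 + N²(t - r))⁻¹`. -/
theorem lintegral_timeWeight_le {N s t : ℝ} (hN : 0 < N) (hst : s < t) :
    ∫⁻ r in Ioo s t, timeWeight N t r ≤ ENNReal.ofReal (1 / N) := by
  have hpos : ∀ r ∈ Icc s t, 0 < 1 + N ^ 2 * (t - r) := by
    intro r hr
    have : 0 ≤ N ^ 2 * (t - r) := mul_nonneg (by positivity) (by linarith [hr.2])
    linarith
  have hcont : ContinuousOn (fun r => N * ((1 + N ^ 2 * (t - r)) ^ 2)⁻¹) (Icc s t) := by
    refine continuousOn_const.mul (ContinuousOn.inv₀ (by fun_prop) fun r hr => ?_)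
    exact (pow_pos (hpos r hr) 2).ne'
  have hi : IntervalIntegrable (fun r => N * ((1 + N ^ 2 * (t - r)) ^ 2)⁻¹) volume s t :=
    ContinuousOn.intervalIntegrable_of_Icc hst.le hcont
  have hd : ∀ r ∈ uIcc s t, HasDerivAt (fun r => N⁻¹ * (1 + N ^ 2 * (t - r))⁻¹)
      (N * ((1 + N ^ 2 * (t - r)) ^ 2)⁻¹) r := by
    intro r hr
    rw [uIcc_of_le hst.le] at hr
    have h0 := (hpos r hr).ne'
    have h1 : HasDerivAt (fun r => 1 + N ^ 2 * (t - r)) (-N ^ 2) r := by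
      simpa using (((hasDerivAt_id r).const_sub t).const_mul (N ^ 2)).const_add 1
    refine ((h1.inv h0).const_mul N⁻¹).congr_deriv ?_
    field_simp
  have h := intervalIntegral.integral_eq_sub_of_hasDerivAt hd hi
  have h3 : 0 < N⁻¹ * (1 + N ^ 2 * (t - s))⁻¹ :=
    mul_pos (inv_pos.2 hN) (inv_pos.2 (hpos s (left_mem_Icc.2 hst.le)))
  rw [intervalIntegral.integral_of_le hst.le] at h
  refine (lintegral_mono_set Ioo_subset_Ioc_self).trans ?_
  unfold timeWeight
  rw [← ofReal_integral_eq_lintegral_ofReal ((intervalIntegrable_iff_integrableOn_Ioc_of_le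
    hst.le).1 hi) (Filter.Eventually.of_forall fun r => by positivity), h]
  refine ENNReal.ofReal_le_ofReal ?_
  simp only [sub_self, mul_zero, add_zero, inv_one, mul_one, one_div]
  linarith

/-! ### The quadratic Duhamel term and its averages over sets -/

theorem volume_ball_one_le (x : E3) : volume (Metric.ball x 1) ≤ ENNReal.ofReal 5 := by
  rw [EuclideanSpace.volume_ball_fin_three, ENNReal.ofReal_one, one_pow, one_mul]
  exact ENNReal.ofReal_le_ofReal (by linarith [Real.pi_lt_d2])

theorem one_le_volume_ball_one (x : E3) : 1 ≤ volume (Metric.ball x 1) := by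
  rw [EuclideanSpace.volume_ball_fin_three, ENNReal.ofReal_one, one_pow, one_mul,
    ← ENNReal.ofReal_one]
  exact ENNReal.ofReal_le_ofReal (by linarith [Real.pi_gt_three])

/-- The quadratic term of the Duhamel inequality, for a density `f` in place of `|u|²`. -/
noncomputable def duhamelInt (N s t : ℝ) (f : ℝ → E3 → ℝ≥0∞) (x : E3) : ℝ≥0∞ :=
  ∫⁻ r in Ioo s t, timeWeight N t r * ∫⁻ y, ENNReal.ofReal (maj N (y - x)) * f r y

section

variable {f : ℝ → E3 → ℝ≥0∞}

theorem measurable_duhamelInt_integrand (hf : Measurable fun z : ℝ × E3 => f z.1 z.2) {N : ℝ}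
    (hN : 0 < N) (t : ℝ) : Measurable fun z : E3 × ℝ =>
      timeWeight N t z.2 * ∫⁻ y, ENNReal.ofReal (maj N (y - z.1)) * f z.2 y := by
  refine ((measurable_timeWeight N t).comp measurable_snd).mul ?_
  refine Measurable.lintegral_prod_right' (f := fun w : (E3 × ℝ) × E3 =>
    ENNReal.ofReal (maj N (w.2 - w.1.1)) * f w.1.2 w.2) ?_
  exact ((measurable_ofReal_maj hN).comp (by fun_prop)).mul
    (hf.comp (g := fun z : ℝ × E3 => f z.1 z.2) (f := fun w : (E3 × ℝ) × E3 => (w.1.2, w.2))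
      (by fun_prop))

theorem measurable_duhamelInt (hf : Measurable fun z : ℝ × E3 => f z.1 z.2) {N : ℝ}
    (hN : 0 < N) (s t : ℝ) : Measurable (duhamelInt N s t f) :=
  Measurable.lintegral_prod_right' (measurable_duhamelInt_integrand hf hN t)

theorem lintegral_maj_sub_mul (N : ℝ) (x : E3) (g : E3 → ℝ≥0∞) :
    ∫⁻ y, ENNReal.ofReal (maj N (y - x)) * g y = ∫⁻ z, ENNReal.ofReal (maj N z) * g (x + z) := by
  rw [← lintegral_add_left_eq_self (μ := volume)
    (fun y : E3 => ENNReal.ofReal (maj N (y - x)) * g y) x]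
  simp only [add_sub_cancel_left]

theorem setLIntegral_lintegral_maj (hf : Measurable fun z : ℝ × E3 => f z.1 z.2) {N : ℝ}
    (hN : 0 < N) (B : Set E3) (r : ℝ) :
    ∫⁻ x in B, ∫⁻ y, ENNReal.ofReal (maj N (y - x)) * f r y =
      ∫⁻ z, ENNReal.ofReal (maj N z) * ∫⁻ x in B, f r (x + z) := by
  simp only [lintegral_maj_sub_mul]
  rw [lintegral_lintegral_swap]
  · refine lintegral_congr fun z => ?_
    rw [lintegral_const_mul' _ _ ENNReal.ofReal_ne_top]
  · exact (((measurable_ofReal_maj hN).comp measurable_snd).mul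
      (hf.comp (g := fun z : ℝ × E3 => f z.1 z.2) (f := fun w : E3 × E3 => (r, w.1 + w.2))
      (by fun_prop))).aemeasurable

/-- By Tonelli the average falls on the density: only its integrals over translates of `B` matter,
and no pointwise bound on the density is required. -/
theorem setLIntegral_duhamelInt (hf : Measurable fun z : ℝ × E3 => f z.1 z.2) {N : ℝ}
    (hN : 0 < N) (s t : ℝ) (B : Set E3) :
    ∫⁻ x in B, duhamelInt N s t f x = ∫⁻ r in Ioo s t, timeWeight N t r *
      ∫⁻ z, ENNReal.ofReal (maj N z) * ∫⁻ x in B, f r (x + z) := by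
  unfold duhamelInt
  rw [lintegral_lintegral_swap (measurable_duhamelInt_integrand hf hN t).aemeasurable]
  refine lintegral_congr fun r => ?_
  rw [lintegral_const_mul' _ _ (by simp [timeWeight]), setLIntegral_lintegral_maj hf hN]

theorem setLIntegral_timeWeight_mul_le {N s t D : ℝ} (hN : 0 < N) (hst : s < t)
    {g : ℝ → ℝ≥0∞} (hg : ∀ r ∈ Ioo s t, g r ≤ ENNReal.ofReal D) :
    ∫⁻ r in Ioo s t, timeWeight N t r * g r ≤ ENNReal.ofReal (D / N) := by
  calc ∫⁻ r in Ioo s t, timeWeight N t r * g r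
      ≤ ∫⁻ r in Ioo s t, timeWeight N t r * ENNReal.ofReal D :=
        setLIntegral_mono' measurableSet_Ioo fun r hr => mul_le_mul_right (hg r hr) _
    _ = (∫⁻ r in Ioo s t, timeWeight N t r) * ENNReal.ofReal D :=
        lintegral_mul_const' _ _ ENNReal.ofReal_ne_top
    _ ≤ ENNReal.ofReal (1 / N) * ENNReal.ofReal D :=
        mul_le_mul_left (lintegral_timeWeight_le hN hst) _
    _ = ENNReal.ofReal (D / N) := by
        rw [← ENNReal.ofReal_mul (by positivity)]
        congr 1
        ring

theorem duhamelInt_le {N s t D : ℝ} (hN : 0 < N) (hst : s < t) (hD : 0 ≤ D)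
    (hf : ∀ r ∈ Ioo s t, ∀ y, f r y ≤ ENNReal.ofReal D) (x : E3) :
    duhamelInt N s t f x ≤ ENNReal.ofReal (D * majInt / N) := by
  refine setLIntegral_timeWeight_mul_le hN hst fun r hr => ?_
  calc ∫⁻ y, ENNReal.ofReal (maj N (y - x)) * f r y
      ≤ ∫⁻ y, ENNReal.ofReal (maj N (y - x)) * ENNReal.ofReal D :=
        lintegral_mono fun y => mul_le_mul_right (hf r hr y) _
    _ = ENNReal.ofReal (D * majInt) := by
        rw [lintegral_mul_const' _ _ ENNReal.ofReal_ne_top, lintegral_maj_sub hN, mul_comm,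
          ← ENNReal.ofReal_mul hD]

theorem lintegral_maj_mul_le_of_split {N ρ δ D : ℝ} (hN : 0 < N) (hρ : 0 < ρ) (hδ : 0 ≤ δ)
    (hD : 0 ≤ D) {g : E3 → ℝ≥0∞} (h1 : ∀ z, ‖z‖ < ρ → g z ≤ ENNReal.ofReal δ)
    (h2 : ∀ z, g z ≤ ENNReal.ofReal D) :
    ∫⁻ z, ENNReal.ofReal (maj N z) * g z ≤
      ENNReal.ofReal (δ * majInt + D * (majTail / (N * ρ))) := by
  have hT := majTail_nonneg
  have hI := majInt_nonneg
  have hs0 : MeasurableSet {y : E3 | ρ ≤ ‖y‖} :=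
    (isClosed_le continuous_const (by fun_prop)).measurableSet
  have hp : ∀ z, ENNReal.ofReal (maj N z) * g z ≤
      ENNReal.ofReal δ * ENNReal.ofReal (maj N z) + {y : E3 | ρ ≤ ‖y‖}.indicator
        (fun z => ENNReal.ofReal D * ENNReal.ofReal (maj N z)) z := by
    intro z
    by_cases hz : ‖z‖ < ρ
    · refine le_trans ?_ le_self_add
      rw [mul_comm]
      exact mul_le_mul_left (h1 z hz) _
    · rw [indicator_of_mem (show z ∈ {y : E3 | ρ ≤ ‖y‖} from not_lt.1 hz)]
      refine le_trans ?_ le_add_self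
      rw [mul_comm]
      exact mul_le_mul_left (h2 z) _
  refine (lintegral_mono hp).trans ?_
  rw [lintegral_add_left ((measurable_ofReal_maj hN).const_mul _),
    lintegral_const_mul' _ _ ENNReal.ofReal_ne_top, lintegral_maj hN, lintegral_indicator hs0,
    lintegral_const_mul' _ _ ENNReal.ofReal_ne_top, ENNReal.ofReal_add (by positivity)
    (by positivity), ← ENNReal.ofReal_mul hδ, ENNReal.ofReal_mul hD]
  gcongr
  exact lintegral_maj_tail_le hN hρ

theorem setLIntegral_duhamelInt_le (hf : Measurable fun z : ℝ × E3 => f z.1 z.2)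
    {N s t ρ δ D : ℝ} (hN : 0 < N) (hst : s < t) (hρ : 0 < ρ) (hδ : 0 ≤ δ) (hD : 0 ≤ D)
    (B : Set E3)
    (h1 : ∀ r ∈ Ioo s t, ∀ z, ‖z‖ < ρ → ∫⁻ x in B, f r (x + z) ≤ ENNReal.ofReal δ)
    (h2 : ∀ r ∈ Ioo s t, ∀ z, ∫⁻ x in B, f r (x + z) ≤ ENNReal.ofReal D) :
    ∫⁻ x in B, duhamelInt N s t f x ≤
      ENNReal.ofReal ((δ * majInt + D * (majTail / (N * ρ))) / N) := by
  rw [setLIntegral_duhamelInt hf hN]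
  exact setLIntegral_timeWeight_mul_le hN hst fun r hr =>
    lintegral_maj_mul_le_of_split hN hρ hδ hD (h1 r hr) (h2 r hr)

end

/-- The integral of `|v|²` over the unit ball around `z`. -/
noncomputable def locEnergy (v : E3 → E3) (z : E3) : ℝ≥0∞ := ∫⁻ y in Metric.ball z 1, ‖v y‖ₑ ^ 2

theorem setLIntegral_ball_add (g : E3 → ℝ≥0∞) (x z : E3) :
    ∫⁻ y in Metric.ball x 1, g (y + z) = ∫⁻ y in Metric.ball (x + z) 1, g y := by
  rw [← lintegral_indicator Metric.isOpen_ball.measurableSet,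
    ← lintegral_indicator Metric.isOpen_ball.measurableSet,
    ← lintegral_add_right_eq_self (μ := volume) (indicator (Metric.ball (x + z) 1) g) z]
  refine lintegral_congr fun y => ?_
  by_cases hy : y ∈ Metric.ball x 1
  · rw [indicator_of_mem hy, indicator_of_mem]
    simpa using hy
  · rw [indicator_of_notMem hy, indicator_of_notMem]
    simpa using hy

theorem IsWeakL3.locEnergy_le {m : ℝ} {v : E3 → E3} (hv : IsWeakL3 m v) (z : E3) :
    locEnergy v z ≤ ENNReal.ofReal (69 * m ^ 2) := by
  have hm := hv.pos
  -- With the height `λ = m`, the low part gives `5m²` (volume of the ball) and the high part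
  -- `64m²`, hence `69`.
  have h := hv.lintegral_mul_pow_le hm (k := 2) (Or.inr rfl)
    (κ := (Metric.ball z 1).indicator fun _ => 1) (measurable_const.indicator
      Metric.isOpen_ball.measurableSet) (B := 1) (fun y => indicator_le_self' (by simp) y)
  have e : ∀ y, (Metric.ball z 1).indicator (fun _ => (1 : ℝ≥0∞)) y * ‖v y‖ₑ ^ 2 =
      (Metric.ball z 1).indicator (fun y => ‖v y‖ₑ ^ 2) y := by
    intro y
    by_cases hy : y ∈ Metric.ball z 1 <;> simp [hy]
  simp only [e] at h
  rw [lintegral_indicator Metric.isOpen_ball.measurableSet,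
    lintegral_indicator Metric.isOpen_ball.measurableSet, setLIntegral_const, one_mul, one_mul] at h
  refine h.trans ((add_le_add_left (mul_le_mul_right (volume_ball_one_le z) _) _).trans ?_)
  rw [← ENNReal.ofReal_mul (by positivity), ← ENNReal.ofReal_add (by positivity) (by positivity)]
  refine ENNReal.ofReal_le_ofReal (le_of_eq ?_)
  field_simp
  ring

/-- Moving the centre of the kernel by less than `1` changes it by at most `2⁵ = 32`. Averaging over
such centres, in a ball of volume at least `1`, turns the pointwise `|v|²` into local energies. -/
theorem lintegral_maj_mul_sq_le_locEnergy {v : E3 → E3} (hv : Continuous v) :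
    ∫⁻ y, ENNReal.ofReal (maj 1 (y - 0)) * ‖v y‖ₑ ^ 2 ≤
      ENNReal.ofReal 32 * ∫⁻ z, ENNReal.ofReal (maj 1 z) * locEnergy v z := by
  have hf : Measurable fun z : ℝ × E3 => ‖v z.2‖ₑ ^ 2 :=
    (hv.comp continuous_snd).enorm.measurable.pow_const 2
  have h := setLIntegral_lintegral_maj (f := fun _ y => ‖v y‖ₑ ^ 2) hf one_pos
    (Metric.ball 0 1) 0
  have h1 : ∀ z, ∫⁻ x in Metric.ball (0 : E3) 1, ‖v (x + z)‖ₑ ^ 2 = locEnergy v z := by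
    intro z
    rw [setLIntegral_ball_add (fun y => ‖v y‖ₑ ^ 2) 0 z, zero_add]
    rfl
  simp only [h1] at h
  rw [← h, ← lintegral_const_mul' _ _ ENNReal.ofReal_ne_top]
  have h2 : ∀ x ∈ Metric.ball (0 : E3) 1, ∫⁻ y, ENNReal.ofReal (maj 1 (y - 0)) * ‖v y‖ₑ ^ 2 ≤
      ENNReal.ofReal 32 * ∫⁻ y, ENNReal.ofReal (maj 1 (y - x)) * ‖v y‖ₑ ^ 2 := by
    intro x hx
    rw [← lintegral_const_mul' _ _ ENNReal.ofReal_ne_top]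
    refine lintegral_mono fun y => ?_
    simp only
    rw [← mul_assoc, ← ENNReal.ofReal_mul (by norm_num)]
    refine mul_le_mul_left (ENNReal.ofReal_le_ofReal ?_) _
    simp only [maj, sub_zero, one_pow, one_mul]
    have hx1 : ‖x‖ < 1 := by simpa using hx
    have h3 : 1 + ‖y - x‖ ≤ 2 * (1 + ‖y‖) := by
      have := norm_sub_le y x
      have := norm_nonneg y
      linarith
    have h4 := pow_le_pow_left₀ (by positivity) h3 5
    rw [mul_pow] at h4
    rw [inv_eq_one_div, div_le_iff₀ (by positivity), mul_right_comm, ← div_eq_mul_inv,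
      le_div_iff₀ (by positivity)]
    linarith
  refine le_trans ?_ (setLIntegral_mono' Metric.isOpen_ball.measurableSet h2)
  rw [setLIntegral_const]
  exact le_mul_of_one_le_right zero_le (one_le_volume_ball_one 0)

end NSLorentz

namespace NSLorentz

/-! ### Littlewood-Paley sums -/

variable {φ : E3 → ℝ}

theorem projLe_sub_projLe_eq_sum (v : E3 → E3) (K : ℝ) (x : E3) (J : ℕ) :
    projLe φ (2 ^ J * K) (fun y => toC3 (v y)) x - projLe φ K (fun y => toC3 (v y)) x =
      ∑ j ∈ Finset.range J, proj φ (2 ^ (j + 1) * K) v x := by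
  have h := Finset.sum_range_sub (fun j : ℕ => projLe φ (2 ^ j * K) (fun y => toC3 (v y)) x) J
  rw [pow_zero, one_mul] at h
  rw [← h]
  refine Finset.sum_congr rfl fun j _ => ?_
  have e : 2 ^ (j + 1) * K / 2 = 2 ^ j * K := by ring
  rw [proj, e]

theorem measurable_enorm_proj (hφ : IsBump φ) {v : E3 → E3} (hv : Continuous v) {N : ℝ}
    (hN : 0 < N) : Measurable fun x => ‖proj φ N v x‖ₑ := by
  have h : ∀ {N : ℝ}, 0 < N → Measurable fun x => projLe φ N (fun y => toC3 (v y)) x := by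
    intro N hN
    simp only [projLe_eq]
    refine (StronglyMeasurable.integral_prod_right (f := fun x y : E3 =>
      kernelLe φ N (x - y) • toC3 (v y)) (Continuous.stronglyMeasurable ?_)).measurable
    exact ((continuous_kernelLe hφ hN).comp (by fun_prop)).smul
      (continuous_toC3.comp (hv.comp continuous_snd))
  exact ((h hN).sub (h (by positivity))).enorm

theorem sum_geometric_five_sixths_le (J : ℕ) :
    ∑ j ∈ Finset.range J, ((5 : ℝ) / 6) ^ j ≤ 6 := by
  have h := Summable.sum_le_tsum (Finset.range J) (f := fun j : ℕ => ((5 : ℝ) / 6) ^ j)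
    (fun j _ => by positivity) (summable_geometric_of_lt_one (by norm_num) (by norm_num))
  rw [tsum_geometric_of_lt_one (by norm_num) (by norm_num)] at h
  linarith

/-- Cauchy-Schwarz with the summable weights `(5/6)^j`, of sum `6`, replaces orthogonality, which is
not available on balls. The growth `(6/5)^j` is slower than the decay `2^(-j/2)` of the later
estimate. -/
theorem IsWeakL3.enorm_sub_projLe_sq_le (hφ : IsBump φ) {m : ℝ} {v : E3 → E3}
    (hv : IsWeakL3 m v) {K : ℝ} (hK : 0 < K) (x : E3) :
    ‖toC3 (v x) - projLe φ K (fun y => toC3 (v y)) x‖ₑ ^ 2 ≤ ENNReal.ofReal 6 *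
      ∑' j : ℕ, ENNReal.ofReal ((6 / 5) ^ j) * ‖proj φ (2 ^ (j + 1) * K) v x‖ₑ ^ 2 := by
  have hlim : Filter.Tendsto (fun J : ℕ => ‖projLe φ (2 ^ J * K) (fun y => toC3 (v y)) x -
      projLe φ K (fun y => toC3 (v y)) x‖ₑ ^ 2) Filter.atTop
      (nhds (‖toC3 (v x) - projLe φ K (fun y => toC3 (v y)) x‖ₑ ^ 2)) := by
    have h1 : Filter.Tendsto (fun J : ℕ => (2 : ℝ) ^ J * K) Filter.atTop Filter.atTop :=
      (tendsto_pow_atTop_atTop_of_one_lt one_lt_two).atTop_mul_const hK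
    have h2 := (((hv.tendsto_projLe hφ x).comp h1).sub_const
      (projLe φ K (fun y => toC3 (v y)) x)).enorm
    exact (ENNReal.continuous_pow 2).continuousAt.tendsto.comp h2
  refine le_of_tendsto' hlim fun J => ?_
  rw [projLe_sub_projLe_eq_sum]
  refine le_trans ?_ (mul_le_mul_right (ENNReal.sum_le_tsum (Finset.range J)) _)
  have h3 : (∑ j ∈ Finset.range J, ‖proj φ (2 ^ (j + 1) * K) v x‖) ^ 2 ≤
      6 * ∑ j ∈ Finset.range J, (6 / 5) ^ j * ‖proj φ (2 ^ (j + 1) * K) v x‖ ^ 2 := by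
    refine (Finset.sum_sq_le_sum_mul_sum_of_sq_le_mul (Finset.range J)
      (f := fun j : ℕ => ((5 : ℝ) / 6) ^ j)
      (g := fun j : ℕ => (6 / 5) ^ j * ‖proj φ (2 ^ (j + 1) * K) v x‖ ^ 2)
      (fun j _ => by positivity) (fun j _ => by positivity) (fun j _ => ?_)).trans ?_
    · rw [← mul_assoc, ← mul_pow]
      norm_num
    · exact mul_le_mul_of_nonneg_right (sum_geometric_five_sixths_le J)
        (Finset.sum_nonneg fun j _ => by positivity)
  have h4 : ∀ j ∈ Finset.range J, ENNReal.ofReal ((6 / 5) ^ j) *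
      ‖proj φ (2 ^ (j + 1) * K) v x‖ₑ ^ 2 =
      ENNReal.ofReal ((6 / 5) ^ j * ‖proj φ (2 ^ (j + 1) * K) v x‖ ^ 2) := by
    intro j _
    rw [ENNReal.ofReal_mul (by positivity), ENNReal.ofReal_pow (norm_nonneg _), ofReal_norm]
  rw [Finset.sum_congr rfl h4, ← ENNReal.ofReal_sum_of_nonneg (fun j _ => by positivity),
    ← ENNReal.ofReal_mul (by norm_num), ← ofReal_norm, ← ENNReal.ofReal_pow (norm_nonneg _)]
  refine ENNReal.ofReal_le_ofReal (le_trans ?_ h3)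
  exact pow_le_pow_left₀ (norm_nonneg _) (norm_sum_le _ _) 2

/-! ### Flows obeying the Duhamel inequality -/

/-- A continuous flow, bounded by `m` in weak `L³`, whose Littlewood-Paley pieces obey the Duhamel
inequality on `(a, b)`. -/
structure IsDuhamelFlow (φ : E3 → ℝ) (c m a b : ℝ) (U : ℝ → E3 → E3) : Prop where
  one_le : 1 ≤ m
  continuous : Continuous fun z : ℝ × E3 => U z.1 z.2
  isWeakL3 : ∀ t, IsWeakL3 m (U t)
  duhamel : ∀ {s t : ℝ}, a < s → s < t → t < b → ∀ {N : ℝ}, 0 < N → ∀ x : E3,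
    ‖proj φ N (U t) x‖ₑ ≤ ENNReal.ofReal (c * m * N * ((1 + N ^ 2 * (t - s)) ^ 2)⁻¹) +
      ENNReal.ofReal c * duhamelInt N s t (fun r y => ‖U r y‖ₑ ^ 2) x

namespace IsDuhamelFlow

variable {c m a b : ℝ} {U : ℝ → E3 → E3}

theorem measurable_sq (hU : IsDuhamelFlow φ c m a b U) :
    Measurable fun z : ℝ × E3 => ‖U z.1 z.2‖ₑ ^ 2 :=
  hU.continuous.enorm.measurable.pow_const 2

/-- For `N ≥ 1` one has `1 + N²S ≥ NS`, so the free term is brought to the form `1/N` times a gain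
in `S`, matching the quadratic term. -/
theorem duhamel_sub (hU : IsDuhamelFlow φ c m a b U) (hc : 0 ≤ c) {t S : ℝ} (hS : 0 < S)
    (ha : a < t - S) (hb : t < b) {N : ℝ} (hN : 1 ≤ N) (x : E3) :
    ‖proj φ N (U t) x‖ₑ ≤ ENNReal.ofReal (c * m / (N * S ^ 2)) +
      ENNReal.ofReal c * duhamelInt N (t - S) t (fun r y => ‖U r y‖ₑ ^ 2) x := by
  have hm := hU.one_le
  have hN0 : 0 < N := by linarith
  refine (hU.duhamel ha (by linarith) hb hN0 x).trans (add_le_add_left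
    (ENNReal.ofReal_le_ofReal ?_) _)
  rw [sub_sub_cancel]
  have h1 : N ^ 2 * S ^ 2 ≤ (1 + N ^ 2 * S) ^ 2 := by
    have h2 : N * S ≤ 1 + N ^ 2 * S := by
      have : N * S ≤ N * (N * S) := le_mul_of_one_le_left (by positivity) hN
      nlinarith
    calc N ^ 2 * S ^ 2 = (N * S) ^ 2 := by ring
      _ ≤ _ := pow_le_pow_left₀ (by positivity) h2 2
  calc c * m * N * ((1 + N ^ 2 * S) ^ 2)⁻¹ ≤ c * m * N * (N ^ 2 * S ^ 2)⁻¹ :=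
        mul_le_mul_of_nonneg_left (inv_anti₀ (by positivity) h1) (by positivity)
    _ = c * m / (N * S ^ 2) := by field_simp

/-- Three contributions, each with a factor `1/N`: the free term, small for large `S`; the energy
`δ` near `x₀`; and the trivial energy `69m²` beyond distance `ρ`. -/
theorem setLIntegral_proj_le (hU : IsDuhamelFlow φ c m a b U) (hc : 0 ≤ c) {t S : ℝ} (hS : 0 < S)
    (ha : a < t - S) (hb : t < b) {N : ℝ} (hN : 1 ≤ N) (x₀ : E3) {ρ δ : ℝ} (hρ : 0 < ρ)
    (hδ : 0 ≤ δ) (hloc : ∀ r ∈ Ioo (t - S) t, ∀ z, ‖z‖ < ρ →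
      locEnergy (U r) (x₀ + z) ≤ ENNReal.ofReal δ) :
    ∫⁻ x in Metric.ball x₀ 1, ‖proj φ N (U t) x‖ₑ ≤
      ENNReal.ofReal (c * (5 * m / S ^ 2 + (δ * majInt + 69 * m ^ 2 * (majTail / ρ))) / N) := by
  have hm := hU.one_le
  have hN0 : 0 < N := by linarith
  have hT := majTail_nonneg
  have hI := majInt_nonneg
  have h1 := setLIntegral_duhamelInt_le (f := fun r y => ‖U r y‖ₑ ^ 2) hU.measurable_sq hN0
    (show t - S < t by linarith) hρ hδ (D := 69 * m ^ 2) (by positivity) (Metric.ball x₀ 1)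
    (fun r hr z hz => by
      rw [setLIntegral_ball_add (fun y => ‖U r y‖ₑ ^ 2)]
      exact hloc r hr z hz)
    (fun r _ z => by
      rw [setLIntegral_ball_add (fun y => ‖U r y‖ₑ ^ 2)]
      exact (hU.isWeakL3 r).locEnergy_le _)
  refine (lintegral_mono fun x => hU.duhamel_sub hc hS ha hb hN x).trans ?_
  rw [lintegral_add_left measurable_const, setLIntegral_const,
    lintegral_const_mul' _ _ ENNReal.ofReal_ne_top]
  refine (add_le_add (mul_le_mul_right (volume_ball_one_le x₀) _)
    (mul_le_mul_right h1 _)).trans ?_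
  rw [← ENNReal.ofReal_mul (by positivity), ← ENNReal.ofReal_mul hc,
    ← ENNReal.ofReal_add (by positivity) (by positivity)]
  refine ENNReal.ofReal_le_ofReal ?_
  have h2 : majTail / (N * ρ) ≤ majTail / ρ :=
    div_le_div_of_nonneg_left hT hρ (le_mul_of_one_le_left hρ.le hN)
  calc c * m / (N * S ^ 2) * 5 + c * ((δ * majInt + 69 * m ^ 2 * (majTail / (N * ρ))) / N)
      ≤ c * m / (N * S ^ 2) * 5 + c * ((δ * majInt + 69 * m ^ 2 * (majTail / ρ)) / N) := by
        gcongr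
    _ = _ := by
        field_simp

end IsDuhamelFlow

/-- High frequencies are small in `L²` on unit balls. -/
theorem IsBump.exists_setLIntegral_proj_sq_le (hφ : IsBump φ) {c : ℝ} (hc : 0 ≤ c) :
    ∃ C : ℝ, 0 ≤ C ∧ ∀ {m a b : ℝ} {U : ℝ → E3 → E3}, IsDuhamelFlow φ c m a b U →
      ∀ {t : ℝ}, a < t - 1 → t < b → ∀ {N : ℝ}, 1 ≤ N → ∀ x₀ : E3,
      ∫⁻ x in Metric.ball x₀ 1, ‖proj φ N (U t) x‖ₑ ^ 2 ≤ ENNReal.ofReal (C * m ^ 4 / √N) := by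
  obtain ⟨Cp, hCp0, hCp⟩ := exists_norm_proj_le hφ
  have hT := majTail_nonneg
  have hI := majInt_nonneg
  obtain ⟨D, hD⟩ : ∃ D, D = 69 * (1 + (majInt + majTail)) := ⟨_, rfl⟩
  have hD0 : 0 ≤ D := by rw [hD]; positivity
  refine ⟨c * (1 + majInt) * (c * (5 + D)) + Cp * c * D, by positivity, ?_⟩
  intro m a b U hU t ha hb N hN x₀
  have hm := hU.one_le
  have hN0 : 0 < N := by linarith
  have hq : 0 < √N := Real.sqrt_pos.2 hN0
  have hq2 : √N ^ 2 = N := Real.sq_sqrt hN0.le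
  have hq1 : 1 ≤ √N := Real.one_le_sqrt.2 hN
  have hP := hU.setLIntegral_proj_le hc one_pos ha hb hN x₀ one_pos (δ := 69 * m ^ 2)
    (by positivity) (fun r _ z _ => (hU.isWeakL3 r).locEnergy_le _)
  -- `fh` is the part of `|U|²` above the height `|U| = √N`. The part below is at most `N`, so the
  -- gain `1/N` in time makes its contribution to `P_N U` bounded pointwise. The part above has
  -- total mass `O(m³/√N)`.
  obtain ⟨fh, hfh⟩ : ∃ fh : ℝ → E3 → ℝ≥0∞, fh = fun r y =>
      {z : ℝ × E3 | √N < ‖U z.1 z.2‖}.indicator (fun z => ‖U z.1 z.2‖ₑ ^ 2) (r, y) := ⟨_, rfl⟩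
  have hfm : Measurable fun z : ℝ × E3 => fh z.1 z.2 := by
    rw [hfh]
    exact hU.measurable_sq.indicator (isOpen_lt continuous_const hU.continuous.norm).measurableSet
  have hsplit : ∀ r y, ‖U r y‖ₑ ^ 2 ≤ ENNReal.ofReal N + fh r y := by
    intro r y
    by_cases h : √N < ‖U r y‖
    · refine le_trans (le_of_eq ?_) le_add_self
      rw [hfh]
      simp [h]
    · refine le_trans ?_ le_self_add
      rw [← ofReal_norm, ← ENNReal.ofReal_pow (norm_nonneg _)]
      refine ENNReal.ofReal_le_ofReal ?_
      rw [← hq2]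
      exact pow_le_pow_left₀ (norm_nonneg _) (not_lt.1 h) 2
  have hfD : ∀ r (z : E3), ∫⁻ x in Metric.ball x₀ 1, fh r (x + z) ≤
      ENNReal.ofReal (64 * m ^ 3 / √N) := by
    intro r z
    have h1 := (hU.isWeakL3 r).setLIntegral_pow_le hq (k := 2) (Or.inr rfl)
    rw [← lintegral_indicator (measurableSet_lt_norm (hU.isWeakL3 r).continuous _)] at h1
    calc ∫⁻ x in Metric.ball x₀ 1, fh r (x + z) ≤ ∫⁻ x, fh r (x + z) := setLIntegral_le_lintegral _ _
      _ = ∫⁻ x, fh r x := lintegral_add_right_eq_self (μ := volume) (fh r) z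
      _ = ∫⁻ x, {y | √N < ‖U r y‖}.indicator (fun y => ‖U r y‖ₑ ^ 2) x := by
          rw [hfh]
          rfl
      _ ≤ _ := h1
      _ = _ := by
          congr 1
          field_simp
  have hG : ∫⁻ x in Metric.ball x₀ 1, duhamelInt N (t - 1) t fh x ≤
      ENNReal.ofReal (D * m ^ 3 / (√N * N)) := by
    refine (setLIntegral_duhamelInt_le hfm hN0 (show t - 1 < t by linarith) one_pos
      (δ := 64 * m ^ 3 / √N) (by positivity) (D := 64 * m ^ 3 / √N) (by positivity) _
      (fun r _ z _ => hfD r z) (fun r _ z => hfD r z)).trans (ENNReal.ofReal_le_ofReal ?_)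
    have h2 : majTail / (N * 1) ≤ majTail := div_le_self hT (by linarith)
    have h3 : 64 * (majInt + majTail / (N * 1)) ≤ D := by rw [hD]; linarith
    calc (64 * m ^ 3 / √N * majInt + 64 * m ^ 3 / √N * (majTail / (N * 1))) / N
        = (64 * (majInt + majTail / (N * 1))) * (m ^ 3 / (√N * N)) := by field_simp
      _ ≤ D * (m ^ 3 / (√N * N)) := by gcongr
      _ = _ := by ring
  have hpt : ∀ x, ‖proj φ N (U t) x‖ₑ ≤ ENNReal.ofReal (c * (1 + majInt) * m) +
      ENNReal.ofReal c * duhamelInt N (t - 1) t fh x := by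
    intro x
    have h4 : duhamelInt N (t - 1) t (fun r y => ‖U r y‖ₑ ^ 2) x ≤
        ENNReal.ofReal majInt + duhamelInt N (t - 1) t fh x := by
      have h5 : duhamelInt N (t - 1) t (fun r y => ‖U r y‖ₑ ^ 2) x ≤
          duhamelInt N (t - 1) t (fun _ _ => ENNReal.ofReal N) x +
            duhamelInt N (t - 1) t fh x := by
        have hcm : Measurable fun _ : ℝ × E3 => ENNReal.ofReal N := measurable_const
        have h6 := (measurable_duhamelInt_integrand (f := fun _ _ => ENNReal.ofReal N) hcm hN0
          t).comp (f := fun r : ℝ => (x, r)) (by fun_prop)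
        have h7 : Measurable fun y : E3 => ENNReal.ofReal (maj N (y - x)) * ENNReal.ofReal N :=
          ((measurable_ofReal_maj hN0).comp (by fun_prop)).mul_const _
        unfold duhamelInt
        rw [← lintegral_add_left (by exact h6)]
        refine lintegral_mono fun r => ?_
        simp only
        rw [← mul_add, ← lintegral_add_left h7]
        refine mul_le_mul_right (lintegral_mono fun y => ?_) _
        simp only
        rw [← mul_add]
        exact mul_le_mul_right (hsplit r y) _
      refine h5.trans (add_le_add_left ((duhamelInt_le hN0 (by linarith) hN0.le
        (fun _ _ _ => le_rfl) x).trans (ENNReal.ofReal_le_ofReal (le_of_eq ?_))) _)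
      field_simp
    refine (hU.duhamel_sub hc one_pos ha hb hN x).trans
      ((add_le_add_right (mul_le_mul_right h4 _) _).trans ?_)
    rw [mul_add, ← add_assoc, ← ENNReal.ofReal_mul hc,
      ← ENNReal.ofReal_add (by positivity) (by positivity)]
    refine add_le_add_left (ENNReal.ofReal_le_ofReal ?_) _
    have h8 : c * m / (N * 1 ^ 2) ≤ c * m := div_le_self (by positivity) (by linarith)
    have h9 : c * majInt ≤ c * majInt * m := le_mul_of_one_le_right (by positivity) hm
    linarith
  -- One factor is estimated by `hpt`. The bounded part multiplies the `L¹` bound `m²/N`; for the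
  -- rest the other factor is bounded by Bernstein, `CmN`, against an `L¹` norm `m³/N^(3/2)`. The
  -- total is `O(m⁴/√N)`.
  have hsq : ∀ x, ‖proj φ N (U t) x‖ₑ ^ 2 ≤
      ENNReal.ofReal (c * (1 + majInt) * m) * ‖proj φ N (U t) x‖ₑ +
        ENNReal.ofReal (Cp * m * N * c) * duhamelInt N (t - 1) t fh x := by
    intro x
    have h1 : ‖proj φ N (U t) x‖ₑ ≤ ENNReal.ofReal (Cp * m * N) := by
      rw [← ofReal_norm]
      exact ENNReal.ofReal_le_ofReal (hCp (hU.isWeakL3 t) N hN0 x)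
    rw [pow_two]
    refine (mul_le_mul_right (hpt x) _).trans ?_
    rw [mul_add, mul_comm ‖proj φ N (U t) x‖ₑ, ← mul_assoc,
      ENNReal.ofReal_mul (p := Cp * m * N) (by positivity)]
    gcongr
  refine (lintegral_mono hsq).trans ?_
  rw [lintegral_add_right _ ((measurable_duhamelInt hfm hN0 _ _).const_mul _),
    lintegral_const_mul' _ _ ENNReal.ofReal_ne_top, lintegral_const_mul' _ _ ENNReal.ofReal_ne_top]
  refine (add_le_add (mul_le_mul_right hP _) (mul_le_mul_right hG _)).trans ?_
  rw [← ENNReal.ofReal_mul (by positivity), ← ENNReal.ofReal_mul (by positivity),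
    ← ENNReal.ofReal_add (by positivity) (by positivity)]
  refine ENNReal.ofReal_le_ofReal ?_
  have k1 : c * (5 * m / 1 ^ 2 + (69 * m ^ 2 * majInt + 69 * m ^ 2 * (majTail / 1))) ≤
      c * (5 + D) * m ^ 2 := by
    have : 5 * m ≤ 5 * m ^ 2 := by nlinarith
    have h2 : 69 * m ^ 2 * majInt + 69 * m ^ 2 * majTail ≤ D * m ^ 2 := by
      rw [hD]
      nlinarith [sq_nonneg m]
    rw [mul_assoc c (5 + D)]
    refine mul_le_mul_of_nonneg_left ?_ hc
    simp only [one_pow, div_one]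
    linarith
  have k2 : √N ≤ N := by
    nlinarith
  calc c * (1 + majInt) * m *
        (c * (5 * m / 1 ^ 2 + (69 * m ^ 2 * majInt + 69 * m ^ 2 * (majTail / 1))) / N) +
        Cp * m * N * c * (D * m ^ 3 / (√N * N))
      ≤ c * (1 + majInt) * m * (c * (5 + D) * m ^ 2 / √N) +
        Cp * m * N * c * (D * m ^ 3 / (√N * N)) := by
        gcongr
    _ = c * (1 + majInt) * (c * (5 + D)) * m ^ 3 / √N + Cp * c * D * m ^ 4 / √N := by
        field_simp
    _ ≤ c * (1 + majInt) * (c * (5 + D)) * m ^ 4 / √N + Cp * c * D * m ^ 4 / √N := by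
        gcongr
        norm_num
    _ = _ := by ring

end NSLorentz

namespace NSLorentz

/-! ### High and low frequencies -/

variable {φ : E3 → ℝ}

theorem pow_div_sqrt_two_pow_le {K : ℝ} (hK : 0 < K) (j : ℕ) :
    (6 / 5) ^ j * (1 / √(2 ^ (j + 1) * K)) ≤ (9 / 10) ^ j * (1 / √K) := by
  -- Uses `(4/3)² ≤ 2`; then `(6/5)/(4/3) = 9/10 < 1`.
  have h1 : (4 / 3) ^ j * √K ≤ √(2 ^ (j + 1) * K) := by
    refine Real.le_sqrt_of_sq_le ?_
    rw [mul_pow, Real.sq_sqrt hK.le, ← pow_mul, mul_comm j 2, pow_mul]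
    refine mul_le_mul_of_nonneg_right ?_ hK.le
    calc ((4 / 3 : ℝ) ^ 2) ^ j ≤ 2 ^ j := pow_le_pow_left₀ (by positivity) (by norm_num) j
      _ ≤ 2 ^ (j + 1) := pow_le_pow_right₀ (by norm_num) (by omega)
  have hq : 0 < √K := Real.sqrt_pos.2 hK
  calc (6 / 5) ^ j * (1 / √(2 ^ (j + 1) * K)) ≤ (6 / 5) ^ j * (1 / ((4 / 3) ^ j * √K)) := by
        gcongr
    _ = (6 / 5 / (4 / 3)) ^ j * (1 / √K) := by
        rw [div_pow (6 / 5) (4 / 3)]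
        field_simp
    _ = _ := by norm_num

theorem tsum_ofReal_mul_nine_tenths {E : ℝ} (hE : 0 ≤ E) :
    ∑' j : ℕ, ENNReal.ofReal (E * (9 / 10) ^ j) = ENNReal.ofReal (10 * E) := by
  rw [← ENNReal.ofReal_tsum_of_nonneg (fun j => by positivity)
    ((summable_geometric_of_lt_one (by norm_num) (by norm_num)).mul_left E), tsum_mul_left,
    tsum_geometric_of_lt_one (by norm_num) (by norm_num)]
  congr 1
  norm_num
  ring

theorem IsBump.exists_setLIntegral_sub_projLe_sq_le (hφ : IsBump φ) {c : ℝ} (hc : 0 ≤ c) :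
    ∃ C : ℝ, 0 ≤ C ∧ ∀ {m a b : ℝ} {U : ℝ → E3 → E3}, IsDuhamelFlow φ c m a b U →
      ∀ {t : ℝ}, a < t - 1 → t < b → ∀ {K : ℝ}, 1 ≤ K → ∀ x₀ : E3,
      ∫⁻ x in Metric.ball x₀ 1, ‖toC3 (U t x) - projLe φ K (fun y => toC3 (U t y)) x‖ₑ ^ 2 ≤
        ENNReal.ofReal (C * m ^ 4 / √K) := by
  obtain ⟨C, hC0, hC⟩ := hφ.exists_setLIntegral_proj_sq_le hc
  refine ⟨60 * C, by positivity, fun {m a b U} hU t ha hb K hK x₀ => ?_⟩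
  have hm := hU.one_le
  have hK0 : 0 < K := by linarith
  have hw := hU.isWeakL3 t
  have hNpos : ∀ j : ℕ, 0 < 2 ^ (j + 1) * K := fun j => by positivity
  refine (lintegral_mono fun x => hw.enorm_sub_projLe_sq_le hφ hK0 x).trans ?_
  rw [lintegral_const_mul' _ _ ENNReal.ofReal_ne_top, lintegral_tsum fun j =>
    (((measurable_enorm_proj hφ hw.continuous (hNpos j)).pow_const 2).const_mul _).aemeasurable]
  have h1 : ∀ j : ℕ, ∫⁻ x in Metric.ball x₀ 1, ENNReal.ofReal ((6 / 5) ^ j) *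
      ‖proj φ (2 ^ (j + 1) * K) (U t) x‖ₑ ^ 2 ≤
      ENNReal.ofReal (C * m ^ 4 / √K * (9 / 10) ^ j) := by
    intro j
    rw [lintegral_const_mul' _ _ ENNReal.ofReal_ne_top]
    have hN1 : 1 ≤ 2 ^ (j + 1) * K := one_le_mul_of_one_le_of_one_le
      (one_le_pow₀ (by norm_num)) hK
    refine (mul_le_mul_right (hC hU ha hb hN1 x₀) _).trans ?_
    rw [← ENNReal.ofReal_mul (by positivity)]
    refine ENNReal.ofReal_le_ofReal ?_
    calc (6 / 5) ^ j * (C * m ^ 4 / √(2 ^ (j + 1) * K))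
        = C * m ^ 4 * ((6 / 5) ^ j * (1 / √(2 ^ (j + 1) * K))) := by ring
      _ ≤ C * m ^ 4 * ((9 / 10) ^ j * (1 / √K)) :=
          mul_le_mul_of_nonneg_left (pow_div_sqrt_two_pow_le hK0 j) (by positivity)
      _ = _ := by ring
  refine (mul_le_mul_right (ENNReal.tsum_le_tsum h1) _).trans ?_
  rw [tsum_ofReal_mul_nine_tenths (by positivity), ← ENNReal.ofReal_mul (by norm_num)]
  refine ENNReal.ofReal_le_ofReal (le_of_eq ?_)
  ring

theorem sum_two_pow_succ_le (J : ℕ) : ∑ j ∈ Finset.range J, (2 : ℝ) ^ (j + 1) ≤ 2 * 2 ^ J := by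
  have h := geom_sum_eq (show (2 : ℝ) ≠ 1 by norm_num) J
  have h1 : ∑ j ∈ Finset.range J, (2 : ℝ) ^ (j + 1) = 2 * ∑ j ∈ Finset.range J, (2 : ℝ) ^ j := by
    rw [Finset.mul_sum]
    exact Finset.sum_congr rfl fun j _ => by ring
  rw [h1, h]
  norm_num

/-- The decomposition is stopped at a frequency `L` comparable to `εK`. Below `L` Bernstein already
gives `C m L`, and the pieces between `L` and `K` sum geometrically to at most `2εK`. Smallness at
arbitrarily low frequencies is therefore not needed. -/
theorem IsBump.exists_norm_projLe_le_of_small (hφ : IsBump φ) :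
    ∃ C : ℝ, 0 ≤ C ∧ ∀ {m : ℝ} {v : E3 → E3}, IsWeakL3 m v → 1 ≤ m → ∀ {K ε : ℝ}, 0 < K →
      0 < ε → ε ≤ 1 → ∀ x, (∀ N, ε * K / 2 ≤ N → N ≤ K → ‖proj φ N v x‖ ≤ ε * N) →
      ‖projLe φ K (fun y => toC3 (v y)) x‖ ≤ C * m * (ε * K) := by
  obtain ⟨C, hC0, hC⟩ := exists_norm_projLe_le hφ
  refine ⟨C + 2, by positivity, fun {m v} hv hm K ε hK hε hε1 x h => ?_⟩
  -- With `2^n ≤ ε⁻¹ < 2^(n+1)`, the frequency `L = 2^(-n-1) K` lies between `εK/2` and `εK`.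
  obtain ⟨n, hn1, hn2⟩ := exists_nat_pow_near (one_le_inv_iff₀.2 ⟨hε, hε1⟩) one_lt_two
  obtain ⟨L, hL⟩ : ∃ L : ℝ, L = (2 ^ (n + 1))⁻¹ * K := ⟨_, rfl⟩
  have hL0 : 0 < L := by rw [hL]; positivity
  have hLK : 2 ^ (n + 1) * L = K := by
    rw [hL, mul_inv_cancel_left₀ (by positivity)]
  have hLu : L ≤ ε * K := by
    rw [hL]
    exact mul_le_mul_of_nonneg_right (inv_le_of_inv_le₀ hε hn2.le) hK.le
  have hLl : ε * K / 2 ≤ L := by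
    have h1 : ε ≤ (2 ^ n)⁻¹ := (le_inv_comm₀ hε (by positivity)).2 hn1
    rw [hL, pow_succ, mul_inv]
    nlinarith
  have hsum := projLe_sub_projLe_eq_sum (φ := φ) v L x (n + 1)
  rw [hLK, sub_eq_iff_eq_add] at hsum
  rw [hsum]
  have h1 : ‖∑ j ∈ Finset.range (n + 1), proj φ (2 ^ (j + 1) * L) v x‖ ≤ 2 * (ε * K) := by
    refine (norm_sum_le _ _).trans ?_
    have h2 : ∀ j ∈ Finset.range (n + 1), ‖proj φ (2 ^ (j + 1) * L) v x‖ ≤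
        ε * L * 2 ^ (j + 1) := by
      intro j hj
      have hj1 : j + 1 ≤ n + 1 := Finset.mem_range.1 hj
      have h3 : (1 : ℝ) ≤ 2 ^ (j + 1) := one_le_pow₀ (by norm_num)
      have h4 : (2 : ℝ) ^ (j + 1) ≤ 2 ^ (n + 1) := pow_le_pow_right₀ (by norm_num) hj1
      refine (h _ (hLl.trans (le_mul_of_one_le_left hL0.le h3)) ?_).trans (le_of_eq (by ring))
      rw [← hLK]
      exact mul_le_mul_of_nonneg_right h4 hL0.le
    refine (Finset.sum_le_sum h2).trans ?_
    rw [← Finset.mul_sum]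
    refine (mul_le_mul_of_nonneg_left (sum_two_pow_succ_le (n + 1)) (by positivity)).trans
      (le_of_eq ?_)
    rw [← hLK]
    ring
  have h5 : C * m * L ≤ C * m * (ε * K) := by
    have : 0 < m := by linarith
    gcongr
  have h6 : 2 * (ε * K) ≤ 2 * m * (ε * K) :=
    mul_le_mul_of_nonneg_right (by linarith) (by positivity)
  refine (norm_add_le _ _).trans ((add_le_add h1 (hC hv L hL0 x)).trans ?_)
  linarith

end NSLorentz

namespace NSLorentz

/-! ### Quiet flows -/

variable {φ : E3 → ℝ}

/-- A flow on `(-e⁻²⁴⁰, 0)` all of whose Littlewood-Paley pieces at frequencies between `e²⁴⁰` and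
`e⁻²⁴⁰` are small in the ball of radius `e⁻²⁴⁰`, up to time `-e²⁴⁰`. -/
structure IsQuietFlow (φ : E3 → ℝ) (c m e : ℝ) (U : ℝ → E3 → E3) : Prop where
  flow : IsDuhamelFlow φ c m (-(e ^ 240)⁻¹) 0 U
  pos : 0 < e
  le_half : e ≤ 1 / 2
  small : ∀ t, -(e ^ 240)⁻¹ ≤ t → t ≤ -e ^ 240 → ∀ x : E3, ‖x‖ ≤ (e ^ 240)⁻¹ →
    ∀ N, e ^ 240 ≤ N → N ≤ (e ^ 240)⁻¹ → ‖proj φ N (U t) x‖ ≤ e ^ 24 * N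

theorem enorm_add_sq_le (z w : C3) :
    ‖z + w‖ₑ ^ 2 ≤ ENNReal.ofReal 2 * ‖z‖ₑ ^ 2 + ENNReal.ofReal 2 * ‖w‖ₑ ^ 2 := by
  rw [← ofReal_norm, ← ofReal_norm z, ← ofReal_norm w, ← ENNReal.ofReal_pow (norm_nonneg _),
    ← ENNReal.ofReal_pow (norm_nonneg _), ← ENNReal.ofReal_pow (norm_nonneg _),
    ← ENNReal.ofReal_mul (by norm_num), ← ENNReal.ofReal_mul (by norm_num),
    ← ENNReal.ofReal_add (by positivity) (by positivity)]
  refine ENNReal.ofReal_le_ofReal ?_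
  have h := norm_add_le z w
  have h2 := pow_le_pow_left₀ (norm_nonneg _) h 2
  nlinarith [sq_nonneg (‖z‖ - ‖w‖)]

theorem enorm_sq_eq_toC3 (v : E3) : ‖v‖ₑ ^ 2 = ‖toC3 v‖ₑ ^ 2 := by
  rw [← ofReal_norm, ← ofReal_norm, norm_toC3]

theorem sqrt_inv_pow_two_mul {e : ℝ} (he : 0 < e) (k : ℕ) : √((e ^ (2 * k))⁻¹) = (e ^ k)⁻¹ := by
  rw [mul_comm, pow_mul, ← inv_pow, Real.sqrt_sq (by positivity)]

namespace IsQuietFlow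

variable {c m e : ℝ} {U : ℝ → E3 → E3}

theorem pow_le (hU : IsQuietFlow φ c m e U) {j k : ℕ} (h : j ≤ k) : e ^ k ≤ e ^ j :=
  pow_le_pow_of_le_one hU.pos.le (by linarith [hU.le_half]) h

theorem four_mul_pow_le (hU : IsQuietFlow φ c m e U) {j k : ℕ} (h : j + 2 ≤ k) :
    4 * e ^ k ≤ e ^ j := by
  have h1 := hU.pow_le h
  have h2 := hU.le_half
  have h3 := hU.pos
  have h4 : e ^ (j + 2) = e ^ j * e ^ 2 := pow_add _ _ _
  have h5 : e ^ 2 ≤ 1 / 4 := by nlinarith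
  have h6 : 0 < e ^ j := by positivity
  nlinarith

theorem inv_pow_le (hU : IsQuietFlow φ c m e U) {j k : ℕ} (h : j ≤ k) :
    (e ^ j)⁻¹ ≤ (e ^ k)⁻¹ :=
  inv_anti₀ (pow_pos hU.pos k) (hU.pow_le h)

theorem four_le_inv_pow (hU : IsQuietFlow φ c m e U) {k : ℕ} (h : 2 ≤ k) : 4 ≤ (e ^ k)⁻¹ := by
  have h1 := hU.four_mul_pow_le (j := 0) (k := k) (by omega)
  have h0 := pow_pos hU.pos k
  rw [le_inv_comm₀ (by norm_num) h0]
  rw [pow_zero] at h1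
  linarith

end IsQuietFlow

theorem IsBump.exists_norm_projLe_le_of_isQuietFlow (hφ : IsBump φ) {c : ℝ} :
    ∃ C : ℝ, 0 ≤ C ∧ ∀ {m e : ℝ} {U : ℝ → E3 → E3}, IsQuietFlow φ c m e U →
      ∀ {t : ℝ}, -(e ^ 240)⁻¹ ≤ t → t ≤ -e ^ 240 → ∀ x : E3, ‖x‖ ≤ (e ^ 240)⁻¹ →
      ‖projLe φ (e ^ 6)⁻¹ (fun y => toC3 (U t y)) x‖ ≤ C * m * e ^ 18 := by
  obtain ⟨C, hC0, hC⟩ := hφ.exists_norm_projLe_le_of_small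
  refine ⟨C, hC0, fun {m e U} hU t ht1 ht2 x hx => ?_⟩
  have he := hU.pos
  have e1 : e ^ 24 * (e ^ 6)⁻¹ = e ^ 18 := by field_simp
  have h1 := hC (hU.flow.isWeakL3 t) hU.flow.one_le (K := (e ^ 6)⁻¹) (ε := e ^ 24) (by positivity)
    (by positivity) (by simpa using hU.pow_le (Nat.zero_le 24)) x (fun N hN1 hN2 =>
      hU.small t ht1 ht2 x hx N ?_ (hN2.trans (hU.inv_pow_le (by norm_num))))
  · rwa [e1] at h1
  · rw [e1] at hN1
    have h2 := hU.four_mul_pow_le (j := 18) (k := 240) (by norm_num)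
    have := pow_pos he 240
    linarith

/-- First energy estimate, with the cut at `K = e⁻⁶`: high frequencies cost `m⁴ K^(-1/2) = m⁴ e³`,
low ones `(m e¹⁸)²`. The margins `2` in time and `1` in space leave room for the unit time step and
the unit ball. -/
theorem IsBump.exists_locEnergy_le_cube (hφ : IsBump φ) {c : ℝ} (hc : 0 ≤ c) :
    ∃ C : ℝ, 0 ≤ C ∧ ∀ {m e : ℝ} {U : ℝ → E3 → E3}, IsQuietFlow φ c m e U →
      ∀ {t : ℝ}, -(e ^ 240)⁻¹ + 2 ≤ t → t ≤ -e ^ 240 → ∀ x₀ : E3, ‖x₀‖ ≤ (e ^ 240)⁻¹ - 1 →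
      locEnergy (U t) x₀ ≤ ENNReal.ofReal (C * m ^ 4 * e ^ 3) := by
  obtain ⟨C₁, hC₁0, hC₁⟩ := hφ.exists_setLIntegral_sub_projLe_sq_le hc
  obtain ⟨C₂, hC₂0, hC₂⟩ := hφ.exists_norm_projLe_le_of_isQuietFlow (c := c)
  refine ⟨2 * C₁ + 10 * C₂ ^ 2, by positivity, fun {m e U} hU t ht1 ht2 x₀ hx₀ => ?_⟩
  have he := hU.pos
  have hm := hU.flow.one_le
  have hpos240 := pow_pos he 240
  have hK : 1 ≤ (e ^ 6)⁻¹ := by linarith [hU.four_le_inv_pow (k := 6) (by norm_num)]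
  have h1 := hC₁ hU.flow (t := t) (by linarith) (by linarith) hK x₀
  have hpt : ∀ x ∈ Metric.ball x₀ 1, ‖U t x‖ₑ ^ 2 ≤ ENNReal.ofReal 2 *
      ‖toC3 (U t x) - projLe φ (e ^ 6)⁻¹ (fun y => toC3 (U t y)) x‖ₑ ^ 2 +
      ENNReal.ofReal (2 * (C₂ * m * e ^ 18) ^ 2) := by
    intro x hx
    have hxn : ‖x‖ ≤ (e ^ 240)⁻¹ := by
      have h3 : ‖x - x₀‖ < 1 := by simpa [dist_eq_norm] using hx
      have h4 := norm_le_norm_add_norm_sub' x x₀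
      linarith
    have h2 := hC₂ hU (t := t) (by linarith) ht2 x hxn
    have h5 := enorm_add_sq_le (toC3 (U t x) - projLe φ (e ^ 6)⁻¹ (fun y => toC3 (U t y)) x)
      (projLe φ (e ^ 6)⁻¹ (fun y => toC3 (U t y)) x)
    rw [sub_add_cancel] at h5
    rw [enorm_sq_eq_toC3]
    refine h5.trans (add_le_add_right ?_ _)
    rw [← ofReal_norm (projLe φ _ _ _), ← ENNReal.ofReal_pow (norm_nonneg _),
      ← ENNReal.ofReal_mul (by norm_num)]
    refine ENNReal.ofReal_le_ofReal ?_
    have := pow_le_pow_left₀ (norm_nonneg _) h2 2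
    linarith
  refine (setLIntegral_mono' Metric.isOpen_ball.measurableSet hpt).trans ?_
  rw [lintegral_add_right _ measurable_const, lintegral_const_mul' _ _ ENNReal.ofReal_ne_top,
    setLIntegral_const]
  refine (add_le_add (mul_le_mul_right h1 _)
    (mul_le_mul_right (volume_ball_one_le x₀) _)).trans ?_
  rw [← ENNReal.ofReal_mul (by positivity), ← ENNReal.ofReal_mul (by positivity),
    ← ENNReal.ofReal_add (by positivity) (by positivity)]
  refine ENNReal.ofReal_le_ofReal ?_
  rw [show (6 : ℕ) = 2 * 3 by norm_num, sqrt_inv_pow_two_mul he, div_inv_eq_mul]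
  have h6 : e ^ 36 ≤ e ^ 3 := hU.pow_le (by norm_num)
  have h7 : m ^ 2 ≤ m ^ 4 := pow_le_pow_right₀ hm (by norm_num)
  calc 2 * (C₁ * m ^ 4 * e ^ 3) + 2 * (C₂ * m * e ^ 18) ^ 2 * 5
      = 2 * C₁ * m ^ 4 * e ^ 3 + 10 * C₂ ^ 2 * m ^ 2 * e ^ 36 := by ring
    _ ≤ 2 * C₁ * m ^ 4 * e ^ 3 + 10 * C₂ ^ 2 * m ^ 4 * e ^ 3 := by gcongr
    _ = _ := by ring

/-- The energy bound `e³` is fed back into Duhamel with `S = e⁻²⁴` and `ρ = e⁻²⁴⁰/4`. Restricting to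
half the time span and half the radius keeps all points used within the range of
`IsBump.exists_locEnergy_le_cube`. -/
theorem IsBump.exists_setLIntegral_proj_le_of_isQuietFlow (hφ : IsBump φ) {c : ℝ} (hc : 0 ≤ c) :
    ∃ C : ℝ, 0 ≤ C ∧ ∀ {m e : ℝ} {U : ℝ → E3 → E3}, IsQuietFlow φ c m e U →
      ∀ {t : ℝ}, -((e ^ 240)⁻¹ / 2) ≤ t → t ≤ -e ^ 240 → ∀ x₀ : E3, ‖x₀‖ ≤ (e ^ 240)⁻¹ / 2 →
      ∀ {N : ℝ}, 1 ≤ N → ∫⁻ x in Metric.ball x₀ 1, ‖proj φ N (U t) x‖ₑ ≤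
        ENNReal.ofReal (C * m ^ 4 * e ^ 3 / N) := by
  obtain ⟨C, hC0, hC⟩ := hφ.exists_locEnergy_le_cube hc
  have hT := majTail_nonneg
  have hI := majInt_nonneg
  refine ⟨c * (5 + (C * majInt + 276 * majTail)), by positivity,
    fun {m e U} hU t ht1 ht2 x₀ hx₀ N hN => ?_⟩
  have he := hU.pos
  have hm := hU.flow.one_le
  have hpos240 := pow_pos he 240
  obtain ⟨A, hA⟩ : ∃ A, A = (e ^ 240)⁻¹ := ⟨_, rfl⟩
  have hS : 4 * (e ^ 24)⁻¹ ≤ A := by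
    rw [hA, ← div_eq_mul_inv, div_le_iff₀ (by positivity), inv_mul_eq_div,
      le_div_iff₀ (by positivity)]
    exact hU.four_mul_pow_le (by norm_num)
  have hA16 : 16 ≤ A := by
    have h1 := hU.four_le_inv_pow (k := 24) (by norm_num)
    linarith
  have hA0 : 0 < A := by linarith
  rw [← hA] at ht1 hx₀
  have h := hU.flow.setLIntegral_proj_le hc (t := t) (S := (e ^ 24)⁻¹) (by positivity)
    (by rw [← hA]; linarith) (by linarith) hN x₀ (ρ := A / 4) (δ := C * m ^ 4 * e ^ 3)
    (by positivity) (by positivity) (fun r hr z hz => by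
      refine hC hU ?_ (hr.2.le.trans ht2) _ ?_
      · rw [← hA]
        linarith [hr.1]
      · rw [← hA]
        linarith [norm_add_le x₀ z])
  refine h.trans (ENNReal.ofReal_le_ofReal ?_)
  have h1 : 5 * m / (e ^ 24)⁻¹ ^ 2 = 5 * m * e ^ 48 := by field_simp
  have h2 : majTail / (A / 4) = 4 * majTail * e ^ 240 := by
    rw [hA]
    field_simp
  rw [h1, h2, div_le_div_iff_of_pos_right (by linarith)]
  have h3 : e ^ 48 ≤ e ^ 3 := hU.pow_le (by norm_num)
  have h4 : e ^ 240 ≤ e ^ 3 := hU.pow_le (by norm_num)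
  have h5 : m ^ 2 ≤ m ^ 4 := pow_le_pow_right₀ hm (by norm_num)
  have h6 : m ≤ m ^ 4 := le_self_pow₀ hm (by norm_num)
  calc c * (5 * m * e ^ 48 + (C * m ^ 4 * e ^ 3 * majInt + 69 * m ^ 2 * (4 * majTail * e ^ 240)))
      ≤ c * (5 * m ^ 4 * e ^ 3 + (C * m ^ 4 * e ^ 3 * majInt +
          69 * m ^ 4 * (4 * majTail * e ^ 3))) := by gcongr
    _ = _ := by ring

end NSLorentz

namespace NSLorentz

/-! ### Quiet flows vanish at unit frequency -/

variable {φ : E3 → ℝ}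

/-- `J` counts the dyadic steps from `e⁻⁶` up to a cutoff of size at least `e⁻⁶⁰` and at most
`e⁻¹¹⁴`, still in the quiet range. The true count is logarithmic in `e⁻¹`; the bound `54/e` suffices
and follows from `n + 1 ≤ 2^n ≤ e⁻¹`. -/
theorem IsQuietFlow.exists_two_pow {c m e : ℝ} {U : ℝ → E3 → E3} (hU : IsQuietFlow φ c m e U) :
    ∃ J : ℕ, (e ^ 54)⁻¹ ≤ (2 : ℝ) ^ J ∧ (2 : ℝ) ^ J ≤ (e ^ 108)⁻¹ ∧ (J : ℝ) ≤ 54 * e⁻¹ := by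
  have he := hU.pos
  have hh := hU.le_half
  obtain ⟨n, hn1, hn2⟩ := exists_nat_pow_near (x := e⁻¹)
    (one_le_inv_iff₀.2 ⟨he, by linarith⟩) one_lt_two
  refine ⟨(n + 1) * 54, ?_, ?_, ?_⟩
  · rw [pow_mul, ← inv_pow]
    exact pow_le_pow_left₀ (by positivity) hn2.le 54
  · rw [pow_mul, show (e ^ 108)⁻¹ = ((e ^ 2)⁻¹) ^ 54 by rw [inv_pow, ← pow_mul]]
    refine pow_le_pow_left₀ (by positivity) ?_ 54
    have h1 : 2 ≤ e⁻¹ := by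
      rw [le_inv_comm₀ (by norm_num) he]
      linarith
    rw [pow_succ, ← inv_pow, pow_two e⁻¹]
    exact mul_le_mul hn1 h1 (by norm_num) (by positivity)
  · have h1 : ((n + 1 : ℕ) : ℝ) ≤ 2 ^ n := by exact_mod_cast Nat.lt_two_pow_self
    push_cast at h1 ⊢
    linarith

theorem enorm_sum_sq_le (F : ℕ → C3) (J : ℕ) :
    ‖∑ j ∈ Finset.range J, F j‖ₑ ^ 2 ≤
      ENNReal.ofReal J * ∑ j ∈ Finset.range J, ‖F j‖ₑ ^ 2 := by
  have h1 : ∀ j ∈ Finset.range J, ‖F j‖ₑ ^ 2 = ENNReal.ofReal (‖F j‖ ^ 2) := by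
    intro j _
    rw [ENNReal.ofReal_pow (norm_nonneg _), ofReal_norm]
  rw [Finset.sum_congr rfl h1, ← ENNReal.ofReal_sum_of_nonneg (fun j _ => by positivity),
    ← ENNReal.ofReal_mul (by positivity), ← ofReal_norm, ← ENNReal.ofReal_pow (norm_nonneg _)]
  refine ENNReal.ofReal_le_ofReal ?_
  refine (pow_le_pow_left₀ (norm_nonneg _) (norm_sum_le _ _) 2).trans ?_
  simpa using sq_sum_le_card_mul_sum_sq (s := Finset.range J) (f := fun j => ‖F j‖)

/-- Second energy estimate. For the intermediate frequencies `|P_N u|²` is bounded by its quiet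
supremum `e²⁴N` times the `L¹` bound `m⁴e³/N`. The powers of `N` cancel, and the `J²` lost in the
sum turns `e²⁷` into `e²⁵`. -/
theorem IsBump.exists_locEnergy_le_of_isQuietFlow (hφ : IsBump φ) {c : ℝ} (hc : 0 ≤ c) :
    ∃ C : ℝ, 0 ≤ C ∧ ∀ {m e : ℝ} {U : ℝ → E3 → E3}, IsQuietFlow φ c m e U →
      ∀ {t : ℝ}, -((e ^ 240)⁻¹ / 2) ≤ t → t ≤ -e ^ 240 → ∀ x₀ : E3, ‖x₀‖ ≤ (e ^ 240)⁻¹ / 2 →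
      locEnergy (U t) x₀ ≤ ENNReal.ofReal (C * m ^ 4 * e ^ 25) := by
  obtain ⟨C₁, hC₁0, hC₁⟩ := hφ.exists_setLIntegral_sub_projLe_sq_le hc
  obtain ⟨C₂, hC₂0, hC₂⟩ := hφ.exists_norm_projLe_le_of_isQuietFlow (c := c)
  obtain ⟨C₃, hC₃0, hC₃⟩ := hφ.exists_setLIntegral_proj_le_of_isQuietFlow hc
  refine ⟨2 * C₁ + 4 * 54 ^ 2 * C₃ + 20 * C₂ ^ 2, by positivity,
    fun {m e U} hU t ht1 ht2 x₀ hx₀ => ?_⟩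
  have he := hU.pos
  have hm := hU.flow.one_le
  have hpos240 := pow_pos he 240
  have hw := hU.flow.isWeakL3 t
  have hA4 : 16 ≤ (e ^ 240)⁻¹ := by
    have h1 := hU.four_le_inv_pow (k := 2) le_rfl
    have h2 : (e ^ 2)⁻¹ * (e ^ 2)⁻¹ ≤ (e ^ 240)⁻¹ := by
      rw [← mul_inv, ← pow_add]
      exact hU.inv_pow_le (by norm_num)
    nlinarith
  obtain ⟨J, hJ1, hJ2, hJ3⟩ := hU.exists_two_pow
  obtain ⟨K, hK⟩ : ∃ K, K = (e ^ 6)⁻¹ := ⟨_, rfl⟩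
  have hK1 : 1 ≤ K := by
    rw [hK]
    linarith [hU.four_le_inv_pow (k := 6) (by norm_num)]
  have hL60 : (e ^ 60)⁻¹ ≤ 2 ^ J * K := by
    rw [hK, show (e ^ 60)⁻¹ = (e ^ 54)⁻¹ * (e ^ 6)⁻¹ by rw [← mul_inv, ← pow_add]]
    exact mul_le_mul_of_nonneg_right hJ1 (by positivity)
  have hLA : 2 ^ J * K ≤ (e ^ 240)⁻¹ := by
    refine (mul_le_mul_of_nonneg_right hJ2 (by positivity)).trans ?_
    rw [hK, ← mul_inv, ← pow_add]
    exact hU.inv_pow_le (by norm_num)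
  have hL1 : 1 ≤ 2 ^ J * K := by
    linarith [hU.four_le_inv_pow (k := 60) (by norm_num)]
  have h1 := hC₁ hU.flow (t := t) (by linarith) (by linarith) hL1 x₀
  have hfreq : ∀ j ∈ Finset.range J, 1 ≤ 2 ^ (j + 1) * K ∧ 2 ^ (j + 1) * K ≤ (e ^ 240)⁻¹ := by
    intro j hj
    have hj1 : j + 1 ≤ J := Finset.mem_range.1 hj
    have h3 : (1 : ℝ) ≤ 2 ^ (j + 1) := one_le_pow₀ (by norm_num)
    have h4 : (2 : ℝ) ^ (j + 1) ≤ 2 ^ J := pow_le_pow_right₀ (by norm_num) hj1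
    exact ⟨one_le_mul_of_one_le_of_one_le h3 hK1,
      (mul_le_mul_of_nonneg_right h4 (by linarith)).trans hLA⟩
  have hpt : ∀ x ∈ Metric.ball x₀ 1, ‖U t x‖ₑ ^ 2 ≤ ENNReal.ofReal 2 *
      ‖toC3 (U t x) - projLe φ (2 ^ J * K) (fun y => toC3 (U t y)) x‖ₑ ^ 2 +
      (∑ j ∈ Finset.range J, ENNReal.ofReal (4 * J * (e ^ 24 * (2 ^ (j + 1) * K))) *
          ‖proj φ (2 ^ (j + 1) * K) (U t) x‖ₑ +
        ENNReal.ofReal (4 * (C₂ * m * e ^ 18) ^ 2)) := by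
    intro x hx
    have hxn : ‖x‖ ≤ (e ^ 240)⁻¹ := by
      have h3 : ‖x - x₀‖ < 1 := by simpa [dist_eq_norm] using hx
      have h4 := norm_le_norm_add_norm_sub' x x₀
      linarith
    have h2 := hC₂ hU (t := t) (by linarith) ht2 x hxn
    rw [← hK] at h2
    have h5 := enorm_add_sq_le
      (toC3 (U t x) - projLe φ (2 ^ J * K) (fun y => toC3 (U t y)) x)
      (projLe φ (2 ^ J * K) (fun y => toC3 (U t y)) x)
    have h6 := enorm_add_sq_le
      (projLe φ (2 ^ J * K) (fun y => toC3 (U t y)) x - projLe φ K (fun y => toC3 (U t y)) x)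
      (projLe φ K (fun y => toC3 (U t y)) x)
    rw [sub_add_cancel] at h5 h6
    rw [enorm_sq_eq_toC3]
    refine h5.trans (add_le_add_right ((mul_le_mul_right h6 _).trans ?_) _)
    rw [mul_add, ← mul_assoc, ← mul_assoc, ← ENNReal.ofReal_mul (by norm_num)]
    norm_num only
    refine add_le_add ?_ ?_
    · rw [projLe_sub_projLe_eq_sum]
      refine (mul_le_mul_right (enorm_sum_sq_le _ J) _).trans ?_
      rw [← mul_assoc, ← ENNReal.ofReal_mul (by norm_num), Finset.mul_sum]
      refine Finset.sum_le_sum fun j hj => ?_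
      obtain ⟨hN1, hN2⟩ := hfreq j hj
      have h7 := hU.small t (by linarith) ht2 x hxn _
        ((hU.pow_le (Nat.zero_le 240)).trans (by simpa using hN1)) hN2
      rw [ENNReal.ofReal_mul (p := 4 * J) (by positivity), mul_assoc, pow_two]
      refine mul_le_mul_right (mul_le_mul_left ?_ _) _
      rw [← ofReal_norm]
      exact ENNReal.ofReal_le_ofReal h7
    · rw [← ofReal_norm, ← ENNReal.ofReal_pow (norm_nonneg _),
        ← ENNReal.ofReal_mul (by norm_num)]
      refine ENNReal.ofReal_le_ofReal ?_
      have := pow_le_pow_left₀ (norm_nonneg _) h2 2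
      linarith
  have hpm : ∀ j ∈ Finset.range J, Measurable fun x =>
      ENNReal.ofReal (4 * J * (e ^ 24 * (2 ^ (j + 1) * K))) *
        ‖proj φ (2 ^ (j + 1) * K) (U t) x‖ₑ := fun j _ =>
    (measurable_enorm_proj hφ hw.continuous (by positivity)).const_mul _
  have hhead : ∫⁻ x in Metric.ball x₀ 1, ∑ j ∈ Finset.range J,
      ENNReal.ofReal (4 * J * (e ^ 24 * (2 ^ (j + 1) * K))) *
        ‖proj φ (2 ^ (j + 1) * K) (U t) x‖ₑ ≤ ENNReal.ofReal (4 * 54 ^ 2 * C₃ * m ^ 4 * e ^ 25) := by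
    rw [lintegral_finsetSum _ hpm]
    have hj : ∀ j ∈ Finset.range J, ∫⁻ x in Metric.ball x₀ 1,
        ENNReal.ofReal (4 * J * (e ^ 24 * (2 ^ (j + 1) * K))) *
          ‖proj φ (2 ^ (j + 1) * K) (U t) x‖ₑ ≤
        ENNReal.ofReal (4 * J * C₃ * m ^ 4 * e ^ 27) := by
      intro j hj
      rw [lintegral_const_mul' _ _ ENNReal.ofReal_ne_top]
      refine (mul_le_mul_right (hC₃ hU ht1 ht2 x₀ hx₀ (hfreq j hj).1) _).trans ?_
      rw [← ENNReal.ofReal_mul (by positivity)]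
      refine ENNReal.ofReal_le_ofReal (le_of_eq ?_)
      have hKp : 0 < K := by linarith
      field_simp
    refine (Finset.sum_le_sum hj).trans ?_
    rw [Finset.sum_const, Finset.card_range, nsmul_eq_mul, ← ENNReal.ofReal_natCast,
      ← ENNReal.ofReal_mul (by positivity)]
    refine ENNReal.ofReal_le_ofReal ?_
    have h8 : (J : ℝ) ^ 2 ≤ (54 * e⁻¹) ^ 2 := pow_le_pow_left₀ (by positivity) hJ3 2
    calc (J : ℝ) * (4 * J * C₃ * m ^ 4 * e ^ 27) = J ^ 2 * (4 * C₃ * m ^ 4 * e ^ 27) := by ring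
      _ ≤ (54 * e⁻¹) ^ 2 * (4 * C₃ * m ^ 4 * e ^ 27) :=
          mul_le_mul_of_nonneg_right h8 (by positivity)
      _ = _ := by
          field_simp
  refine (setLIntegral_mono' Metric.isOpen_ball.measurableSet hpt).trans ?_
  rw [lintegral_add_right _ ((Finset.measurable_fun_sum _ hpm).add_const _),
    lintegral_add_right _ measurable_const, lintegral_const_mul' _ _ ENNReal.ofReal_ne_top,
    setLIntegral_const]
  refine (add_le_add (mul_le_mul_right h1 _)
    (add_le_add hhead (mul_le_mul_right (volume_ball_one_le x₀) _))).trans ?_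
  rw [← ENNReal.ofReal_mul (by positivity), ← ENNReal.ofReal_mul (by positivity),
    ← ENNReal.ofReal_add (by positivity) (by positivity),
    ← ENNReal.ofReal_add (by positivity) (by positivity)]
  refine ENNReal.ofReal_le_ofReal ?_
  -- The cutoff was pushed to `e⁻⁶⁰` so that the high-frequency tail falls below `e²⁵`.
  have h9 : (e ^ 30)⁻¹ ≤ √(2 ^ J * K) := by
    rw [← sqrt_inv_pow_two_mul he]
    exact Real.sqrt_le_sqrt hL60
  have h10 : C₁ * m ^ 4 / √(2 ^ J * K) ≤ C₁ * m ^ 4 * e ^ 25 := by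
    calc C₁ * m ^ 4 / √(2 ^ J * K) ≤ C₁ * m ^ 4 / (e ^ 30)⁻¹ :=
          div_le_div_of_nonneg_left (by positivity) (by positivity) h9
      _ = C₁ * m ^ 4 * e ^ 30 := div_inv_eq_mul _ _
      _ ≤ _ := mul_le_mul_of_nonneg_left (hU.pow_le (by norm_num)) (by positivity)
  have h11 : e ^ 36 ≤ e ^ 25 := hU.pow_le (by norm_num)
  have h12 : m ^ 2 ≤ m ^ 4 := pow_le_pow_right₀ hm (by norm_num)
  have h13 : 4 * (C₂ * m * e ^ 18) ^ 2 * 5 ≤ 20 * C₂ ^ 2 * m ^ 4 * e ^ 25 := by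
    calc 4 * (C₂ * m * e ^ 18) ^ 2 * 5 = 20 * C₂ ^ 2 * m ^ 2 * e ^ 36 := by ring
      _ ≤ _ := by gcongr
  linarith

/-- Duhamel over the time span `e⁻²⁴`: the free term is `O(m e⁴⁸)`, the quiet times contribute the
local energy `e²⁵` plus a spatial tail `O(m² e²⁴⁰)`, and the last stretch of length at most `e²⁴⁰`
is paid for by the trivial energy bound. -/
theorem IsBump.exists_norm_proj_one_le_of_isQuietFlow (hφ : IsBump φ) {c : ℝ} (hc : 0 ≤ c) :
    ∃ C : ℝ, 0 ≤ C ∧ ∀ {m e : ℝ} {U : ℝ → E3 → E3}, IsQuietFlow φ c m e U →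
      ∀ {t : ℝ}, -e ^ 240 < t → t < 0 → ‖proj φ 1 (U t) 0‖ ≤ C * m ^ 4 * e ^ 25 := by
  obtain ⟨C, hC0, hC⟩ := hφ.exists_locEnergy_le_of_isQuietFlow hc
  have hT := majTail_nonneg
  have hI := majInt_nonneg
  refine ⟨c * (1 + 32 * (C * majInt + 138 * majTail + 69 * majInt)), by positivity,
    fun {m e U} hU t ht1 ht2 => ?_⟩
  have he := hU.pos
  have hm := hU.flow.one_le
  have hpos240 := pow_pos he 240
  have hpos24 := pow_pos he 24
  obtain ⟨A, hA⟩ : ∃ A, A = (e ^ 240)⁻¹ := ⟨_, rfl⟩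
  have hS : 4 * (e ^ 24)⁻¹ ≤ A := by
    rw [hA, ← div_eq_mul_inv, div_le_iff₀ (by positivity), inv_mul_eq_div,
      le_div_iff₀ (by positivity)]
    exact hU.four_mul_pow_le (by norm_num)
  have hA16 : 16 ≤ A := by
    have h1 := hU.four_le_inv_pow (k := 24) (by norm_num)
    linarith
  have he1 : e ^ 240 ≤ 1 := by simpa using hU.pow_le (Nat.zero_le 240)
  have hS0 : 0 < (e ^ 24)⁻¹ := by positivity
  obtain ⟨G, hG⟩ : ∃ G, G = 32 * (C * m ^ 4 * e ^ 25 * majInt +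
    69 * m ^ 2 * (majTail / (1 * (A / 2)))) := ⟨_, rfl⟩
  obtain ⟨D, hD⟩ : ∃ D, D = 32 * (69 * m ^ 2 * majInt) := ⟨_, rfl⟩
  have hA0 : 0 < A := by linarith
  have hG0 : 0 ≤ G := by rw [hG]; positivity
  have hD0 : 0 ≤ D := by rw [hD]; positivity
  -- `G` bounds the quadratic density at quiet times; `D` below is its trivial bound at all times.
  have hquiet : ∀ r ∈ Ioo (t - (e ^ 24)⁻¹) t, r ≤ -e ^ 240 →
      ∫⁻ y, ENNReal.ofReal (maj 1 (y - 0)) * ‖U r y‖ₑ ^ 2 ≤ ENNReal.ofReal G := by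
    intro r hr hr2
    refine (lintegral_maj_mul_sq_le_locEnergy (hU.flow.isWeakL3 r).continuous).trans ?_
    rw [hG, ENNReal.ofReal_mul (by norm_num)]
    refine mul_le_mul_right (lintegral_maj_mul_le_of_split one_pos (by positivity) (by positivity)
      (by positivity) (fun z hz => ?_) (fun z => (hU.flow.isWeakL3 r).locEnergy_le z)) _
    refine hC hU ?_ hr2 z ?_
    · rw [← hA]
      linarith [hr.1]
    · rw [← hA]
      exact hz.le
  have hall : ∀ r, ∫⁻ y, ENNReal.ofReal (maj 1 (y - 0)) * ‖U r y‖ₑ ^ 2 ≤ ENNReal.ofReal D := by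
    intro r
    refine (lintegral_maj_mul_sq_le_locEnergy (hU.flow.isWeakL3 r).continuous).trans ?_
    rw [hD, ENNReal.ofReal_mul (by norm_num)]
    refine mul_le_mul_right ((lintegral_mono fun z => mul_le_mul_right
      ((hU.flow.isWeakL3 r).locEnergy_le z) _).trans (le_of_eq ?_)) _
    rw [lintegral_mul_const' _ _ ENNReal.ofReal_ne_top, lintegral_maj one_pos, mul_comm,
      ← ENNReal.ofReal_mul (by positivity)]
  have hweight : ∀ r ∈ Ioo (t - (e ^ 24)⁻¹) t, timeWeight 1 t r ≤ 1 := by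
    intro r hr
    rw [timeWeight, ← ENNReal.ofReal_one]
    refine ENNReal.ofReal_le_ofReal ?_
    rw [one_mul, one_pow, one_mul]
    exact inv_le_one_of_one_le₀ (one_le_pow₀ (by linarith [hr.2]))
  have hint : duhamelInt 1 (t - (e ^ 24)⁻¹) t (fun r y => ‖U r y‖ₑ ^ 2) 0 ≤
      ENNReal.ofReal (G + D * e ^ 240) := by
    have h1 : ∀ r ∈ Ioo (t - (e ^ 24)⁻¹) t, timeWeight 1 t r *
        ∫⁻ y, ENNReal.ofReal (maj 1 (y - 0)) * ‖U r y‖ₑ ^ 2 ≤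
        timeWeight 1 t r * ENNReal.ofReal G +
          (Ioo (-e ^ 240) t).indicator (fun _ => ENNReal.ofReal D) r := by
      intro r hr
      by_cases hr2 : r ≤ -e ^ 240
      · exact (mul_le_mul_right (hquiet r hr hr2) _).trans le_self_add
      · rw [indicator_of_mem (show r ∈ Ioo (-e ^ 240) t from ⟨not_le.1 hr2, hr.2⟩)]
        exact (mul_le_of_le_one_left zero_le (hweight r hr)).trans ((hall r).trans le_add_self)
    refine (setLIntegral_mono' measurableSet_Ioo h1).trans ?_
    rw [lintegral_add_right _ (measurable_const.indicator measurableSet_Ioo),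
      ENNReal.ofReal_add hG0 (by positivity)]
    refine add_le_add ?_ ?_
    · have := setLIntegral_timeWeight_mul_le (g := fun _ => ENNReal.ofReal G) one_pos
        (show t - (e ^ 24)⁻¹ < t by linarith) (fun _ _ => le_rfl)
      rwa [div_one] at this
    · refine (setLIntegral_le_lintegral _ _).trans ?_
      rw [lintegral_indicator measurableSet_Ioo, setLIntegral_const, Real.volume_Ioo,
        ENNReal.ofReal_mul hD0]
      exact mul_le_mul_right (ENNReal.ofReal_le_ofReal (by linarith)) _
  have h := (hU.flow.duhamel_sub hc hS0 (by rw [← hA]; linarith) ht2 le_rfl 0).trans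
    (add_le_add_right (mul_le_mul_right hint _) _)
  rw [← ENNReal.ofReal_mul hc, ← ENNReal.ofReal_add (by positivity) (by positivity),
    ← ofReal_norm] at h
  refine ((ENNReal.ofReal_le_ofReal_iff (by positivity)).1 h).trans ?_
  have h1 : c * m / (1 * (e ^ 24)⁻¹ ^ 2) = c * (m * e ^ 48) := by field_simp
  have h2 : majTail / (1 * (A / 2)) = 2 * majTail * e ^ 240 := by
    rw [hA]
    field_simp
  rw [h1, hG, hD, h2, ← mul_add, mul_assoc c, mul_assoc c]
  refine mul_le_mul_of_nonneg_left ?_ hc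
  have h3 : e ^ 48 ≤ e ^ 25 := hU.pow_le (by norm_num)
  have h4 : e ^ 240 ≤ e ^ 25 := hU.pow_le (by norm_num)
  have h5 : m ^ 2 ≤ m ^ 4 := pow_le_pow_right₀ hm (by norm_num)
  have h6 : m ≤ m ^ 4 := le_self_pow₀ hm (by norm_num)
  calc m * e ^ 48 + (32 * (C * m ^ 4 * e ^ 25 * majInt + 69 * m ^ 2 * (2 * majTail * e ^ 240)) +
        32 * (69 * m ^ 2 * majInt) * e ^ 240)
      ≤ m ^ 4 * e ^ 25 + (32 * (C * m ^ 4 * e ^ 25 * majInt +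
          69 * m ^ 4 * (2 * majTail * e ^ 25)) + 32 * (69 * m ^ 4 * majInt) * e ^ 25) := by
        gcongr
    _ = _ := by ring

end NSLorentz

namespace NSLorentz

/-! ### Back propagation -/

variable {φ : E3 → ℝ}

/-- Freezing the solution outside `[a, b]` makes continuity, and hence measurability, and the weak
`L³` bound global in time; on `(a, b)` nothing changes. -/
theorem IsBump.exists_isDuhamelFlow (hφ : IsBump φ) :
    ∃ c : ℝ, 0 ≤ c ∧ ∀ {a b : ℝ} {v : ℝ → E3 → E3} {p : ℝ → E3 → ℝ} {m : ℝ},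
      IsClassicalSolution a b v p → a ≤ b → (∀ t ∈ Icc a b, IsWeakL3 m (v t)) → 1 ≤ m →
      ∀ {a' b' : ℝ}, a ≤ a' → b' ≤ b →
      IsDuhamelFlow φ c m a' b' fun r => v (max a (min r b)) := by
  obtain ⟨c, hc0, hc⟩ := hφ.exists_duhamel
  refine ⟨c, hc0, fun {a b v p m} hv hab hw hm a' b' ha hb => ?_⟩
  have hmem : ∀ r, max a (min r b) ∈ Icc a b := fun r =>
    ⟨le_max_left _ _, max_le hab (min_le_right _ _)⟩
  have hid : ∀ r, a < r → r < b → max a (min r b) = r := fun r h1 h2 => by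
    rw [min_eq_left h2.le, max_eq_right h1.le]
  refine ⟨hm, ?_, fun t => hw _ (hmem t), ?_⟩
  · exact hv.continuousOn_u.comp_continuous
      (f := fun z : ℝ × E3 => (max a (min z.1 b), z.2)) (by fun_prop)
      fun z => ⟨hmem z.1, mem_univ _⟩
  · intro s t has hst htb N hN x
    have h := hc hv (fun r hr => hw r (Ioo_subset_Icc_self hr)) (ha.trans_lt has) hst
      (htb.trans_le hb) hN x
    rw [hid t (by linarith) (by linarith)]
    refine h.trans (le_of_eq ?_)
    congr 2
    refine setLIntegral_congr_fun measurableSet_Ioo fun r hr => ?_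
    simp only [timeWeight]
    rw [hid r (by linarith [hr.1]) (by linarith [hr.2])]

/-- Time `0` may be the right endpoint of the interval, where the equation is not assumed. The bound
is proved for `t < 0` and passes to the limit by continuity of `P_1 v` in time. -/
theorem IsBump.exists_norm_proj_one_le (hφ : IsBump φ) :
    ∃ C : ℝ, 0 ≤ C ∧ ∀ {a b : ℝ} {v : ℝ → E3 → E3} {p : ℝ → E3 → ℝ} {m e : ℝ},
      IsClassicalSolution a b v p → (∀ t ∈ Icc a b, IsWeakL3 m (v t)) → 1 ≤ m → 0 < e →
      e ≤ 1 / 2 → a ≤ -(e ^ 240)⁻¹ → 0 ≤ b →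
      (∀ t, -(e ^ 240)⁻¹ ≤ t → t ≤ -e ^ 240 → ∀ x : E3, ‖x‖ ≤ (e ^ 240)⁻¹ →
        ∀ N, e ^ 240 ≤ N → N ≤ (e ^ 240)⁻¹ → ‖proj φ N (v t) x‖ ≤ e ^ 24 * N) →
      ‖proj φ 1 (v 0) 0‖ ≤ C * m ^ 4 * e ^ 25 := by
  obtain ⟨c, hc0, hc⟩ := hφ.exists_isDuhamelFlow
  obtain ⟨C, hC0, hC⟩ := hφ.exists_norm_proj_one_le_of_isQuietFlow hc0
  refine ⟨C, hC0, fun {a b v p m e} hv hw hm he hh ha hb hsmall => ?_⟩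
  have h240 : 0 < e ^ 240 := by positivity
  have hinv : e ^ 240 < (e ^ 240)⁻¹ := by
    have h1 : e ^ 240 < 1 := pow_lt_one₀ he.le (by linarith) (by norm_num)
    exact h1.trans ((one_lt_inv₀ h240).2 h1)
  have hid : ∀ r, a ≤ r → r ≤ b → max a (min r b) = r := fun r h1 h2 => by
    rw [min_eq_left h2, max_eq_right h1]
  have hU : IsQuietFlow φ c m e fun r => v (max a (min r b)) := by
    refine ⟨hc hv (by linarith) hw hm ha hb, he, hh, fun t h1 h2 => ?_⟩
    rw [hid t (by linarith) (by linarith)]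
    exact hsmall t h1 h2
  have hcont := ((hv.continuousOn_proj hφ hw one_pos 0) 0 ⟨by linarith, hb⟩).mono
    (show Ioo (-e ^ 240) 0 ⊆ Icc a b from fun r hr => ⟨by linarith [hr.1], by linarith [hr.2]⟩)
  have : (nhdsWithin (0 : ℝ) (Ioo (-e ^ 240) 0)).NeBot :=
    right_nhdsWithin_Ioo_neBot (by linarith)
  refine le_of_tendsto hcont.norm ?_
  filter_upwards [self_mem_nhdsWithin] with t ht
  have h := hC hU ht.1 ht.2
  rwa [hid t (by linarith [ht.1]) (by linarith [ht.2])] at h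

/-! ### The hierarchy of constants -/

theorem Mlevel_le_Mlevel {C₀ M : ℝ} (hC₀ : 1 ≤ C₀) (hM : 1 ≤ M) {j k : ℕ} (h : j ≤ k) :
    Mlevel C₀ M j ≤ Mlevel C₀ M k :=
  Real.rpow_le_rpow_of_exponent_le hM (pow_le_pow_right₀ hC₀ h)

/-- The number `e = M^(-C₀/24)`, normalised so that `M₁⁻¹ = e²⁴`. -/
theorem exists_pow_eq_Mlevel {K C₀ M : ℝ} (hK : 0 ≤ K) (hC₀ : 120 + 16 * K ≤ C₀) (hM : C₀ ≤ M) :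
    ∃ e : ℝ, 0 < e ∧ e ≤ 1 / 2 ∧ (Mlevel C₀ M 1)⁻¹ = e ^ 24 ∧ (e ^ 240)⁻¹ ≤ Mlevel C₀ M 2 ∧
      K * (2 * M) ^ 4 * e ^ 25 < e ^ 24 := by
  have hM0 : 0 < M := by linarith
  have hM1 : 1 ≤ M := by linarith
  -- This is where `C₀ ≥ 120` is used. Then `K(2M)⁴e ≤ 16K/M`, which is below `1` because `M ≥ C₀ ≥
  -- 120 + 16K`.
  have he5 : M ^ (-(C₀ / 24)) ≤ (M ^ 5)⁻¹ := by
    rw [← Real.rpow_natCast, ← Real.rpow_neg hM0.le]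
    refine Real.rpow_le_rpow_of_exponent_le hM1 ?_
    push_cast
    linarith
  have hpow : ∀ k : ℕ, (M ^ (-(C₀ / 24))) ^ k = M ^ (-(C₀ / 24) * k) := fun k => by
    rw [← Real.rpow_natCast, ← Real.rpow_mul hM0.le]
  refine ⟨M ^ (-(C₀ / 24)), by positivity, ?_, ?_, ?_, ?_⟩
  · refine he5.trans ?_
    rw [one_div]
    refine inv_anti₀ (by norm_num) ?_
    have := le_self_pow₀ hM1 (n := 5) (by norm_num)
    linarith
  · rw [hpow, Mlevel, ← Real.rpow_neg hM0.le]
    congr 1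
    push_cast
    ring
  -- `e⁻²⁴⁰ = M^(10C₀)`, and `10C₀ ≤ C₀²`.
  · rw [hpow, Mlevel, ← Real.rpow_neg hM0.le]
    refine Real.rpow_le_rpow_of_exponent_le hM1 ?_
    push_cast
    nlinarith
  · have h1 : 0 < M ^ (-(C₀ / 24)) := by positivity
    have h2 : K * (2 * M) ^ 4 * M ^ (-(C₀ / 24)) < 1 := by
      calc K * (2 * M) ^ 4 * M ^ (-(C₀ / 24)) ≤ K * (2 * M) ^ 4 * (M ^ 5)⁻¹ := by gcongr
        _ = 16 * K / M := by
            field_simp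
            ring
        _ < 1 := by
            rw [div_lt_one hM0]
            linarith
    calc K * (2 * M) ^ 4 * (M ^ (-(C₀ / 24))) ^ 25
        = K * (2 * M) ^ 4 * M ^ (-(C₀ / 24)) * (M ^ (-(C₀ / 24))) ^ 24 := by ring
      _ < 1 * (M ^ (-(C₀ / 24))) ^ 24 := by gcongr
      _ = _ := one_mul _

end NSLorentz

/-! ### Conclusion: rescaling and contradiction -/

theorem mainTheorem5 (φ : NSLorentz.E3 → ℝ) (hφ : NSLorentz.IsBump φ) :
    ∃ C : ℝ, 1 ≤ C ∧ ∀ C₀ : ℝ, C ≤ C₀ →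
      ∀ (q₀ M t₀ T : ℝ), 3 ≤ q₀ → C₀ ≤ M → 0 < T →
      ∀ (u : ℝ → NSLorentz.E3 → NSLorentz.E3) (p : ℝ → NSLorentz.E3 → ℝ),
        NSLorentz.IsClassicalSolution (t₀ - T) t₀ u p →
        NSLorentz.supLorentzNorm 3 q₀ (t₀ - T) t₀ u ≤ ENNReal.ofReal M →
        ∀ (t₁ : ℝ) (x₁ : NSLorentz.E3) (N₁ : ℝ),
          t₁ ∈ Set.Icc (t₀ - T / 2) t₀ →
          NSLorentz.Mlevel C₀ M 3 * T ^ (-(1 / 2) : ℝ) ≤ N₁ →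
          (NSLorentz.Mlevel C₀ M 1)⁻¹ * N₁ ≤ ‖NSLorentz.proj φ N₁ (u t₁) x₁‖ →
          ∃ (t₂ : ℝ) (x₂ : NSLorentz.E3) (N₂ : ℝ),
            t₂ ∈ Set.Icc (t₀ - T) t₁ ∧
            N₂ ∈ Set.Icc ((NSLorentz.Mlevel C₀ M 2)⁻¹ * N₁) (NSLorentz.Mlevel C₀ M 2 * N₁) ∧
            (NSLorentz.Mlevel C₀ M 3)⁻¹ * (N₁ ^ 2)⁻¹ ≤ t₁ - t₂ ∧
            t₁ - t₂ ≤ NSLorentz.Mlevel C₀ M 3 * (N₁ ^ 2)⁻¹ ∧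
            ‖x₂ - x₁‖ ≤ NSLorentz.Mlevel C₀ M 3 * N₁⁻¹ ∧
            (NSLorentz.Mlevel C₀ M 1)⁻¹ * N₂ ≤ ‖NSLorentz.proj φ N₂ (u t₂) x₂‖ := by
  open NSLorentz in
  obtain ⟨K, hK0, hK⟩ := hφ.exists_norm_proj_one_le
  refine ⟨120 + 16 * K, by linarith, ?_⟩
  intro C₀ hC₀ q₀ M t₀ T hq hM hT u p hu hsup t₁ x₁ N₁ ht₁ hN₁ hbig
  obtain ⟨e, he, hh, he24, he240, hsmall⟩ := exists_pow_eq_Mlevel hK0 hC₀ hM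
  have hC1 : 1 ≤ C₀ := by linarith
  have hM1 : 1 ≤ M := by linarith
  have hM23 : Mlevel C₀ M 2 ≤ Mlevel C₀ M 3 := Mlevel_le_Mlevel hC1 hM1 (by norm_num)
  have h240 : 0 < e ^ 240 := by positivity
  have hA2 : 2 ≤ (e ^ 240)⁻¹ := by
    rw [le_inv_comm₀ (by norm_num) h240, inv_eq_one_div]
    exact (pow_le_of_le_one he.le (by linarith) (by norm_num)).trans hh
  have hM2 : 0 < Mlevel C₀ M 2 := by linarith
  have hM3 : 0 < Mlevel C₀ M 3 := by linarith
  have hTr : 0 < T ^ (-(1 / 2) : ℝ) := Real.rpow_pos_of_pos hT _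
  have hN0 : 0 < N₁ := (mul_pos hM3 hTr).trans_le hN₁
  have hl : 0 < N₁⁻¹ := inv_pos.2 hN0
  -- The lower bound on `N₁` says `T N₁² ≥ M₃²`. After rescaling, the solution therefore exists for
  -- a time at least `M₃²/2 ≥ M₃ ≥ e⁻²⁴⁰` before time `0`.
  have hTN : (e ^ 240)⁻¹ ≤ T / 2 * N₁ ^ 2 := by
    have h1 : (T ^ (-(1 / 2) : ℝ)) ^ 2 = T⁻¹ := by
      rw [← Real.rpow_natCast, ← Real.rpow_mul hT.le, ← Real.rpow_neg_one]
      norm_num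
    have h2 := pow_le_pow_left₀ (by positivity) hN₁ 2
    rw [mul_pow, h1] at h2
    have h3 : Mlevel C₀ M 3 ^ 2 ≤ T * N₁ ^ 2 := by
      have := mul_le_mul_of_nonneg_left h2 hT.le
      rwa [mul_left_comm, mul_inv_cancel₀ hT.ne', mul_one] at this
    nlinarith
  have hdiv : ∀ r : ℝ, r / N₁⁻¹ ^ 2 = N₁ ^ 2 * r := fun r => by field_simp
  have hsol := hu.scale hl t₁ x₁
  simp only [hdiv] at hsol
  have hback : ∀ r ∈ Set.Icc (N₁ ^ 2 * (t₀ - T - t₁)) (N₁ ^ 2 * (t₀ - t₁)),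
      t₁ + N₁⁻¹ ^ 2 * r ∈ Set.Icc (t₀ - T) t₀ := by
    intro r hr
    have e1 : N₁⁻¹ ^ 2 * r = r / N₁ ^ 2 := by field_simp
    have h1 : t₀ - T - t₁ ≤ r / N₁ ^ 2 := (le_div_iff₀ (by positivity)).2 (by linarith [hr.1])
    have h2 : r / N₁ ^ 2 ≤ t₀ - t₁ := (div_le_iff₀ (by positivity)).2 (by linarith [hr.2])
    rw [e1]
    constructor <;> linarith
  have ha : N₁ ^ 2 * (t₀ - T - t₁) ≤ -(e ^ 240)⁻¹ := by
    have h1 : N₁ ^ 2 * (t₀ - T - t₁) ≤ N₁ ^ 2 * (-(T / 2)) :=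
      mul_le_mul_of_nonneg_left (by linarith [ht₁.1]) (by positivity)
    linarith
  have hb : 0 ≤ N₁ ^ 2 * (t₀ - t₁) := mul_nonneg (by positivity) (by linarith [ht₁.2])
  have hscale : ∀ {N : ℝ}, 0 < N → ∀ (r : ℝ) (x : E3),
      ‖proj φ N (scaleVel N₁⁻¹ t₁ x₁ u r) x‖ =
        N₁⁻¹ * ‖proj φ (N * N₁) (u (t₁ + N₁⁻¹ ^ 2 * r)) (x₁ + N₁⁻¹ • x)‖ := by
    intro N hN r x
    have h := proj_scale (φ := φ) (v := u (t₁ + N₁⁻¹ ^ 2 * r)) hN hl x₁ x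
    rw [div_inv_eq_mul] at h
    have h1 := congrArg norm h
    rwa [norm_smul, Complex.norm_real, Real.norm_eq_abs, abs_of_pos hl] at h1
  by_contra hno
  -- A failure of quietness at `(t, x, N)` in the rescaled picture, scaled back, is exactly a triple
  -- `(t₂, x₂, N₂)` as required. The windows in `e⁻²⁴⁰` fit those in `M₃` because `e⁻²⁴⁰ ≤ M₂ ≤ M₃`.
  have key := hK hsol (m := 2 * M) (fun r hr =>
    (hu.isWeakL3 (by linarith) hq (by linarith) hsup (hback r hr)).scale hl x₁)
    (by linarith) he hh ha hb (fun t ht1 ht2 x hx N hN1 hN2 => by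
      by_contra hlt
      have hNpos : 0 < N := by linarith
      rw [not_le, hscale hNpos, ← he24] at hlt
      have htm := hback t ⟨by linarith, by linarith⟩
      have et : t₁ - (t₁ + N₁⁻¹ ^ 2 * t) = -t * (N₁ ^ 2)⁻¹ := by
        rw [inv_pow]
        ring
      have hq2 : 0 < (N₁ ^ 2)⁻¹ := by positivity
      refine hno ⟨t₁ + N₁⁻¹ ^ 2 * t, x₁ + N₁⁻¹ • x, N * N₁, ⟨htm.1, ?_⟩, ⟨?_, ?_⟩, ?_, ?_, ?_, ?_⟩
      · have : N₁⁻¹ ^ 2 * t ≤ 0 := mul_nonpos_of_nonneg_of_nonpos (by positivity) (by linarith)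
        linarith
      · refine mul_le_mul_of_nonneg_right ?_ hN0.le
        exact (inv_le_of_inv_le₀ h240 he240).trans hN1
      · exact mul_le_mul_of_nonneg_right (hN2.trans he240) hN0.le
      · rw [et]
        refine mul_le_mul_of_nonneg_right ?_ hq2.le
        have := inv_le_of_inv_le₀ h240 (he240.trans hM23)
        linarith
      · rw [et]
        refine mul_le_mul_of_nonneg_right ?_ hq2.le
        linarith
      · rw [add_sub_cancel_left, norm_smul, Real.norm_eq_abs, abs_of_pos hl, mul_comm]
        refine mul_le_mul_of_nonneg_right ?_ hl.le
        linarith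
      · have h1 := mul_le_mul_of_nonneg_left hlt.le hN0.le
        rw [mul_inv_cancel_left₀ hN0.ne'] at h1
        linarith)
  rw [hscale one_pos, mul_zero, smul_zero, add_zero, add_zero, one_mul] at key
  have h1 := mul_le_mul_of_nonneg_left hbig hl.le
  rw [he24, mul_left_comm, inv_mul_cancel₀ hN0.ne', mul_one] at h1
  linarith
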